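/- Let $\phi=\frac{1+\sqrt5}{2}$. Let $m,n,k$ be positive integers with $m\le n$ (without loss of generality), $n\ge 4$, $k\ge n=\max\{m,n\}$ and $k\mid mn$, and put $A=mn/k$, $a=\lfloor\sqrt A\rfloor$. Consider the rectangular grid graph with $m$ rows and $n$ columns. The perimeter of a set of vertices (unit cells) is the number of unit sides of its cells that are not shared by two of its cells, sides on the border of the grid included; the total perimeter of a partition is the sum of the perimeters of its parts. $\phi$-Cautious Striping is the following procedure (for $k\mid mn$). (1) Write $m=da+r$ with $0\le r<a$. Divide the rows into horizontal strips: if $r\le d$, strips of height $a$ followed, below, by strips of height $a+1$; if $r>d$, strips of height $a$ and a last strip, of height $r$ if $r>\lfloor a/\phi\rfloor$ and of height $a+r$ otherwise. Let $S_2$ be this last strip (empty if $r\le d$) and $S_1$ the set of the other strips. (2) In each strip of $S_1$, take the cells column by column from left to right, each column from top to bottom, and cut off parts of $A$ consecutive cells until, for the first time, the number of unpartitioned columns is in $[\lfloor a/\phi\rfloor,\lceil\phi a\rceil]$. (3) Let $R$ be the set of unpartitioned cells of $S_1$. Take its cells row by row from top to bottom, each row from right to left or from left to right, and (4) then the cells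 of $S_2$ column by column from right to left, each column downwards or upwards; every $A$ consecutive cells of this sequence form a part. The numbers of strips of the two heights in (1) and the directions in (3) and (4) are chosen so that the parts are contiguous (induce connected subgraphs). Then such choices exist, so $\phi$-Cautious Striping gives a partition into $k$ contiguous parts; every partition that it gives is exactly balanced (each part has $A$ vertices). Moreover, there is an absolute constant $C$ such that for all such $m,n,k$ every partition that it gives has total perimeter at most $$1+\frac{1}{\lceil 2\sqrt A\rceil}+\frac{\lceil\phi\sqrt A\rceil\left(\frac{\sqrt5}{2}-1\right)+C}{n}$$ times the minimum total perimeter of a partition of the grid into $k$ parts with $A$ vertices each, and also at most $1.69$ times this minimum. -/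

import Mathlib

open scoped goldenRatio

namespace GridStriping

/-- The vertices of the `m × n` grid graph: row `v.1` (counted from the top), column `v.2` (counted
from the left). A vertex is also thought of as a unit square cell. -/
abbrev Cell (m n : ℕ) : Type := Fin m × Fin n

/-- The rectangular grid graph with `m` rows and `n` columns. -/
abbrev gridGraph (m n : ℕ) : SimpleGraph (Cell m n) :=
  (SimpleGraph.pathGraph m).boxProd (SimpleGraph.pathGraph n)

/-- The `i`-th part of the partition `f` of the grid into `k` labelled parts. -/
def part {m n k : ℕ} (f : Cell m n → Fin k) (i : Fin k) : Finset (Cell m n) :=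
  Finset.univ.filter fun v => f v = i

/-- Perimeter of a set of cells: of the four unit sides of every cell, count those that are not
shared with another cell of the set (so sides on the border of the grid do count). -/
noncomputable def perimeter {m n : ℕ} (S : Finset (Cell m n)) : ℕ :=
  ∑ v ∈ S, (4 - {w | w ∈ S ∧ (gridGraph m n).Adj v w}.ncard)

/-- Sum of the perimeters of the parts. -/
noncomputable def totalPerimeter {m n k : ℕ} (f : Cell m n → Fin k) : ℕ :=
  ∑ i, perimeter (part f i)

/-- Exact balance: all `k` parts have the same number `m * n / k` of cells. -/
def IsBalanced {m n k : ℕ} (f : Cell m n → Fin k) : Prop :=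
  ∀ i, k * (part f i).card = m * n

/-- Every part induces a connected (in particular non-empty) subgraph of the grid graph. -/
def IsContiguous {m n k : ℕ} (f : Cell m n → Fin k) : Prop :=
  ∀ i, ((gridGraph m n).induce {v | f v = i}).Connected

/-- A horizontal subdivision of the rows: from top to bottom, `s₁` strips of height `a`, then `s₂`
strips of height `a + 1` (these form the set `S₁`), then a last strip `S₂` of height `t` (absent if
`t = 0`). In every strip of height `a` (resp. `a + 1`) of `S₁`, `p₁` (resp. `p₂`) parts of `A` cells
are cut off by top-to-bottom striping. -/
structure Layout where
  /-- number of cells of a part -/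
  A : ℕ
  /-- height of the lower strips of `S₁` -/
  a : ℕ
  /-- number of strips of height `a` -/
  s₁ : ℕ
  /-- number of strips of height `a + 1` -/
  s₂ : ℕ
  /-- height of `S₂` -/
  t : ℕ
  /-- number of parts cut off in each strip of height `a` -/
  p₁ : ℕ
  /-- number of parts cut off in each strip of height `a + 1` -/
  p₂ : ℕ

namespace Layout

variable (L : Layout)

/-- Number of rows that belong to strips of `S₁`. -/
def rows : ℕ := L.s₁ * L.a + L.s₂ * (L.a + 1)

/-- Height of the strip of `S₁` that contains row `i`. -/
def height (i : ℕ) : ℕ := if i < L.s₁ * L.a then L.a else L.a + 1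

/-- First row of the strip of `S₁` that contains row `i`. -/
def top (i : ℕ) : ℕ :=
  if i < L.s₁ * L.a then i / L.a * L.a
  else L.s₁ * L.a + (i - L.s₁ * L.a) / (L.a + 1) * (L.a + 1)

/-- Number of parts cut off in the strip of `S₁` that contains row `i`. -/
def parts (i : ℕ) : ℕ := if i < L.s₁ * L.a then L.p₁ else L.p₂

/-- Number of parts cut off in the strips above the strip of `S₁` that contains row `i`. -/
def partsAbove (i : ℕ) : ℕ :=
  if i < L.s₁ * L.a then i / L.a * L.p₁
  else L.s₁ * L.p₁ + (i - L.s₁ * L.a) / (L.a + 1) * L.p₂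

/-- Position of cell `(i, j)` in the top-to-bottom striping of its strip: the columns are taken from
left to right, each one from top to bottom. -/
def index (i j : ℕ) : ℕ := j * L.height i + (i - L.top i)

/-- Cell `(i, j)` is covered by the vertical striping of `S₁`. -/
def InStripParts (i j : ℕ) : Prop := i < L.rows ∧ L.index i j < L.parts i * L.A

instance (i j : ℕ) : Decidable (L.InStripParts i j) := by
  unfold InStripParts; infer_instance

/-- The order in which the cells that are not covered by the vertical striping of `S₁` are taken.
First come those in the rows of `S₁` (the region `R`), row by row downwards, row `i` being traversed
from left to right if `rowDir i = true` and from right to left otherwise. Then come the cells of `S₂`,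
column by column from right to left, column `j` being traversed downwards if `colDir j = true` and
upwards otherwise. -/
def Precedes (rowDir colDir : ℕ → Bool) (v w : ℕ × ℕ) : Prop :=
  if v.1 < L.rows then
    if w.1 < L.rows then
      v.1 < w.1 ∨ v.1 = w.1 ∧ (if rowDir v.1 then v.2 < w.2 else w.2 < v.2)
    else True
  else
    if w.1 < L.rows then False
    else w.2 < v.2 ∨ v.2 = w.2 ∧ (if colDir v.2 then v.1 < w.1 else w.1 < v.1)

instance (rowDir colDir : ℕ → Bool) (v w : ℕ × ℕ) :
    Decidable (L.Precedes rowDir colDir v w) := by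
  unfold Precedes; infer_instance

/-- Number of cells of `R ∪ S₂` that are taken before the cell `v` of `R ∪ S₂`. -/
def rank (m n : ℕ) (rowDir colDir : ℕ → Bool) (v : Cell m n) : ℕ :=
  (Finset.univ.filter fun w : Cell m n =>
    ¬ L.InStripParts w.1 w.2 ∧
      L.Precedes rowDir colDir ((w.1 : ℕ), (w.2 : ℕ)) ((v.1 : ℕ), (v.2 : ℕ))).card

/-- Number of the part that receives the cell `v`: within each strip of `S₁`, and within the sequence
of the remaining cells, every `A` consecutive cells form a part. -/
def label (m n : ℕ) (rowDir colDir : ℕ → Bool) (v : Cell m n) : ℕ :=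
  if L.InStripParts v.1 v.2 then L.partsAbove v.1 + L.index v.1 v.2 / L.A
  else L.s₁ * L.p₁ + L.s₂ * L.p₂ + L.rank m n rowDir colDir v / L.A

end Layout

/-- The number of parts cut off in a strip of height `h`: parts of `A` cells are cut off until, for
the first time, the number of unpartitioned columns (those without a cell in a part) is in the
interval `[⌊a / φ⌋, ⌈φ a⌉]`. Here `⌈/⌉` is division rounded upwards. -/
def IsStop (n A a h p : ℕ) : Prop :=
  IsLeast {q : ℕ | q * A ≤ n * h ∧
    n - (q * A) ⌈/⌉ h ∈ Set.Icc ⌊(a : ℝ) / φ⌋₊ ⌈φ * (a : ℝ)⌉₊} p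

/-- `L` is a layout that the algorithm can use on the `m × n` grid for `k` parts, where `k ∣ m * n`
(so that every part is to have exactly `A = m * n / k` cells). With `m = d * a + r`, `0 ≤ r < a`:
strips of height `a` and `a + 1` only, if `r ≤ d`; otherwise strips of height `a`, and a last one
of height `r` if `r > ⌊a / φ⌋`, of height `a + r` if `r ≤ ⌊a / φ⌋`. -/
def IsLayout (m n k : ℕ) (L : Layout) : Prop :=
  L.A = m * n / k ∧ L.a = Nat.sqrt L.A ∧
  L.s₁ * L.a + L.s₂ * (L.a + 1) + L.t = m ∧
  (if m % L.a ≤ m / L.a then L.t = 0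
    else if ⌊(L.a : ℝ) / φ⌋₊ < m % L.a then L.s₂ = 0 ∧ L.t = m % L.a
    else L.s₂ = 0 ∧ L.t = L.a + m % L.a) ∧
  IsStop n L.A L.a L.a L.p₁ ∧ IsStop n L.A L.a (L.a + 1) L.p₂

/-- `f` is a partition produced by the striping steps of `φ`-Cautious Striping on the `m × n` grid
with `k` parts, `k ∣ m * n`, for some division of the rows and some choice of the directions in which
the rows of `R` and the columns of `S₂` are traversed. (The algorithm picks these so that the parts
are contiguous; that this is possible is not part of the definition.) -/
def IsCautiousStriping {m n k : ℕ} (f : Cell m n → Fin k) : Prop :=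
  ∃ (L : Layout) (rowDir colDir : ℕ → Bool), IsLayout m n k L ∧
    ∀ v, (f v : ℕ) = L.label m n rowDir colDir v

end GridStriping

/-! Since `k ≥ n`, a part has `A ≤ m` cells. Hence `a * a ≤ m`, and the quotient of `m` by `a` is at
least the remainder (`sqrt_mod_le_div`). So the strip S₂ never occurs, and the grid consists of
strips of heights `a` and `a + 1` only.

Put x = √A and c = ⌈2x⌉. A set of A cells that meets p rows and q columns has pq ≥ A and perimeter
at least 2(p + q) ≥ 2c (`two_mul_ceil_le_perimeter`). Every balanced partition therefore costs at
least 2ck, and both ratios are proved against this number.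

A part cut from a strip costs at most 2(c + 1) (`perimeter_le_of_consecutive`, `add_div_le_ceil`),
whence the summand 1/c. The region R is a stack of right-aligned rows; in a strip of height h with N
uncut cells their lengths are ⌊(N + o)/h⌋ for o < h. Consecutive parts of R share at most one row,
so their left and right sides number at most 2(m + K) for K parts; their upper and lower sides are
paid by two row lengths per part and by the upper and lower border of R, which is counted once
(`Layout.Fits.totalPerimeter_le`). A strip of height h with u free columns thus exceeds 2c per part
by about 2(h/A)(u - x)². The stopping rule gives |u - x| ≤ x/φ + 2, and 1/φ² = 2φ(√5/2 - 1); summing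
over the strips, whose heights add up to m, gives the term of order √A/n. The factor 1.69 follows
from the same estimate for A ≥ 11 and from a spanning tree bound for A ≤ 10.

Balance holds because different cells of a part have different positions modulo A, so no part
exceeds A cells, while k parts share kA cells.

For existence the directions of the rows of R must keep each part linked from row to row. This
depends only on row lengths and on cell counts modulo A (`Crossing`). If A ≥ 30, the cuts lie in
rows far enough apart to be treated one by one (`Layout.exists_directed_of_le`). If 4 ≤ A < 30,
periodicity leaves finitely many configurations, which the kernel checks. If A ≤ 3, all strips can
be single rows, and alternating directions work. -/

namespace GridStriping

/-! ### Perimeter by directions, isoperimetry, and the spanning tree bound -/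

section Perimeter

variable {m n k : ℕ}

/-- Number of cells of `S` that have no `r`-neighbour in `S`. -/
noncomputable def exposed (r : Cell m n → Cell m n → Prop) (S : Finset (Cell m n)) : ℕ :=
  open Classical in (S.filter fun v => ¬ ∃ w ∈ S, r v w).card

/-- `w` is the left neighbour of `v`. -/
def LeftOf (v w : Cell m n) : Prop := w.1 = v.1 ∧ (w.2 : ℕ) + 1 = v.2
/-- `w` is the right neighbour of `v`. -/
def RightOf (v w : Cell m n) : Prop := w.1 = v.1 ∧ (v.2 : ℕ) + 1 = w.2
/-- `w` is the upper neighbour of `v`. -/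
def Above (v w : Cell m n) : Prop := w.2 = v.2 ∧ (w.1 : ℕ) + 1 = v.1
/-- `w` is the lower neighbour of `v`. -/
def Below (v w : Cell m n) : Prop := w.2 = v.2 ∧ (v.1 : ℕ) + 1 = w.1

theorem gridGraph_adj_iff {v w : Cell m n} :
    (gridGraph m n).Adj v w ↔ LeftOf v w ∨ RightOf v w ∨ Above v w ∨ Below v w := by
  simp only [gridGraph, SimpleGraph.boxProd_adj, SimpleGraph.pathGraph_adj, LeftOf, RightOf, Above,
    Below, eq_comm (a := w.1), eq_comm (a := w.2)]
  tauto

open Classical in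
theorem card_filter_eq_ite {α : Type*} (S : Finset α) (r : α → Prop)
    (h : ∀ w w', r w → r w' → w = w') :
    (S.filter r).card = if ∃ w ∈ S, r w then 1 else 0 := by
  split_ifs with hw
  · obtain ⟨w, hS, hr⟩ := hw
    rw [Finset.card_eq_one]
    refine ⟨w, Finset.eq_singleton_iff_unique_mem.2 ⟨by simp [hS, hr], fun x hx => ?_⟩⟩
    exact h _ _ (Finset.mem_filter.1 hx).2 hr
  · rw [Finset.card_eq_zero, Finset.filter_eq_empty_iff]
    exact fun x hx hr => hw ⟨x, hx, hr⟩

open Classical in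
theorem ncard_neighbors (S : Finset (Cell m n)) (v : Cell m n) :
    {w | w ∈ S ∧ (gridGraph m n).Adj v w}.ncard =
      (if ∃ w ∈ S, LeftOf v w then 1 else 0) + (if ∃ w ∈ S, RightOf v w then 1 else 0) +
      (if ∃ w ∈ S, Above v w then 1 else 0) + (if ∃ w ∈ S, Below v w then 1 else 0) := by
  have e : {w | w ∈ S ∧ (gridGraph m n).Adj v w} =
      ((S.filter (LeftOf v) ∪ S.filter (RightOf v)) ∪ S.filter (Above v)) ∪
        S.filter (Below v) := by
    ext w
    simp only [gridGraph_adj_iff, Set.mem_ofPred_eq, Finset.coe_union, Finset.coe_filter,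
      Set.mem_union]
    tauto
  rw [e, Set.ncard_coe_finset]
  rw [Finset.card_union_of_disjoint, Finset.card_union_of_disjoint, Finset.card_union_of_disjoint]
  · rw [card_filter_eq_ite, card_filter_eq_ite, card_filter_eq_ite, card_filter_eq_ite] <;>
    · rintro ⟨a, b⟩ ⟨c, d⟩
      simp only [LeftOf, RightOf, Above, Below, Prod.mk.injEq, Fin.ext_iff]
      omega
  all_goals
    rw [Finset.disjoint_left]
    intro w
    simp only [Finset.mem_union, Finset.mem_filter, LeftOf, RightOf, Above, Below, Fin.ext_iff]
    omega

theorem perimeter_eq (S : Finset (Cell m n)) :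
    perimeter S = exposed LeftOf S + exposed RightOf S + exposed Above S + exposed Below S := by
  classical
  simp only [perimeter, exposed, Finset.card_filter, ← Finset.sum_add_distrib]
  refine Finset.sum_congr rfl fun v _ => ?_
  rw [ncard_neighbors]
  split_ifs <;> simp_all

/-- Upper bounds: in a set without gaps along its lines, each line, indexed by `proj`, has at most
one exposed cell. -/
theorem exposed_le_of_injOn {α : Type*} [DecidableEq α] (r : Cell m n → Cell m n → Prop)
    (S : Finset (Cell m n)) (proj : Cell m n → α) (T : Finset α) (hT : ∀ v ∈ S, proj v ∈ T)
    (h : ∀ v ∈ S, ∀ w ∈ S, v ≠ w → proj v = proj w → (∃ x ∈ S, r v x) ∨ ∃ x ∈ S, r w x) :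
    exposed r S ≤ T.card := by
  classical
  refine Finset.card_le_card_of_injOn proj (fun v hv => hT v (Finset.mem_filter.1 hv).1) ?_
  intro v hv w hw hvw
  simp only [Finset.coe_filter, Set.mem_ofPred_eq] at hv hw
  by_contra hne
  rcases h v hv.1 w hw.1 hne hvw with hx | hx
  · exact hv.2 hx
  · exact hw.2 hx

/-- Lower bounds: on every line that meets the set, the cell with the least `key` is exposed. -/
theorem card_image_le_exposed {α : Type*} [DecidableEq α] (r : Cell m n → Cell m n → Prop)
    (S : Finset (Cell m n)) (proj : Cell m n → α) (key : Cell m n → ℕ)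
    (h : ∀ v w, r v w → proj w = proj v ∧ key w < key v) :
    (S.image proj).card ≤ exposed r S := by
  classical
  refine le_trans (Finset.card_le_card ?_)
    (Finset.card_image_le (s := S.filter fun v => ¬ ∃ w ∈ S, r v w) (f := proj))
  intro a ha
  obtain ⟨v, hv, rfl⟩ := Finset.mem_image.1 ha
  obtain ⟨w, hw, hmin⟩ := Finset.exists_min_image (S.filter fun w => proj w = proj v) key
    ⟨v, by simp [hv]⟩
  rw [Finset.mem_filter] at hw
  refine Finset.mem_image.2 ⟨w, Finset.mem_filter.2 ⟨hw.1, ?_⟩, hw.2⟩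
  rintro ⟨x, hx, hr⟩
  obtain ⟨h1, h2⟩ := h _ _ hr
  exact absurd (hmin x (by simp [hx, h1, hw.2])) (by omega)

/-- The isoperimetric inequality in the grid. -/
theorem two_mul_ceil_le_perimeter (S : Finset (Cell m n)) :
    2 * ⌈2 * √(S.card : ℝ)⌉₊ ≤ perimeter S := by
  have hL := card_image_le_exposed LeftOf S Prod.fst (fun v => v.2)
    (fun v w h => ⟨h.1, by have := h.2; omega⟩)
  have hR := card_image_le_exposed RightOf S Prod.fst (fun v => n - v.2)
    (fun v w h => ⟨h.1, by have := h.2; have := w.2.2; omega⟩)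
  have hU := card_image_le_exposed Above S Prod.snd (fun v => v.1)
    (fun v w h => ⟨h.1, by have := h.2; omega⟩)
  have hD := card_image_le_exposed Below S Prod.snd (fun v => m - v.1)
    (fun v w h => ⟨h.1, by have := h.2; have := w.1.2; omega⟩)
  have hS : S.card ≤ (S.image Prod.fst).card * (S.image Prod.snd).card := by
    rw [← Finset.card_product]
    exact Finset.card_le_card Finset.subset_product
  have hc : ⌈2 * √(S.card : ℝ)⌉₊ ≤ (S.image Prod.fst).card + (S.image Prod.snd).card := by
    rw [Nat.ceil_le]
    have h1 : (S.card : ℝ) ≤ (S.image Prod.fst).card * (S.image Prod.snd).card := by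
      exact_mod_cast hS
    have h2 : √(S.card : ℝ) ≤ ((S.image Prod.fst).card + (S.image Prod.snd).card : ℝ) / 2 := by
      apply Real.sqrt_le_iff.2 ⟨by positivity, ?_⟩
      nlinarith [sq_nonneg (((S.image Prod.fst).card : ℝ) - (S.image Prod.snd).card)]
    push_cast
    linarith
  rw [perimeter_eq]
  omega

/-- The perimeter is four times the number of cells minus the sum of degrees, and a connected graph
has at least as many edges as a spanning tree. -/
theorem perimeter_le_of_connected (S : Finset (Cell m n))
    (h : ((gridGraph m n).induce {v | v ∈ S}).Connected) : perimeter S ≤ 2 * S.card + 2 := by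
  classical
  set G := (gridGraph m n).induce {v | v ∈ S} with hG
  have h1 := h.card_vert_le_card_edgeSet_add_one
  have h2 : ∑ v, G.degree v = 2 * G.edgeFinset.card := G.sum_degrees_eq_twice_card_edges
  have h3 : Nat.card {v | v ∈ S} = S.card := by simp
  have h4 : ∀ v : {v | v ∈ S}, G.degree v =
      {w | w ∈ S ∧ (gridGraph m n).Adj v w}.ncard := by
    intro v
    rw [← SimpleGraph.card_neighborFinset_eq_degree, ← Set.ncard_coe_finset,
      SimpleGraph.coe_neighborFinset, ← Set.ncard_image_of_injective _ Subtype.val_injective]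
    congr 1
    ext w
    simp [hG, SimpleGraph.mem_neighborSet]
    tauto
  have h5 : ∀ v, {w | w ∈ S ∧ (gridGraph m n).Adj v w}.ncard ≤ 4 := by
    intro v
    rw [ncard_neighbors]
    split_ifs <;> simp
  have h6 : ∑ v : {v | v ∈ S}, G.degree v =
      ∑ v ∈ S, {w | w ∈ S ∧ (gridGraph m n).Adj v w}.ncard := by
    rw [← Finset.sum_coe_sort S]
    exact Finset.sum_congr rfl fun v _ => h4 v
  have h7 : perimeter S + ∑ v ∈ S, {w | w ∈ S ∧ (gridGraph m n).Adj v w}.ncard = 4 * S.card := by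
    rw [perimeter, ← Finset.sum_add_distrib, mul_comm, ← smul_eq_mul, ← Finset.sum_const]
    exact Finset.sum_congr rfl fun v _ => Nat.sub_add_cancel (h5 v)
  have h8 : Nat.card G.edgeSet = G.edgeFinset.card := by
    rw [Nat.card_eq_fintype_card, SimpleGraph.edgeFinset_card]
  omega

end Perimeter

/-! ### Connectedness of sets of cells sorted into rows or columns -/

section Connected

/-- A set of cells that is sorted into lines is connected if each of its lines is, and if
consecutive lines are linked up to the last one. -/
theorem connected_of_lines {V : Type*} (G : SimpleGraph V) (S : Set V) (line : V → ℕ)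
    (hne : S.Nonempty)
    (hline : ∀ v w : S, line v = line w → (G.induce S).Reachable v w)
    (hlink : ∀ v ∈ S, ∀ w ∈ S, line v < line w → ∃ v' ∈ S, ∃ w' ∈ S, line v' = line v ∧
      line w' = line v + 1 ∧ G.Adj v' w') : (G.induce S).Connected := by
  have key : ∀ d, ∀ v w : S, line w = line v + d → (G.induce S).Reachable v w := by
    intro d
    induction d with
    | zero => exact fun v w h => hline v w (by omega)
    | succ d ih =>
      intro v w h
      obtain ⟨v', hv', w', hw', h1, h2, hadj⟩ := hlink v v.2 w w.2 (by omega)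
      have e1 := hline v ⟨v', hv'⟩ h1.symm
      have e2 : (G.induce S).Adj ⟨v', hv'⟩ ⟨w', hw'⟩ := hadj
      exact e1.trans (e2.reachable.trans (ih ⟨w', hw'⟩ w (by simp only; omega)))
  refine { preconnected := fun v w => ?_, nonempty := hne.to_subtype }
  rcases le_total (line v) (line w) with h | h
  · exact key (line w - line v) v w (by omega)
  · exact (key (line v - line w) w v (by omega)).symm

variable {m n : ℕ}

theorem reachable_in_row (S : Set (Cell m n))
    (h : ∀ i j j' j'', (i, j) ∈ S → (i, j'') ∈ S → j < j' → j' < j'' → (i, j') ∈ S)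
    (v w : S) (hvw : v.1.1 = w.1.1) : ((gridGraph m n).induce S).Reachable v w := by
  have key : ∀ d : ℕ, ∀ v w : S, v.1.1 = w.1.1 → (w.1.2 : ℕ) = v.1.2 + d →
      ((gridGraph m n).induce S).Reachable v w := by
    intro d
    induction d with
    | zero =>
      rintro ⟨⟨i, j⟩, hv⟩ ⟨⟨i', j'⟩, hw⟩ rfl h2
      obtain rfl : j' = j := Fin.ext (by simpa using h2)
      rfl
    | succ d ih =>
      rintro ⟨⟨i, j⟩, hv⟩ ⟨⟨i', j''⟩, hw⟩ h1 h2
      simp only at h1 h2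
      subst h1
      have hlt : (j : ℕ) + 1 < n := by have := j''.2; omega
      have hx : (i, (⟨j + 1, hlt⟩ : Fin n)) ∈ S := by
        by_cases hd : d = 0
        · subst hd
          obtain rfl : j'' = ⟨j + 1, hlt⟩ := Fin.ext (by simpa using h2)
          exact hw
        · exact h i j _ j'' hv hw (by simp [Fin.lt_def]) (by simp only [Fin.lt_def]; omega)
      have e : ((gridGraph m n).induce S).Adj ⟨(i, j), hv⟩ ⟨_, hx⟩ := by
        simp [gridGraph, SimpleGraph.boxProd_adj, SimpleGraph.pathGraph_adj]
      exact e.reachable.trans (ih ⟨_, hx⟩ ⟨_, hw⟩ rfl (by simp only; omega))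
  rcases le_total (v.1.2 : ℕ) w.1.2 with hle | hle
  · exact key (w.1.2 - v.1.2) v w hvw (by omega)
  · exact (key (v.1.2 - w.1.2) w v hvw.symm (by omega)).symm

theorem reachable_in_column (S : Set (Cell m n))
    (h : ∀ i i' i'' j, (i, j) ∈ S → (i'', j) ∈ S → i < i' → i' < i'' → (i', j) ∈ S)
    (v w : S) (hvw : v.1.2 = w.1.2) : ((gridGraph m n).induce S).Reachable v w := by
  have key : ∀ d : ℕ, ∀ v w : S, v.1.2 = w.1.2 → (w.1.1 : ℕ) = v.1.1 + d →
      ((gridGraph m n).induce S).Reachable v w := by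
    intro d
    induction d with
    | zero =>
      rintro ⟨⟨j, i⟩, hv⟩ ⟨⟨j', i'⟩, hw⟩ rfl h2
      obtain rfl : j' = j := Fin.ext (by simpa using h2)
      rfl
    | succ d ih =>
      rintro ⟨⟨j, i⟩, hv⟩ ⟨⟨j'', i'⟩, hw⟩ h1 h2
      simp only at h1 h2
      subst h1
      have hlt : (j : ℕ) + 1 < m := by have := j''.2; omega
      have hx : ((⟨j + 1, hlt⟩ : Fin m), i) ∈ S := by
        by_cases hd : d = 0
        · subst hd
          obtain rfl : j'' = ⟨j + 1, hlt⟩ := Fin.ext (by simpa using h2)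
          exact hw
        · exact h j _ j'' i hv hw (by simp [Fin.lt_def]) (by simp only [Fin.lt_def]; omega)
      have e : ((gridGraph m n).induce S).Adj ⟨(j, i), hv⟩ ⟨_, hx⟩ := by
        simp [gridGraph, SimpleGraph.boxProd_adj, SimpleGraph.pathGraph_adj]
      exact e.reachable.trans (ih ⟨_, hx⟩ ⟨_, hw⟩ rfl (by simp only; omega))
  rcases le_total (v.1.1 : ℕ) w.1.1 with hle | hle
  · exact key (w.1.1 - v.1.1) v w hvw (by omega)
  · exact (key (v.1.1 - w.1.1) w v hvw.symm (by omega)).symm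

end Connected

/-! ### Strips, and the region R as a stack of right-aligned rows -/

namespace Layout

variable (L : Layout)

/-- The layout has no strip `S₂`, covers the rows of the `m × n` grid, and the parts that are cut
off fit into the strips. -/
structure Fits (m n : ℕ) : Prop where
  A_pos : 0 < L.A
  a_pos : 0 < L.a
  rows_eq : L.rows = m
  le₁ : L.p₁ * L.A ≤ n * L.a
  le₂ : L.p₂ * L.A ≤ n * (L.a + 1)

/-- Position of row `i` in its strip. -/
def offset (i : ℕ) : ℕ := i - L.top i

/-- Number of cells that are left unpartitioned in the strip of row `i`. -/
def rest (n i : ℕ) : ℕ := n * L.height i - L.parts i * L.A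

/-- Number of unpartitioned cells in row `i`. -/
def len (n i : ℕ) : ℕ := (L.rest n i + L.offset i) / L.height i

/-- Number of unpartitioned cells above row `i`. -/
def cum (n i : ℕ) : ℕ := ∑ x ∈ Finset.range i, L.len n x

/-- Position of the unpartitioned cell `(i, j)` in the row by row order. -/
def pos (n : ℕ) (d : ℕ → Bool) (i j : ℕ) : ℕ :=
  L.cum n i + if d i then j + L.len n i - n else n - 1 - j

variable {L} {m n : ℕ}

theorem top_le (i : ℕ) : L.top i ≤ i := by
  unfold top
  split_ifs with h
  · exact Nat.div_mul_le_self _ _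
  · have := Nat.div_mul_le_self (i - L.s₁ * L.a) (L.a + 1)
    omega

theorem height_pos (ha : 0 < L.a) (i : ℕ) : 0 < L.height i := by
  unfold height
  split_ifs <;> omega

theorem lt_top_add_height (ha : 0 < L.a) (i : ℕ) : i < L.top i + L.height i := by
  unfold top height
  split_ifs with h
  · have := Nat.lt_div_mul_add (a := i) ha
    omega
  · have := Nat.lt_div_mul_add (a := i - L.s₁ * L.a) (Nat.succ_pos L.a)
    simp only [Nat.succ_eq_add_one] at this
    omega

theorem offset_lt (ha : 0 < L.a) (i : ℕ) : L.offset i < L.height i := by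
  have := lt_top_add_height ha i
  have := top_le (L := L) i
  unfold offset
  omega

theorem top_add_offset (i : ℕ) : L.top i + L.offset i = i := by
  have := top_le (L := L) i
  unfold offset
  omega

theorem strip_congr (ha : 0 < L.a) {i i' : ℕ} (h1 : L.top i ≤ i')
    (h2 : i' < L.top i + L.height i) :
    L.height i' = L.height i ∧ L.top i' = L.top i ∧ L.parts i' = L.parts i ∧
      L.partsAbove i' = L.partsAbove i := by
  unfold top at h1 h2
  unfold height at h2
  unfold top height parts partsAbove
  by_cases h : i < L.s₁ * L.a
  · rw [if_pos h] at h1 h2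
    rw [if_pos h] at h2
    have h3 : i / L.a < L.s₁ := by rwa [Nat.div_lt_iff_lt_mul ha]
    have h4 : i' < L.s₁ * L.a := by nlinarith
    have h5 : i' / L.a = i / L.a := by
      rw [Nat.div_eq_iff ha]
      constructor
      · omega
      · omega
    simp [h, h4, h5]
  · rw [if_neg h] at h1 h2
    rw [if_neg h] at h2
    have h4 : ¬ i' < L.s₁ * L.a := by omega
    have h5 : (i' - L.s₁ * L.a) / (L.a + 1) = (i - L.s₁ * L.a) / (L.a + 1) := by
      rw [Nat.div_eq_iff (show 0 < L.a + 1 by omega)]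
      constructor <;> omega
    simp [h, h4, h5]

theorem Fits.parts_mul_le (hF : L.Fits m n) (i : ℕ) : L.parts i * L.A ≤ n * L.height i := by
  unfold parts height
  split_ifs
  · exact hF.le₁
  · exact hF.le₂

theorem len_le (ha : 0 < L.a) (i : ℕ) : L.len n i ≤ n := by
  have h1 := offset_lt ha i
  have h2 : L.rest n i ≤ n * L.height i := Nat.sub_le _ _
  unfold len
  rw [← Nat.lt_succ_iff, Nat.div_lt_iff_lt_mul (height_pos ha i), Nat.succ_eq_add_one]
  nlinarith

/-- Adding `j` to the quotient that defines `len` turns this into one inequality between numerators.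
Hence the uncut cells of a row are its last `len` cells. -/
theorem Fits.index_lt_iff (hF : L.Fits m n) (i j : ℕ) :
    L.index i j < L.parts i * L.A ↔ j < n - L.len n i := by
  have h1 := hF.parts_mul_le i
  have hh := height_pos hF.a_pos i
  have h2 : j < n - L.len n i ↔ j + L.len n i < n := by omega
  have h3 : j + L.len n i = (L.rest n i + L.offset i + j * L.height i) / L.height i := by
    rw [Nat.add_mul_div_right _ _ hh, len, add_comm]
  rw [h2, h3, Nat.div_lt_iff_lt_mul hh]
  unfold index rest offset
  omega

theorem Fits.inStripParts_iff (hF : L.Fits m n) {i : ℕ} (hi : i < m) (j : ℕ) :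
    L.InStripParts i j ↔ j < n - L.len n i := by
  rw [InStripParts, hF.index_lt_iff, hF.rows_eq]
  simp [hi]

/-- Passing from N to N + 1 shifts the summation window by one: the term N / h is lost and (N + h) /
h = N / h + 1 is gained. -/
theorem sum_add_div (N : ℕ) {h : ℕ} (hh : 0 < h) :
    ∑ o ∈ Finset.range h, (N + o) / h = N := by
  induction N with
  | zero =>
    apply Finset.sum_eq_zero
    intro o ho
    rw [Finset.mem_range] at ho
    simp [ho]
  | succ N ih =>
    have h1 := Finset.sum_range_succ (fun o => (N + o) / h) h
    rw [Finset.sum_range_succ', Nat.add_div_right _ hh, ih] at h1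
    have h2 : ∑ o ∈ Finset.range h, (N + 1 + o) / h = ∑ o ∈ Finset.range h, (N + (o + 1)) / h :=
      Finset.sum_congr rfl fun o _ => by congr 1; ring
    simp only [Nat.add_zero] at h1
    omega

theorem offset_of_lt {i : ℕ} (hi : i < L.s₁ * L.a) : L.offset i = i % L.a := by
  have h := Nat.div_add_mod' i L.a
  simp only [offset, top, if_pos hi]
  omega

theorem offset_of_ge {i : ℕ} (hi : L.s₁ * L.a ≤ i) :
    L.offset i = (i - L.s₁ * L.a) % (L.a + 1) := by
  have h := Nat.div_add_mod' (i - L.s₁ * L.a) (L.a + 1)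
  simp only [offset, top, if_neg hi.not_gt]
  omega

theorem len_of_lt {i : ℕ} (hi : i < L.s₁ * L.a) :
    L.len n i = (n * L.a - L.p₁ * L.A + i % L.a) / L.a := by
  rw [len, rest, offset_of_lt hi, height, parts, if_pos hi, if_pos hi]

theorem len_of_ge {i : ℕ} (hi : L.s₁ * L.a ≤ i) :
    L.len n i =
      (n * (L.a + 1) - L.p₂ * L.A + (i - L.s₁ * L.a) % (L.a + 1)) / (L.a + 1) := by
  rw [len, rest, offset_of_ge hi, height, parts, if_neg hi.not_gt, if_neg hi.not_gt]

theorem cum_mul (ha : 0 < L.a) {s : ℕ} (hs : s ≤ L.s₁) :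
    L.cum n (s * L.a) = s * (n * L.a - L.p₁ * L.A) := by
  induction s with
  | zero => simp [cum]
  | succ s ih =>
    have ih := ih (by omega)
    unfold cum at ih ⊢
    rw [add_mul, add_mul, one_mul, one_mul, Finset.sum_range_add, ih]
    congr 1
    rw [← sum_add_div (n * L.a - L.p₁ * L.A) ha]
    refine Finset.sum_congr rfl fun o ho => ?_
    rw [Finset.mem_range] at ho
    rw [len_of_lt (by nlinarith)]
    congr 2
    rw [add_comm, Nat.add_mul_mod_self_right, Nat.mod_eq_of_lt ho]

theorem cum_add_mul (ha : 0 < L.a) (s : ℕ) :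
    L.cum n (L.s₁ * L.a + s * (L.a + 1)) =
      L.s₁ * (n * L.a - L.p₁ * L.A) + s * (n * (L.a + 1) - L.p₂ * L.A) := by
  induction s with
  | zero => simpa using cum_mul ha le_rfl
  | succ s ih =>
    unfold cum at ih ⊢
    rw [add_mul, one_mul, ← add_assoc, Finset.sum_range_add, ih, add_mul, one_mul, ← add_assoc]
    congr 1
    rw [← sum_add_div (n * (L.a + 1) - L.p₂ * L.A) (Nat.succ_pos L.a)]
    refine Finset.sum_congr rfl fun o ho => ?_
    rw [Finset.mem_range] at ho
    rw [len_of_ge (by omega)]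
    congr 2
    have : L.s₁ * L.a + s * (L.a + 1) + o - L.s₁ * L.a = o + s * (L.a + 1) := by omega
    rw [this, Nat.add_mul_mod_self_right, Nat.mod_eq_of_lt ho]

theorem Fits.cum_eq (hF : L.Fits m n) : L.cum n m =
    L.s₁ * (n * L.a - L.p₁ * L.A) + L.s₂ * (n * (L.a + 1) - L.p₂ * L.A) := by
  rw [← cum_add_mul hF.a_pos, ← hF.rows_eq, rows]

/-- Cells of strip parts and unpartitioned cells together are all cells. -/
theorem Fits.cum_add (hF : L.Fits m n) :
    L.cum n m + (L.s₁ * L.p₁ + L.s₂ * L.p₂) * L.A = m * n := by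
  have h1 := hF.le₁
  have h2 := hF.le₂
  rw [hF.cum_eq, ← hF.rows_eq, rows]
  obtain ⟨x, hx⟩ := Nat.exists_eq_add_of_le h1
  obtain ⟨y, hy⟩ := Nat.exists_eq_add_of_le h2
  rw [hx, hy, Nat.add_sub_cancel_left, Nat.add_sub_cancel_left]
  calc _ = L.s₁ * (L.p₁ * L.A + x) + L.s₂ * (L.p₂ * L.A + y) := by ring
    _ = _ := by rw [← hx, ← hy]; ring

theorem cum_succ (i : ℕ) : L.cum n (i + 1) = L.cum n i + L.len n i :=
  Finset.sum_range_succ _ _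

theorem cum_mono : Monotone (L.cum n) :=
  monotone_nat_of_le_succ fun i => by rw [cum_succ]; omega

theorem pos_bounds {d : ℕ → Bool} {i j : ℕ} (hj : n - L.len n i ≤ j) (hjn : j < n) :
    L.cum n i ≤ L.pos n d i j ∧ L.pos n d i j < L.cum n (i + 1) := by
  rw [cum_succ]
  unfold pos
  split_ifs <;> omega

theorem card_filter_fin (p : ℕ → Prop) [DecidablePred p] (N : ℕ) :
    (Finset.univ.filter fun j : Fin N => p j).card = ((Finset.range N).filter p).card := by
  rw [Finset.card_filter, Finset.card_filter, Fin.sum_univ_eq_sum_range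
    (fun j => if p j then 1 else 0)]

/-- The counting definition is replaced by a closed form, row by row: rows above contribute their
full length, the row of `v` a segment, rows below nothing. All rows belong to S₁, so column
directions play no role. -/
theorem Fits.rank_eq (hF : L.Fits m n) (d d' : ℕ → Bool) (v : Cell m n)
    (hv : n - L.len n v.1 ≤ v.2) : L.rank m n d d' v = L.pos n d v.1 v.2 := by
  have ha := hF.a_pos
  obtain ⟨i, j⟩ := v
  simp only at hv
  have hrow : ∀ x : ℕ, ∑ y : Fin n, (if ¬ (y : ℕ) < n - L.len n x ∧
      (x < i ∨ x = i ∧ if d x then (y : ℕ) < j else (j : ℕ) < y) then 1 else 0) =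
      if x < i then L.len n x else if x = i then
        (if d i then j + L.len n i - n else n - 1 - j) else 0 := by
    intro x
    have hx := len_le (n := n) ha x
    rw [← Finset.card_filter, card_filter_fin
      (fun y => ¬ y < n - L.len n x ∧ (x < i ∨ x = i ∧ if d x then y < j else (j : ℕ) < y))]
    have hj := j.2
    rcases lt_trichotomy x i with h | rfl | h
    · rw [if_pos h, show (Finset.range n).filter _ = Finset.Ico (n - L.len n x) n by
        ext y; simp only [Finset.mem_filter, Finset.mem_range, Finset.mem_Ico, h]; simp; omega]
      rw [Nat.card_Ico]; omega
    · rw [if_neg (lt_irrefl _), if_pos rfl]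
      by_cases hd : d i
      · rw [if_pos hd, show (Finset.range n).filter _ = Finset.Ico (n - L.len n i) j by
          ext y; simp only [Finset.mem_filter, Finset.mem_range, Finset.mem_Ico, hd]; simp; omega]
        rw [Nat.card_Ico]; omega
      · rw [if_neg hd, show (Finset.range n).filter _ = Finset.Ioo (j : ℕ) n by
          ext y; simp only [Finset.mem_filter, Finset.mem_range, Finset.mem_Ioo, hd]; simp; omega]
        rw [Nat.card_Ioo]; omega
    · rw [if_neg (by omega), if_neg (by omega), Finset.card_eq_zero, Finset.filter_eq_empty_iff]
      intro y _
      omega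
  have key : L.rank m n d d' (i, j) = ∑ x ∈ Finset.range m,
      if x < (i : ℕ) then L.len n x else if x = i then
        (if d i then j + L.len n i - n else n - 1 - (j : ℕ)) else 0 := by
    rw [rank, Finset.card_filter, Fintype.sum_prod_type, ← Fin.sum_univ_eq_sum_range]
    refine Finset.sum_congr rfl fun x _ => ?_
    rw [← hrow x]
    refine Finset.sum_congr rfl fun y _ => ?_
    simp only [hF.inStripParts_iff x.2, Precedes, hF.rows_eq, x.2, i.2, if_true]
  rw [key, pos, cum, ← Finset.sum_range_add_sum_Ico _ i.2.le]
  have hi := i.2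
  congr 1
  · refine Finset.sum_congr rfl fun x hx => ?_
    rw [if_pos (Finset.mem_range.1 hx)]
  · rw [Finset.sum_eq_sum_Ico_succ_bot hi, if_neg (lt_irrefl _), if_pos rfl]
    rw [Finset.sum_eq_zero, add_zero]
    intro x hx
    rw [Finset.mem_Ico] at hx
    rw [if_neg (by omega), if_neg (by omega)]

/-! ### Labels of cells and sizes of parts -/

variable {k : ℕ}

/-- Number of parts that are cut off by top-to-bottom striping. -/
def stripParts (L : Layout) : ℕ := L.s₁ * L.p₁ + L.s₂ * L.p₂

theorem index_eq (i j : ℕ) : L.index i j = j * L.height i + L.offset i := rfl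

theorem partsAbove_add_le (ha : 0 < L.a) {i : ℕ} (hi : i < L.rows) :
    L.partsAbove i + L.parts i ≤ L.stripParts := by
  unfold rows at hi
  unfold partsAbove parts stripParts
  split_ifs with h
  · have h3 : i / L.a < L.s₁ := by rwa [Nat.div_lt_iff_lt_mul ha]
    nlinarith
  · have h3 : (i - L.s₁ * L.a) / (L.a + 1) < L.s₂ := by
      rw [Nat.div_lt_iff_lt_mul (Nat.succ_pos _)]
      simp only [Nat.succ_eq_add_one]
      omega
    nlinarith

theorem eq_of_mul_add_eq {a b p x y : ℕ} (hx : x < p) (hy : y < p)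
    (h : a * p + x = b * p + y) : a = b ∧ x = y := by
  have h1 : a = b := by
    rcases lt_trichotomy a b with hab | hab | hab
    · nlinarith
    · exact hab
    · nlinarith
  subst h1
  exact ⟨rfl, by omega⟩

/-- Uniqueness of division with remainder: the number of a cut-off part determines its strip and its
place there. -/
theorem top_eq_of_partsAbove_add_eq (ha : 0 < L.a) {i i' x x' : ℕ} (hx : x < L.parts i)
    (hx' : x' < L.parts i') (h : L.partsAbove i + x = L.partsAbove i' + x') :
    L.top i = L.top i' ∧ x = x' := by
  unfold parts at hx hx'
  unfold partsAbove at h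
  unfold top
  by_cases hi : i < L.s₁ * L.a <;> by_cases hi' : i' < L.s₁ * L.a <;>
    simp only [hi, hi', if_true, if_false] at hx hx' h ⊢
  · obtain ⟨h1, h2⟩ := eq_of_mul_add_eq hx hx' h
    exact ⟨by rw [h1], h2⟩
  · have h3 : i / L.a < L.s₁ := by rwa [Nat.div_lt_iff_lt_mul ha]
    exfalso
    have : i / L.a * L.p₁ + L.p₁ ≤ L.s₁ * L.p₁ := by nlinarith
    omega
  · have h3 : i' / L.a < L.s₁ := by rwa [Nat.div_lt_iff_lt_mul ha]
    exfalso
    have : i' / L.a * L.p₁ + L.p₁ ≤ L.s₁ * L.p₁ := by nlinarith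
    omega
  · rw [add_assoc, add_assoc] at h
    obtain ⟨h1, h2⟩ := eq_of_mul_add_eq hx hx' (Nat.add_left_cancel h)
    exact ⟨by rw [h1], h2⟩

theorem Fits.index_div_lt {i j : ℕ} (hF : L.Fits m n) (h : L.InStripParts i j) :
    L.index i j / L.A < L.parts i :=
  (Nat.div_lt_iff_lt_mul hF.A_pos).2 h.2

theorem label_of_inStripParts {d d' : ℕ → Bool} {v : Cell m n} (h : L.InStripParts v.1 v.2) :
    L.label m n d d' v = L.partsAbove v.1 + L.index v.1 v.2 / L.A := if_pos h

theorem Fits.label_lt {d d' : ℕ → Bool} {v : Cell m n} (hF : L.Fits m n)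
    (h : L.InStripParts v.1 v.2) : L.label m n d d' v < L.stripParts := by
  rw [label_of_inStripParts h]
  have h1 := hF.index_div_lt h
  have h2 := partsAbove_add_le hF.a_pos h.1
  omega

theorem Fits.label_of_not {d d' : ℕ → Bool} {v : Cell m n} (hF : L.Fits m n)
    (h : ¬ L.InStripParts v.1 v.2) :
    L.label m n d d' v = L.stripParts + L.pos n d v.1 v.2 / L.A := by
  rw [label, if_neg h, hF.rank_eq, stripParts]
  rw [hF.inStripParts_iff v.1.2] at h
  omega

theorem Fits.label_lt_iff {d d' : ℕ → Bool} {v : Cell m n} (hF : L.Fits m n) :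
    L.label m n d d' v < L.stripParts ↔ L.InStripParts v.1 v.2 := by
  refine ⟨fun h => ?_, hF.label_lt⟩
  by_contra h'
  rw [hF.label_of_not h'] at h
  exact absurd h (Nat.le_add_right _ _).not_gt

/-- This describes a cut-off part by a fixed strip and a fixed quotient, the form in which its
perimeter and connectedness are studied. -/
theorem Fits.label_eq_iff {d d' : ℕ → Bool} (hF : L.Fits m n) {v w : Cell m n}
    (hv : L.InStripParts v.1 v.2) :
    L.label m n d d' w = L.label m n d d' v ↔
      L.top v.1 ≤ w.1 ∧ (w.1 : ℕ) < L.top v.1 + L.height v.1 ∧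
        ((w.2 : ℕ) * L.height v.1 + (w.1 - L.top v.1)) / L.A = L.index v.1 v.2 / L.A := by
  have ha := hF.a_pos
  constructor
  · intro h
    have hw : L.InStripParts w.1 w.2 := by
      rw [← hF.label_lt_iff (d := d) (d' := d'), h]
      exact hF.label_lt hv
    rw [label_of_inStripParts hv, label_of_inStripParts hw] at h
    obtain ⟨h1, h2⟩ := top_eq_of_partsAbove_add_eq ha (hF.index_div_lt hw) (hF.index_div_lt hv) h
    have h3 := top_le (L := L) w.1
    have h4 := lt_top_add_height ha w.1
    have h5 := (strip_congr ha (i := w.1) (i' := v.1) (by rw [h1]; exact top_le _)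
      (by
        have e1 := lt_top_add_height ha v.1
        have e2 := top_le (L := L) v.1
        by_contra hcon
        have e3 := (strip_congr ha (i := v.1) (i' := w.1) (by omega) (by omega)).1
        omega)).1
    rw [h1] at h3 h4
    rw [h5]
    refine ⟨h3, h4, ?_⟩
    rw [← h2, index, h1]
  · rintro ⟨h1, h2, h3⟩
    obtain ⟨e1, e2, e3, e4⟩ := strip_congr ha h1 h2
    have h4 : L.index w.1 w.2 / L.A = L.index v.1 v.2 / L.A := by
      rw [← h3, index, e1, e2]
    have hw : L.InStripParts w.1 w.2 := by
      refine ⟨by rw [hF.rows_eq]; exact w.1.2, ?_⟩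
      rw [← Nat.div_lt_iff_lt_mul hF.A_pos, h4, e3]
      exact hF.index_div_lt hv
    rw [label_of_inStripParts hv, label_of_inStripParts hw, e4, h4]

theorem Fits.pos_lt_cum {d : ℕ → Bool} {v : Cell m n} (hF : L.Fits m n)
    (h : ¬ L.InStripParts v.1 v.2) : L.cum n v.1 ≤ L.pos n d v.1 v.2 ∧
      L.pos n d v.1 v.2 < L.cum n (v.1 + 1) := by
  rw [hF.inStripParts_iff v.1.2] at h
  exact pos_bounds (by omega) v.2.2

theorem eq_of_cum_bounds {x i i' : ℕ} (h1 : L.cum n i ≤ x) (h2 : x < L.cum n (i + 1))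
    (h3 : L.cum n i' ≤ x) (h4 : x < L.cum n (i' + 1)) : i = i' := by
  rcases lt_trichotomy i i' with h | h | h
  · have := cum_mono (L := L) (n := n) (show i + 1 ≤ i' by omega)
    omega
  · exact h
  · have := cum_mono (L := L) (n := n) (show i' + 1 ≤ i by omega)
    omega

theorem Fits.pos_inj {d : ℕ → Bool} {v w : Cell m n} (hF : L.Fits m n)
    (hv : ¬ L.InStripParts v.1 v.2) (hw : ¬ L.InStripParts w.1 w.2)
    (h : L.pos n d v.1 v.2 = L.pos n d w.1 w.2) : v = w := by
  have b1 := hF.pos_lt_cum (d := d) hv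
  have b2 := hF.pos_lt_cum (d := d) hw
  have e := eq_of_cum_bounds b1.1 b1.2 (by rw [h]; exact b2.1) (by rw [h]; exact b2.2)
  obtain ⟨i, j⟩ := v
  obtain ⟨i', j'⟩ := w
  obtain rfl : i = i' := Fin.ext e
  rw [hF.inStripParts_iff i.2] at hv hw
  have hj := j.2
  have hj' := j'.2
  unfold pos at h
  simp only at hv hw h
  have : (j : ℕ) = j' := by split_ifs at h <;> omega
  rw [Fin.ext this]

/-- Within a part all positions have the same quotient by A, so the position modulo A determines the
cell. -/
theorem Fits.card_part_le (hF : L.Fits m n) {d d' : ℕ → Bool} {f : Cell m n → Fin k}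
    (hf : ∀ v, (f v : ℕ) = L.label m n d d' v) (t : Fin k) : (part f t).card ≤ L.A := by
  rw [← Finset.card_range L.A]
  have hA := hF.A_pos
  refine Finset.card_le_card_of_injOn
    (fun v => (if L.InStripParts v.1 v.2 then L.index v.1 v.2 else L.pos n d v.1 v.2) % L.A)
    (fun v _ => Finset.mem_coe.2 (Finset.mem_range.2 (Nat.mod_lt _ hA))) ?_
  intro v hv w hw h
  simp only [part, Finset.coe_filter, Finset.mem_univ, true_and, Set.mem_ofPred_eq] at hv hw h
  have hl : L.label m n d d' w = L.label m n d d' v := by rw [← hf, ← hf, hv, hw]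
  by_cases hs : L.InStripParts v.1 v.2
  · have hs' : L.InStripParts w.1 w.2 := by
      rw [← hF.label_lt_iff (d := d) (d' := d'), hl]
      exact hF.label_lt hs
    rw [if_pos hs, if_pos hs'] at h
    obtain ⟨h1, h2, h3⟩ := (hF.label_eq_iff hs).1 hl
    obtain ⟨e1, e2, -⟩ := strip_congr hF.a_pos h1 h2
    simp only [index, e1, e2] at h
    rw [← index] at h
    have h4 := congrArg₂ (· + ·) (congrArg (L.A * ·) h3) h.symm
    simp only [Nat.div_add_mod] at h4
    have h5 := offset_lt hF.a_pos v.1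
    rw [index_eq] at h4
    obtain ⟨h6, h7⟩ := eq_of_mul_add_eq (by omega) h5 h4
    have h8 := top_add_offset (L := L) v.1
    exact Prod.ext (Fin.ext (by omega)) (Fin.ext h6.symm)
  · have hs' : ¬ L.InStripParts w.1 w.2 := by
      rw [← hF.label_lt_iff (d := d) (d' := d')] at hs ⊢
      rwa [hl]
    rw [if_neg hs, if_neg hs'] at h
    rw [hF.label_of_not hs, hF.label_of_not hs'] at hl
    have h3 : L.pos n d v.1 v.2 / L.A = L.pos n d w.1 w.2 / L.A := by omega
    have h4 := congrArg₂ (· + ·) (congrArg (L.A * ·) h3) h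
    simp only [Nat.div_add_mod] at h4
    exact hF.pos_inj hs hs' h4

/-- The k upper bounds A add up to exactly the number of cells, so each of them is attained. -/
theorem Fits.card_part (hF : L.Fits m n) {d d' : ℕ → Bool} {f : Cell m n → Fin k}
    (hk : k * L.A = m * n) (hf : ∀ v, (f v : ℕ) = L.label m n d d' v) (t : Fin k) :
    (part f t).card = L.A := by
  have h1 : ∑ t : Fin k, (part f t).card = ∑ _t : Fin k, L.A := by
    rw [Finset.sum_const, Finset.card_univ, Fintype.card_fin, smul_eq_mul, hk]
    have := Finset.card_eq_sum_card_fiberwise (s := (Finset.univ : Finset (Cell m n)))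
      (t := (Finset.univ : Finset (Fin k))) (f := f) (fun v _ => by simp)
    rw [Finset.card_univ, Fintype.card_prod, Fintype.card_fin, Fintype.card_fin] at this
    exact this.symm
  exact (Finset.sum_eq_sum_iff_of_le (fun t _ => hF.card_part_le hf t)).1 h1 t (Finset.mem_univ t)

/-- Number of parts formed by the cells that are not covered by the striping of the strips. -/
theorem Fits.cum_eq_mul (hF : L.Fits m n) (hk : k * L.A = m * n) :
    L.stripParts ≤ k ∧ L.cum n m = (k - L.stripParts) * L.A := by
  have h1 := hF.cum_add
  have hA := hF.A_pos
  rw [← hk] at h1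
  change _ + L.stripParts * L.A = _ at h1
  have h2 : L.stripParts ≤ k := Nat.le_of_mul_le_mul_right (by omega) hA
  refine ⟨h2, ?_⟩
  rw [Nat.sub_mul]
  omega

theorem Fits.label_lt_card (hF : L.Fits m n) (hk : k * L.A = m * n) (d d' : ℕ → Bool)
    (v : Cell m n) : L.label m n d d' v < k := by
  obtain ⟨h1, h2⟩ := hF.cum_eq_mul hk
  by_cases hv : L.InStripParts v.1 v.2
  · exact (hF.label_lt hv).trans_le h1
  · rw [hF.label_of_not hv]
    have h3 := (hF.pos_lt_cum (d := d) hv).2.trans_le (cum_mono (L := L) (n := n) v.1.2)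
    rw [h2, ← Nat.div_lt_iff_lt_mul hF.A_pos] at h3
    omega

/-! ### Parts cut off from a strip -/

section Strip

variable {T h A q : ℕ} {S : Finset (Cell m n)}

/-- Perimeter of a set of consecutive cells of a strip that is taken column by column. -/
theorem perimeter_le_of_consecutive (hh : 0 < h) (hA : 0 < A)
    (hS : ∀ w : Cell m n, w ∈ S ↔ T ≤ w.1 ∧ (w.1 : ℕ) < T + h ∧
      ((w.2 : ℕ) * h + (w.1 - T)) / A = q) :
    perimeter S ≤ 2 * (h + ((A + h - 2) / h + 1)) := by
  have hdiv : ∀ x, x / A = q ↔ q * A ≤ x ∧ x < q * A + A := by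
    intro x
    rw [Nat.div_eq_iff hA]
    omega
  simp only [hdiv] at hS
  have hrow : ∀ v ∈ S, (v.1 : ℕ) ∈ Finset.Ico T (T + h) := fun v hv => by
    rw [hS] at hv
    exact Finset.mem_Ico.2 ⟨hv.1, hv.2.1⟩
  have hcol : ∀ v ∈ S, (v.2 : ℕ) ∈ Finset.Icc (q * A / h) ((q * A + A - 1) / h) := fun v hv => by
    rw [hS] at hv
    obtain ⟨h1, h2, h3, h4⟩ := hv
    have e : (v.2 : ℕ) = ((v.2 : ℕ) * h + (v.1 - T)) / h := by
      rw [add_comm, Nat.add_mul_div_right _ _ hh, Nat.div_eq_of_lt (by omega), zero_add]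
    rw [Finset.mem_Icc, e]
    exact ⟨Nat.div_le_div_right h3, Nat.div_le_div_right (by omega)⟩
  -- The worst case is a part that starts with the last cell of a column: its last cell is then A +
  -- h - 2 places after the top of that column.
  have hcard : (Finset.Icc (q * A / h) ((q * A + A - 1) / h)).card ≤ (A + h - 2) / h + 1 := by
    rw [Nat.card_Icc]
    have h1 : (q * A + A - 1) / h ≤ (A + h - 2) / h + q * A / h := by
      rw [← Nat.add_mul_div_right _ _ hh]
      apply Nat.div_le_div_right
      have := Nat.lt_div_mul_add (a := q * A) hh
      omega
    generalize (A + h - 2) / h = x at h1 ⊢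
    generalize q * A / h = y at h1 ⊢
    omega
  have hl : exposed LeftOf S ≤ h := by
    refine (exposed_le_of_injOn LeftOf S (fun v => (v.1 : ℕ)) _ hrow ?_).trans (by simp)
    have main : ∀ v ∈ S, ∀ w ∈ S, (v.2 : ℕ) < w.2 → (v.1 : ℕ) = w.1 → ∃ x ∈ S, LeftOf w x := by
      intro v hv w hw hlt h1
      have hw2 := w.2.2
      refine ⟨(w.1, ⟨w.2 - 1, by omega⟩), ?_, rfl, by simp only; omega⟩
      rw [hS] at hv hw ⊢
      simp only
      have h2 : (v.2 : ℕ) * h ≤ (w.2 - 1 : ℕ) * h := Nat.mul_le_mul_right h (by omega)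
      have h3 : ((w.2 : ℕ) - 1) * h ≤ w.2 * h := Nat.mul_le_mul_right h (by omega)
      omega
    intro v hv w hw hne h1
    rcases lt_trichotomy (v.2 : ℕ) w.2 with h2 | h2 | h2
    · exact Or.inr (main v hv w hw h2 h1)
    · exact absurd (Prod.ext (Fin.ext h1) (Fin.ext h2)) hne
    · exact Or.inl (main w hw v hv h2 h1.symm)
  have hr : exposed RightOf S ≤ h := by
    refine (exposed_le_of_injOn RightOf S (fun v => (v.1 : ℕ)) _ hrow ?_).trans (by simp)
    have main : ∀ v ∈ S, ∀ w ∈ S, (v.2 : ℕ) < w.2 → (v.1 : ℕ) = w.1 → ∃ x ∈ S, RightOf v x := by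
      intro v hv w hw hlt h1
      have hw2 := w.2.2
      refine ⟨(v.1, ⟨v.2 + 1, by omega⟩), ?_, rfl, by simp only⟩
      rw [hS] at hv hw ⊢
      simp only
      have h2 : (v.2 + 1 : ℕ) * h ≤ (w.2 : ℕ) * h := Nat.mul_le_mul_right h (by omega)
      have h3 : (v.2 : ℕ) * h ≤ (v.2 + 1) * h := Nat.mul_le_mul_right h (by omega)
      omega
    intro v hv w hw hne h1
    rcases lt_trichotomy (v.2 : ℕ) w.2 with h2 | h2 | h2
    · exact Or.inl (main v hv w hw h2 h1)
    · exact absurd (Prod.ext (Fin.ext h1) (Fin.ext h2)) hne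
    · exact Or.inr (main w hw v hv h2 h1.symm)
  have hu : exposed Above S ≤ (A + h - 2) / h + 1 := by
    refine (exposed_le_of_injOn Above S (fun v => (v.2 : ℕ)) _ hcol ?_).trans hcard
    have main : ∀ v ∈ S, ∀ w ∈ S, (v.1 : ℕ) < w.1 → (v.2 : ℕ) = w.2 → ∃ x ∈ S, Above w x := by
      intro v hv w hw hlt h1
      have hw2 := w.1.2
      refine ⟨(⟨w.1 - 1, by omega⟩, w.2), ?_, rfl, by simp only; omega⟩
      rw [hS] at hv hw ⊢
      simp only
      rw [h1] at hv
      omega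
    intro v hv w hw hne h1
    rcases lt_trichotomy (v.1 : ℕ) w.1 with h2 | h2 | h2
    · exact Or.inr (main v hv w hw h2 h1)
    · exact absurd (Prod.ext (Fin.ext h2) (Fin.ext h1)) hne
    · exact Or.inl (main w hw v hv h2 h1.symm)
  have hd : exposed Below S ≤ (A + h - 2) / h + 1 := by
    refine (exposed_le_of_injOn Below S (fun v => (v.2 : ℕ)) _ hcol ?_).trans hcard
    have main : ∀ v ∈ S, ∀ w ∈ S, (v.1 : ℕ) < w.1 → (v.2 : ℕ) = w.2 → ∃ x ∈ S, Below v x := by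
      intro v hv w hw hlt h1
      have hw2 := w.1.2
      refine ⟨(⟨v.1 + 1, by omega⟩, v.2), ?_, rfl, by simp only⟩
      rw [hS] at hv hw ⊢
      simp only
      rw [← h1] at hw
      omega
    intro v hv w hw hne h1
    rcases lt_trichotomy (v.1 : ℕ) w.1 with h2 | h2 | h2
    · exact Or.inl (main v hv w hw h2 h1)
    · exact absurd (Prod.ext (Fin.ext h2) (Fin.ext h1)) hne
    · exact Or.inr (main w hw v hv h2 h1.symm)
  rw [perimeter_eq]
  omega

/-- Consecutive cells of a strip that is taken column by column form a connected set. -/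
theorem connected_of_consecutive (hA : 0 < A) (hT : T + h ≤ m) (hAh : h < A ∨ h = 1)
    (hne : S.Nonempty) (hS : ∀ w : Cell m n, w ∈ S ↔ T ≤ w.1 ∧ (w.1 : ℕ) < T + h ∧
      ((w.2 : ℕ) * h + (w.1 - T)) / A = q) :
    ((gridGraph m n).induce {v | v ∈ S}).Connected := by
  have hdiv : ∀ x, x / A = q ↔ q * A ≤ x ∧ x < q * A + A := by
    intro x
    rw [Nat.div_eq_iff hA]
    omega
  simp only [hdiv] at hS
  refine connected_of_lines _ _ (fun v => (v.2 : ℕ)) hne ?_ ?_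
  · intro v w hvw
    refine reachable_in_column _ ?_ v w (Fin.ext hvw)
    intro i i' i'' j h1 h2 h3 h4
    simp only [Set.mem_ofPred_eq, hS, Fin.lt_def] at *
    omega
  · intro v hv w hw hlt
    simp only [Set.mem_ofPred_eq] at hv hw hlt ⊢
    have hw2 := w.2.2
    have hv' := (hS v).1 hv
    have hw' := (hS w).1 hw
    have e : (v.2 + 1 : ℕ) * h = v.2 * h + h := by ring
    have e2 : (v.2 + 1 : ℕ) * h ≤ (w.2 : ℕ) * h := Nat.mul_le_mul_right h (by omega)
    -- The two columns are linked in row `o` of the strip: the top row if the part contains the top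
    -- cell of the left column, else the row of the first cell of the part. The latter works since h
    -- < A; for h = 1 it does not arise.
    have key : ∃ o, o < h ∧ q * A ≤ (v.2 : ℕ) * h + o ∧ (v.2 + 1 : ℕ) * h + o < q * A + A := by
      by_cases h1 : q * A ≤ (v.2 : ℕ) * h
      · by_cases h2 : (v.2 : ℕ) + 1 < w.2
        · have e3 : (v.2 + 1 + 1 : ℕ) * h ≤ (w.2 : ℕ) * h := Nat.mul_le_mul_right h (by omega)
          have e4 : (v.2 + 1 + 1 : ℕ) * h = v.2 * h + h + h := by ring
          exact ⟨0, by omega, by omega, by omega⟩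
        · exact ⟨0, by omega, by omega, by omega⟩
      · exact ⟨q * A - v.2 * h, by omega, by omega, by omega⟩
    obtain ⟨o, ho, h1, h2⟩ := key
    refine ⟨(⟨T + o, by omega⟩, v.2), ?_, (⟨T + o, by omega⟩, ⟨v.2 + 1, by omega⟩), ?_, rfl, rfl, ?_⟩
    · rw [hS]
      simp only
      omega
    · rw [hS]
      simp only
      omega
    · simp [gridGraph, SimpleGraph.boxProd_adj, SimpleGraph.pathGraph_adj]

end Strip

theorem Fits.top_add_height_le (hF : L.Fits m n) {i : ℕ} (hi : i < m) :
    L.top i + L.height i ≤ m := by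
  rw [← hF.rows_eq, rows] at hi ⊢
  unfold top height
  split_ifs with h
  · have h3 : i / L.a < L.s₁ := by rwa [Nat.div_lt_iff_lt_mul hF.a_pos]
    nlinarith
  · have h3 : (i - L.s₁ * L.a) / (L.a + 1) < L.s₂ := by
      rw [Nat.div_lt_iff_lt_mul (Nat.succ_pos _)]
      simp only [Nat.succ_eq_add_one]
      omega
    nlinarith

theorem height_eq (i : ℕ) : L.height i = L.a ∨ L.height i = L.a + 1 := by
  unfold height
  split_ifs <;> simp

theorem Fits.mem_part_iff (hF : L.Fits m n) {d d' : ℕ → Bool} {f : Cell m n → Fin k}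
    (hf : ∀ v, (f v : ℕ) = L.label m n d d' v) {v : Cell m n} (hv : L.InStripParts v.1 v.2)
    (w : Cell m n) : w ∈ part f (f v) ↔ L.top v.1 ≤ w.1 ∧ (w.1 : ℕ) < L.top v.1 + L.height v.1 ∧
        ((w.2 : ℕ) * L.height v.1 + (w.1 - L.top v.1)) / L.A = L.index v.1 v.2 / L.A := by
  rw [← hF.label_eq_iff (d := d) (d' := d') hv, ← hf, ← hf]
  simp [part, Fin.ext_iff]

/-- Row of the unpartitioned cell at position `x`. -/
noncomputable def rowAt (L : Layout) (m n x : ℕ) : ℕ :=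
  open Classical in Nat.findGreatest (fun i => L.cum n i ≤ x) m

theorem rowAt_le (x : ℕ) : L.rowAt m n x ≤ m := Nat.findGreatest_le m

theorem cum_rowAt_le (x : ℕ) : L.cum n (L.rowAt m n x) ≤ x := by
  classical
  exact Nat.findGreatest_spec (P := fun i => L.cum n i ≤ x) (Nat.zero_le m) (by simp [cum])

theorem rowAt_mono : Monotone (L.rowAt m n) := by
  intro x y h
  classical
  exact Nat.le_findGreatest (rowAt_le x) ((cum_rowAt_le x).trans h)

theorem rowAt_spec {x : ℕ} (hx : x < L.cum n m) :
    L.rowAt m n x < m ∧ L.cum n (L.rowAt m n x) ≤ x ∧ x < L.cum n (L.rowAt m n x + 1) := by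
  have h1 := cum_rowAt_le (L := L) (m := m) (n := n) x
  have h2 : L.rowAt m n x < m := by
    refine lt_of_le_of_ne (rowAt_le x) fun h => ?_
    rw [h] at h1
    omega
  refine ⟨h2, h1, ?_⟩
  by_contra hcon
  have : L.rowAt m n x + 1 ≤ L.rowAt m n x := by
    classical
    conv_rhs => rw [rowAt]
    exact Nat.le_findGreatest (P := fun i => L.cum n i ≤ x) h2 (by omega)
  omega

theorem rowAt_eq {x i : ℕ} (hi : i < m) (h1 : L.cum n i ≤ x) (h2 : x < L.cum n (i + 1)) :
    L.rowAt m n x = i := by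
  have h := rowAt_spec (L := L) (m := m) (n := n)
    (h2.trans_le (cum_mono (show i + 1 ≤ m from hi)))
  exact eq_of_cum_bounds h.2.1 h.2.2 h1 h2

theorem Fits.rowAt_pos (hF : L.Fits m n) {d : ℕ → Bool} {v : Cell m n}
    (hv : ¬ L.InStripParts v.1 v.2) : L.rowAt m n (L.pos n d v.1 v.2) = v.1 :=
  rowAt_eq v.1.2 (hF.pos_lt_cum hv).1 (hF.pos_lt_cum hv).2

/-- The unpartitioned cells without an `r`-neighbour among the unpartitioned cells. -/
noncomputable def restExposed (L : Layout) (r : Cell m n → Cell m n → Prop) :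
    Finset (Cell m n) :=
  open Classical in Finset.univ.filter fun v =>
    ¬ L.InStripParts v.1 v.2 ∧ ¬ ∃ w : Cell m n, ¬ L.InStripParts w.1 w.2 ∧ r v w

/-! ### Sides of one part of R -/

section RestPart

variable {q : ℕ} {S : Finset (Cell m n)} {d : ℕ → Bool}

/-- The part meets each row in a segment, whichever way the row is traversed, so the number of rows
met bounds both counts. -/
theorem Fits.exposed_horizontal_le (hF : L.Fits m n)
    (hS : ∀ w : Cell m n, w ∈ S ↔ ¬ L.InStripParts w.1 w.2 ∧
      q * L.A ≤ L.pos n d w.1 w.2 ∧ L.pos n d w.1 w.2 < q * L.A + L.A) :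
    exposed LeftOf S ≤ L.rowAt m n (q * L.A + L.A - 1) + 1 - L.rowAt m n (q * L.A) ∧
    exposed RightOf S ≤ L.rowAt m n (q * L.A + L.A - 1) + 1 - L.rowAt m n (q * L.A) := by
  have hrow : ∀ v ∈ S, (v.1 : ℕ) ∈
      Finset.Icc (L.rowAt m n (q * L.A)) (L.rowAt m n (q * L.A + L.A - 1)) := by
    intro v hv
    rw [hS] at hv
    rw [← hF.rowAt_pos (d := d) hv.1, Finset.mem_Icc]
    exact ⟨rowAt_mono hv.2.1, rowAt_mono (by omega)⟩
  rw [← Nat.card_Icc]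
  constructor
  · refine exposed_le_of_injOn LeftOf S (fun v => (v.1 : ℕ)) _ hrow ?_
    have main : ∀ v ∈ S, ∀ w ∈ S, (v.2 : ℕ) < w.2 → (v.1 : ℕ) = w.1 → ∃ x ∈ S, LeftOf w x := by
      intro v hv w hw hlt h1
      have hw2 := w.2.2
      refine ⟨(w.1, ⟨w.2 - 1, by omega⟩), ?_, rfl, by simp only; omega⟩
      rw [hS, hF.inStripParts_iff (Fin.isLt _)] at hv hw ⊢
      simp only
      rw [h1] at hv
      unfold pos at hv hw ⊢
      split_ifs at hv hw ⊢ <;> omega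
    intro v hv w hw hne h1
    rcases lt_trichotomy (v.2 : ℕ) w.2 with h2 | h2 | h2
    · exact Or.inr (main v hv w hw h2 h1)
    · exact absurd (Prod.ext (Fin.ext h1) (Fin.ext h2)) hne
    · exact Or.inl (main w hw v hv h2 h1.symm)
  · refine exposed_le_of_injOn RightOf S (fun v => (v.1 : ℕ)) _ hrow ?_
    have main : ∀ v ∈ S, ∀ w ∈ S, (v.2 : ℕ) < w.2 → (v.1 : ℕ) = w.1 → ∃ x ∈ S, RightOf v x := by
      intro v hv w hw hlt h1
      have hw2 := w.2.2
      refine ⟨(v.1, ⟨v.2 + 1, by omega⟩), ?_, rfl, by simp only⟩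
      rw [hS, hF.inStripParts_iff (Fin.isLt _)] at hv hw ⊢
      simp only
      rw [← h1] at hw
      unfold pos at hv hw ⊢
      split_ifs at hv hw ⊢ <;> omega
    intro v hv w hw hne h1
    rcases lt_trichotomy (v.2 : ℕ) w.2 with h2 | h2 | h2
    · exact Or.inl (main v hv w hw h2 h1)
    · exact absurd (Prod.ext (Fin.ext h1) (Fin.ext h2)) hne
    · exact Or.inr (main w hw v hv h2 h1.symm)

theorem Fits.pos_lt_of_row_lt (hF : L.Fits m n) {v w : Cell m n}
    (hv : ¬ L.InStripParts v.1 v.2) (hw : ¬ L.InStripParts w.1 w.2) (h : (v.1 : ℕ) < w.1) :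
    L.pos n d v.1 v.2 < L.pos n d w.1 w.2 := by
  have h1 := (hF.pos_lt_cum (d := d) hv).2
  have h2 := (hF.pos_lt_cum (d := d) hw).1
  have h3 := cum_mono (L := L) (n := n) (show (v.1 : ℕ) + 1 ≤ w.1 from h)
  omega

open Classical in
-- Sides on the border of R are separated from sides between two parts of R: the former are counted
-- globally, the latter for each part.
theorem exposed_le_add (r : Cell m n → Cell m n → Prop)
    (hSr : ∀ v ∈ S, ¬ L.InStripParts v.1 v.2) (x : ℕ)
    (h : (S.filter fun v => (¬ ∃ w ∈ S, r v w) ∧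
      ∃ w : Cell m n, ¬ L.InStripParts w.1 w.2 ∧ r v w).card ≤ x) :
    exposed r S ≤ (S.filter fun v => v ∈ L.restExposed r).card + x := by
  refine le_trans ?_ (Nat.add_le_add_left h _)
  refine le_trans (Finset.card_le_card ?_) (Finset.card_union_le _ _)
  intro v hv
  rw [Finset.mem_filter] at hv
  rw [Finset.mem_union, Finset.mem_filter, Finset.mem_filter, restExposed, Finset.mem_filter]
  by_cases hw : ∃ w : Cell m n, ¬ L.InStripParts w.1 w.2 ∧ r v w
  · exact Or.inr ⟨hv.1, hv.2, hw⟩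
  · exact Or.inl ⟨hv.1, Finset.mem_univ _, hSr v hv.1, hw⟩

open Classical in
-- Where the upper neighbour lies in an earlier part, the row in which the part starts is the row of
-- the cell or of that neighbour. So the column of the cell is one of the uncut columns of that row,
-- and each column is used at most once.
theorem Fits.exposed_above_le (hF : L.Fits m n) (hq : q * L.A < L.cum n m)
    (hS : ∀ w : Cell m n, w ∈ S ↔ ¬ L.InStripParts w.1 w.2 ∧
      q * L.A ≤ L.pos n d w.1 w.2 ∧ L.pos n d w.1 w.2 < q * L.A + L.A) :
    exposed Above S ≤ (S.filter fun v => v ∈ L.restExposed Above).card +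
      L.len n (L.rowAt m n (q * L.A)) := by
  refine exposed_le_add Above (fun v hv => ((hS v).1 hv).1) _ ?_
  set i₀ := L.rowAt m n (q * L.A) with hi₀
  have hi := rowAt_spec hq
  rw [← hi₀] at hi
  have hlen := len_le (L := L) (n := n) hF.a_pos i₀
  have hcard : (Finset.Ico (n - L.len n i₀) n).card = L.len n i₀ := by
    rw [Nat.card_Ico]
    omega
  rw [← hcard]
  refine Finset.card_le_card_of_injOn (fun v => (v.2 : ℕ)) ?_ ?_
  · intro v hv
    simp only [Finset.coe_filter, Set.mem_ofPred_eq] at hv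
    obtain ⟨h1, h2, w, hw, hab⟩ := hv
    have hv1 := (hS v).1 h1
    have hwS : ¬ w ∈ S := fun hw => h2 ⟨w, hw, hab⟩
    have hlt := hF.pos_lt_of_row_lt (d := d) hw hv1.1 (by have := hab.2; omega)
    rw [hS] at hwS
    have hwq : L.pos n d w.1 w.2 < q * L.A := by
      by_contra hcon
      exact hwS ⟨hw, by omega, by omega⟩
    have b1 := hF.pos_lt_cum (d := d) hw
    have b2 := hF.pos_lt_cum (d := d) hv1.1
    have e1 : (w.1 : ℕ) ≤ i₀ := by
      by_contra hcon
      have := cum_mono (L := L) (n := n) (show i₀ + 1 ≤ w.1 by omega)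
      omega
    have e2 : i₀ ≤ v.1 := by
      by_contra hcon
      have := cum_mono (L := L) (n := n) (show (v.1 : ℕ) + 1 ≤ i₀ by omega)
      omega
    have e3 : i₀ = w.1 ∨ i₀ = v.1 := by have := hab.2; omega
    have hw' := hw
    have hv' := hv1.1
    rw [hF.inStripParts_iff (Fin.isLt _)] at hw' hv'
    rw [hab.1] at hw'
    have hv2 := v.2.2
    rw [Finset.coe_Ico, Set.mem_Ico]
    change n - L.len n i₀ ≤ (v.2 : ℕ) ∧ (v.2 : ℕ) < n
    rcases e3 with e3 | e3 <;> rw [e3] <;> omega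
  · intro v hv w hw hvw
    simp only [Finset.coe_filter, Set.mem_ofPred_eq] at hv hw
    have main : ∀ v ∈ S, ∀ w ∈ S, (v.1 : ℕ) < w.1 → (v.2 : ℕ) = w.2 →
        (∃ x : Cell m n, ¬ L.InStripParts x.1 x.2 ∧ Above w x) → ∃ x ∈ S, Above w x := by
      rintro v hv w hw h1 h2 ⟨x, hx, hab⟩
      refine ⟨x, ?_, hab⟩
      rw [hS] at hv hw ⊢
      refine ⟨hx, ?_, (hF.pos_lt_of_row_lt hx hw.1 (by have := hab.2; omega)).trans hw.2.2⟩
      by_cases h3 : (x.1 : ℕ) = v.1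
      · obtain rfl : x = v := Prod.ext (Fin.ext h3) (by rw [hab.1]; exact Fin.ext h2.symm)
        exact hv.2.1
      · have := hF.pos_lt_of_row_lt (d := d) hv.1 hx (by have := hab.2; omega)
        omega
    rcases lt_trichotomy (v.1 : ℕ) w.1 with h2 | h2 | h2
    · exact absurd (main v hv.1 w hw.1 h2 hvw hw.2.2) hw.2.1
    · exact Prod.ext (Fin.ext h2) (Fin.ext hvw)
    · exact absurd (main w hw.1 v hv.1 h2 hvw.symm hv.2.2) hv.2.1

open Classical in
-- The mirror image, with the row in which the part ends.
theorem Fits.exposed_below_le (hF : L.Fits m n) (hq : q * L.A + L.A ≤ L.cum n m)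
    (hS : ∀ w : Cell m n, w ∈ S ↔ ¬ L.InStripParts w.1 w.2 ∧
      q * L.A ≤ L.pos n d w.1 w.2 ∧ L.pos n d w.1 w.2 < q * L.A + L.A) :
    exposed Below S ≤ (S.filter fun v => v ∈ L.restExposed Below).card +
      L.len n (L.rowAt m n (q * L.A + L.A - 1)) := by
  have hA := hF.A_pos
  refine exposed_le_add Below (fun v hv => ((hS v).1 hv).1) _ ?_
  set i₀ := L.rowAt m n (q * L.A + L.A - 1) with hi₀
  have hi := rowAt_spec (L := L) (m := m) (n := n) (x := q * L.A + L.A - 1) (by omega)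
  rw [← hi₀] at hi
  have hlen := len_le (L := L) (n := n) hF.a_pos i₀
  have hcard : (Finset.Ico (n - L.len n i₀) n).card = L.len n i₀ := by
    rw [Nat.card_Ico]
    omega
  rw [← hcard]
  refine Finset.card_le_card_of_injOn (fun v => (v.2 : ℕ)) ?_ ?_
  · intro v hv
    simp only [Finset.coe_filter, Set.mem_ofPred_eq] at hv
    obtain ⟨h1, h2, w, hw, hab⟩ := hv
    have hv1 := (hS v).1 h1
    have hwS : ¬ w ∈ S := fun hw => h2 ⟨w, hw, hab⟩
    have hlt := hF.pos_lt_of_row_lt (d := d) hv1.1 hw (by have := hab.2; omega)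
    rw [hS] at hwS
    have hwq : q * L.A + L.A ≤ L.pos n d w.1 w.2 := by
      by_contra hcon
      exact hwS ⟨hw, by omega, by omega⟩
    have b1 := hF.pos_lt_cum (d := d) hw
    have b2 := hF.pos_lt_cum (d := d) hv1.1
    have e1 : i₀ ≤ w.1 := by
      by_contra hcon
      have := cum_mono (L := L) (n := n) (show (w.1 : ℕ) + 1 ≤ i₀ by omega)
      omega
    have e2 : (v.1 : ℕ) ≤ i₀ := by
      by_contra hcon
      have := cum_mono (L := L) (n := n) (show i₀ + 1 ≤ v.1 by omega)
      omega
    have e3 : i₀ = w.1 ∨ i₀ = v.1 := by have := hab.2; omega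
    have hw' := hw
    have hv' := hv1.1
    rw [hF.inStripParts_iff (Fin.isLt _)] at hw' hv'
    rw [hab.1] at hw'
    have hv2 := v.2.2
    rw [Finset.coe_Ico, Set.mem_Ico]
    change n - L.len n i₀ ≤ (v.2 : ℕ) ∧ (v.2 : ℕ) < n
    rcases e3 with e3 | e3 <;> rw [e3] <;> omega
  · intro v hv w hw hvw
    simp only [Finset.coe_filter, Set.mem_ofPred_eq] at hv hw
    have main : ∀ v ∈ S, ∀ w ∈ S, (v.1 : ℕ) < w.1 → (v.2 : ℕ) = w.2 →
        (∃ x : Cell m n, ¬ L.InStripParts x.1 x.2 ∧ Below v x) → ∃ x ∈ S, Below v x := by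
      rintro v hv w hw h1 h2 ⟨x, hx, hab⟩
      refine ⟨x, ?_, hab⟩
      rw [hS] at hv hw ⊢
      refine ⟨hx, hv.2.1.trans (hF.pos_lt_of_row_lt hv.1 hx (by have := hab.2; omega)).le, ?_⟩
      by_cases h3 : (x.1 : ℕ) = w.1
      · obtain rfl : x = w := Prod.ext (Fin.ext h3) (by rw [hab.1]; exact Fin.ext h2)
        exact hw.2.2
      · have := hF.pos_lt_of_row_lt (d := d) hx hw.1 (by have := hab.2; omega)
        omega
    rcases lt_trichotomy (v.1 : ℕ) w.1 with h2 | h2 | h2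
    · exact absurd (main v hv.1 w hw.1 h2 hvw hv.2.2) hv.2.1
    · exact Prod.ext (Fin.ext h2) (Fin.ext hvw)
    · exact absurd (main w hw.1 v hv.1 h2 hvw.symm hw.2.2) hw.2.1

end RestPart

/-! ### Row lengths along a strip and the upper and lower border of R -/

section RowLengths

/-- Number of the strip that contains row `i`. -/
def strip (L : Layout) (i : ℕ) : ℕ :=
  if i < L.s₁ * L.a then i / L.a else L.s₁ + (i - L.s₁ * L.a) / (L.a + 1)

theorem strip_lt (ha : 0 < L.a) {i : ℕ} (hi : i < L.rows) : L.strip i < L.s₁ + L.s₂ := by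
  unfold rows at hi
  unfold strip
  split_ifs with h
  · have h3 : i / L.a < L.s₁ := by rwa [Nat.div_lt_iff_lt_mul ha]
    omega
  · have h3 : (i - L.s₁ * L.a) / (L.a + 1) < L.s₂ := by
      rw [Nat.div_lt_iff_lt_mul (Nat.succ_pos _)]
      simp only [Nat.succ_eq_add_one]
      omega
    omega

theorem strip_inj (ha : 0 < L.a) {i i' : ℕ} (h : L.strip i = L.strip i') :
    L.top i = L.top i' ∧ L.height i = L.height i' ∧ L.rest n i = L.rest n i' := by
  unfold strip at h
  unfold top rest height parts
  have key : ∀ x, x < L.s₁ * L.a → x / L.a < L.s₁ := fun x hx => by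
    rwa [Nat.div_lt_iff_lt_mul ha]
  by_cases hi : i < L.s₁ * L.a <;> by_cases hi' : i' < L.s₁ * L.a <;>
    simp only [hi, hi', if_true, if_false] at h ⊢
  · simp [h]
  · exact absurd h ((key _ hi).trans_le (Nat.le_add_right _ _)).ne
  · exact absurd h ((key _ hi').trans_le (Nat.le_add_right _ _)).ne'
  · simp [Nat.add_left_cancel h]

theorem len_succ_of_lt (ha : 0 < L.a) {i : ℕ} (h : i + 1 < L.top i + L.height i) :
    L.height (i + 1) = L.height i ∧ L.rest n (i + 1) = L.rest n i ∧
      L.top (i + 1) = L.top i ∧ L.offset (i + 1) = L.offset i + 1 ∧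
      L.len n i ≤ L.len n (i + 1) ∧ L.len n (i + 1) ≤ L.len n i + 1 ∧
      (L.len n i < L.len n (i + 1) → L.height i ∣ L.rest n i + L.offset (i + 1)) := by
  obtain ⟨h1, h2, h3, -⟩ := strip_congr ha (i := i) (i' := i + 1)
    (by have := top_le (L := L) i; omega) h
  have h4 : L.rest n (i + 1) = L.rest n i := by rw [rest, rest, h1, h3]
  have h5 : L.offset (i + 1) = L.offset i + 1 := by
    have := top_le (L := L) i
    rw [offset, offset, h2]
    omega
  refine ⟨h1, h4, h2, h5, ?_⟩
  have hh := height_pos ha i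
  rw [len, len, h1, h4, h5, ← add_assoc, Nat.succ_div]
  split_ifs with hd
  · exact ⟨by omega, le_rfl, fun _ => hd⟩
  · exact ⟨by omega, by omega, fun h => absurd h (by simp)⟩

/-- The offset falls from h - 1 to 0 between two strips of the same kind, so the quotient drops by
at most one. The row where the strip height changes is excluded: there the lengths are unrelated. -/
theorem len_succ_of_eq (ha : 0 < L.a) {i : ℕ} (h : i + 1 = L.top i + L.height i)
    (hs : i + 1 ≠ L.s₁ * L.a) :
    L.len n (i + 1) ≤ L.len n i ∧ L.len n i ≤ L.len n (i + 1) + 1 := by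
  have hh := height_pos ha i
  have h0 : L.offset i = L.height i - 1 := by
    have := top_le (L := L) i
    rw [offset]
    omega
  have h1 : L.height (i + 1) = L.height i ∧ L.parts (i + 1) = L.parts i := by
    unfold height parts
    by_cases hi : i < L.s₁ * L.a
    · have h2 : i + 1 < L.s₁ * L.a := by omega
      simp [hi, h2]
    · have h2 : ¬ i + 1 < L.s₁ * L.a := by omega
      simp [hi, h2]
  have h2 : L.rest n (i + 1) = L.rest n i := by rw [rest, rest, h1.1, h1.2]
  have h3 := offset_lt ha (i + 1)
  have h4 : L.offset (i + 1) = 0 := by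
    by_contra hne
    have e1 := top_add_offset (L := L) (i + 1)
    have e2 := lt_top_add_height ha (i + 1)
    have e3 := (strip_congr ha (i := i + 1) (i' := i) (by omega) (by omega)).2.1
    omega
  rw [len, len, h1.1, h2, h0, h4]
  constructor
  · exact Nat.div_le_div_right (by omega)
  · rw [add_zero, ← Nat.add_div_right _ hh]
    exact Nat.div_le_div_right (by omega)

theorem card_triple_le (H s : ℕ) : ((({0, 1} : Finset ℕ) ×ˢ Finset.range H) ∪
    (({2} : Finset ℕ) ×ˢ Finset.range s)).card ≤ 2 * H + s := by
  refine (Finset.card_union_le _ _).trans ?_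
  simp

/-- The first row and the row where the strip height changes may be exposed throughout. Elsewhere
only a growth of the row length exposes a cell, and it happens at most once per strip, at the offset
for which h divides N + o. -/
theorem Fits.card_restExposed_above_le (hF : L.Fits m n) {H : ℕ}
    (hH : ∀ i < m, L.len n i ≤ H) :
    (L.restExposed (Above (m := m) (n := n))).card ≤ 2 * H + (L.s₁ + L.s₂) := by
  have ha := hF.a_pos
  refine le_trans (Finset.card_le_card_of_injOn
    -- Tags 0 and 1 record the distance from the right end in the two exceptional rows; tag 2
    -- records the strip.
    (fun v => if (v.1 : ℕ) = 0 then (0, n - 1 - (v.2 : ℕ)) else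
      if (v.1 : ℕ) = L.s₁ * L.a then (1, n - 1 - (v.2 : ℕ)) else (2, L.strip v.1)) ?_ ?_)
    (card_triple_le H (L.s₁ + L.s₂))
  · intro v hv
    have h1 := hH v.1 v.1.2
    have h2 := len_le (L := L) (n := n) ha v.1
    have h3 := v.2.2
    have h4 := strip_lt ha (L := L) (i := v.1) (by rw [hF.rows_eq]; exact v.1.2)
    simp only [restExposed, Finset.coe_filter, Finset.mem_univ, true_and, Set.mem_ofPred_eq] at hv
    rw [hF.inStripParts_iff v.1.2] at hv
    simp only [Finset.mem_coe]
    split_ifs <;> simp <;> omega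
  · have main : ∀ v ∈ L.restExposed (Above (m := m) (n := n)), (v.1 : ℕ) ≠ 0 →
        (v.1 : ℕ) ≠ L.s₁ * L.a → n - L.len n v.1 = v.2 ∧
        L.height v.1 ∣ L.rest n v.1 + L.offset v.1 := by
      rintro ⟨⟨i, hi⟩, j⟩ hv h0 h1
      simp only [restExposed, Finset.mem_filter, Finset.mem_univ, true_and] at hv h0 h1 ⊢
      obtain ⟨hv1, hv2⟩ := hv
      obtain ⟨i, rfl⟩ : ∃ i', i = i' + 1 := ⟨i - 1, by omega⟩
      rw [hF.inStripParts_iff hi] at hv1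
      have hj : (j : ℕ) < n - L.len n i := by
        by_contra hcon
        refine hv2 ⟨(⟨i, by omega⟩, j), ?_, rfl, rfl⟩
        rw [hF.inStripParts_iff (by simp; omega)]
        exact hcon
      have e := lt_top_add_height ha i
      rcases (show i + 1 ≤ L.top i + L.height i by omega).lt_or_eq with h | h
      · obtain ⟨e1, e2, e3, e4, e5, e6, e7⟩ := len_succ_of_lt (n := n) ha h
        refine ⟨by omega, ?_⟩
        rw [e1, e2]
        exact e7 (by omega)
      · have := len_succ_of_eq (n := n) ha h h1
        omega
    intro v hv w hw h
    simp only [Finset.mem_coe] at hv hw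
    have hv2 := v.2.2
    have hw2 := w.2.2
    by_cases v0 : (v.1 : ℕ) = 0
    · by_cases w0 : (w.1 : ℕ) = 0
      · simp only [v0, w0, if_true, Prod.mk.injEq, true_and] at h
        exact Prod.ext (Fin.ext (by omega)) (Fin.ext (by omega))
      · simp only [v0, w0, if_true, if_false] at h
        split_ifs at h <;> simp at h
    · by_cases w0 : (w.1 : ℕ) = 0
      · simp only [v0, w0, if_true, if_false] at h
        split_ifs at h <;> simp at h
      · simp only [v0, w0, if_false] at h
        by_cases v1 : (v.1 : ℕ) = L.s₁ * L.a
        · by_cases w1 : (w.1 : ℕ) = L.s₁ * L.a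
          · simp only [v1, w1, if_true, Prod.mk.injEq, true_and] at h
            exact Prod.ext (Fin.ext (by omega)) (Fin.ext (by omega))
          · simp [v1, w1] at h
        · by_cases w1 : (w.1 : ℕ) = L.s₁ * L.a
          · simp [v1, w1] at h
          · simp only [v1, w1, if_false, Prod.mk.injEq, true_and] at h
            obtain ⟨e1, e2, e3⟩ := strip_inj (n := n) ha h
            obtain ⟨a1, a2⟩ := main v hv v0 v1
            obtain ⟨b1, b2⟩ := main w hw w0 w1
            rw [e2, e3] at a2
            have o1 := offset_lt ha v.1
            have o2 := offset_lt ha w.1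
            have t1 := top_add_offset (L := L) v.1
            have t2 := top_add_offset (L := L) w.1
            rw [e2] at o1
            have hoff : L.offset v.1 = L.offset w.1 := by
              have hd := (Nat.modEq_zero_iff_dvd.2 a2).trans (Nat.modEq_zero_iff_dvd.2 b2).symm
              have := Nat.ModEq.add_left_cancel' _ hd
              exact Nat.ModEq.eq_of_lt_of_lt this o1 o2
            have hr : (v.1 : ℕ) = w.1 := by omega
            rw [hr] at a1
            exact Prod.ext (Fin.ext hr) (Fin.ext (by omega))

/-- Here the ordinary exposed cells come from the drop by at most one at the bottom of a strip. -/
theorem Fits.card_restExposed_below_le (hF : L.Fits m n) {H : ℕ}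
    (hH : ∀ i < m, L.len n i ≤ H) :
    (L.restExposed (Below (m := m) (n := n))).card ≤ 2 * H + (L.s₁ + L.s₂) := by
  have ha := hF.a_pos
  refine le_trans (Finset.card_le_card_of_injOn
    (fun v => if (v.1 : ℕ) + 1 = m then (0, n - 1 - (v.2 : ℕ)) else
      if (v.1 : ℕ) + 1 = L.s₁ * L.a then (1, n - 1 - (v.2 : ℕ)) else (2, L.strip v.1)) ?_ ?_)
    (card_triple_le H (L.s₁ + L.s₂))
  · intro v hv
    have h1 := hH v.1 v.1.2
    have h2 := len_le (L := L) (n := n) ha v.1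
    have h3 := v.2.2
    have h4 := strip_lt ha (L := L) (i := v.1) (by rw [hF.rows_eq]; exact v.1.2)
    simp only [restExposed, Finset.coe_filter, Finset.mem_univ, true_and, Set.mem_ofPred_eq] at hv
    rw [hF.inStripParts_iff v.1.2] at hv
    simp only [Finset.mem_coe]
    split_ifs <;> simp <;> omega
  · have main : ∀ v ∈ L.restExposed (Below (m := m) (n := n)), (v.1 : ℕ) + 1 ≠ m →
        (v.1 : ℕ) + 1 ≠ L.s₁ * L.a → n - L.len n v.1 = v.2 ∧
        (v.1 : ℕ) + 1 = L.top v.1 + L.height v.1 := by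
      rintro ⟨⟨i, hi⟩, j⟩ hv h0 h1
      simp only [restExposed, Finset.mem_filter, Finset.mem_univ, true_and] at hv h0 h1 ⊢
      obtain ⟨hv1, hv2⟩ := hv
      rw [hF.inStripParts_iff hi] at hv1
      have hj : (j : ℕ) < n - L.len n (i + 1) := by
        by_contra hcon
        refine hv2 ⟨(⟨i + 1, by omega⟩, j), ?_, rfl, rfl⟩
        rw [hF.inStripParts_iff (by simp; omega)]
        exact hcon
      have e := lt_top_add_height ha i
      rcases (show i + 1 ≤ L.top i + L.height i by omega).lt_or_eq with h | h
      · obtain ⟨e1, e2, e3, e4, e5, e6, e7⟩ := len_succ_of_lt (n := n) ha h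
        omega
      · have := len_succ_of_eq (n := n) ha h h1
        omega
    intro v hv w hw h
    simp only [Finset.mem_coe] at hv hw
    have hv2 := v.2.2
    have hw2 := w.2.2
    by_cases v0 : (v.1 : ℕ) + 1 = m
    · by_cases w0 : (w.1 : ℕ) + 1 = m
      · simp only [v0, w0, if_true, Prod.mk.injEq, true_and] at h
        exact Prod.ext (Fin.ext (by omega)) (Fin.ext (by omega))
      · simp only [v0, w0, if_true, if_false] at h
        split_ifs at h <;> simp at h
    · by_cases w0 : (w.1 : ℕ) + 1 = m
      · simp only [v0, w0, if_true, if_false] at h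
        split_ifs at h <;> simp at h
      · simp only [v0, w0, if_false] at h
        by_cases v1 : (v.1 : ℕ) + 1 = L.s₁ * L.a
        · by_cases w1 : (w.1 : ℕ) + 1 = L.s₁ * L.a
          · simp only [v1, w1, if_true, Prod.mk.injEq, true_and] at h
            exact Prod.ext (Fin.ext (by omega)) (Fin.ext (by omega))
          · simp [v1, w1] at h
        · by_cases w1 : (w.1 : ℕ) + 1 = L.s₁ * L.a
          · simp [v1, w1] at h
          · simp only [v1, w1, if_false, Prod.mk.injEq, true_and] at h
            obtain ⟨e1, e2, e3⟩ := strip_inj (n := n) ha h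
            obtain ⟨a1, a2⟩ := main v hv v0 v1
            obtain ⟨b1, b2⟩ := main w hw w0 w1
            have hr : (v.1 : ℕ) = w.1 := by omega
            rw [hr] at a1
            exact Prod.ext (Fin.ext hr) (Fin.ext (by omega))

end RowLengths

/-! ### Summation of the perimeters over all parts -/

theorem Fits.mem_rest_part_iff (hF : L.Fits m n) {d d' : ℕ → Bool} {f : Cell m n → Fin k}
    (hf : ∀ v, (f v : ℕ) = L.label m n d d' v) {t : Fin k} {q : ℕ}
    (ht : (t : ℕ) = L.stripParts + q) (w : Cell m n) :
    w ∈ part f t ↔ ¬ L.InStripParts w.1 w.2 ∧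
      q * L.A ≤ L.pos n d w.1 w.2 ∧ L.pos n d w.1 w.2 < q * L.A + L.A := by
  have h1 : w ∈ part f t ↔ L.label m n d d' w = L.stripParts + q := by
    rw [← hf, ← ht]
    simp [part, Fin.ext_iff]
  rw [h1]
  by_cases hw : L.InStripParts w.1 w.2
  · have := hF.label_lt (d := d) (d' := d') hw
    simp only [hw, not_true_eq_false, false_and, iff_false]
    omega
  · rw [hF.label_of_not hw]
    simp only [hw, not_false_eq_true, true_and, Nat.add_left_cancel_iff, Nat.div_eq_iff hF.A_pos]
    have := hF.A_pos
    omega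

/-- A part starts no higher than the row where its predecessor ends, so the sum telescopes up to one
extra row per part. -/
theorem sum_rowAt_le (hA : 0 < L.A) (K : ℕ) :
    ∑ q ∈ Finset.range K, (L.rowAt m n (q * L.A + L.A - 1) + 1 - L.rowAt m n (q * L.A)) ≤
      m + K := by
  suffices h : ∑ q ∈ Finset.range K,
      (L.rowAt m n (q * L.A + L.A - 1) + 1 - L.rowAt m n (q * L.A)) ≤ L.rowAt m n (K * L.A) + K by
    have := rowAt_le (L := L) (m := m) (n := n) (K * L.A)
    omega
  induction K with
  | zero => simp
  | succ K ih =>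
    rw [Finset.sum_range_succ]
    have h1 := rowAt_mono (L := L) (m := m) (n := n)
      (show K * L.A ≤ K * L.A + L.A - 1 by omega)
    have h2 := rowAt_mono (L := L) (m := m) (n := n)
      (show K * L.A + L.A - 1 ≤ (K + 1) * L.A by rw [add_mul]; omega)
    omega

/-- The first ⌊C/A⌋ parts of R lie in strips of height `a`, where C counts the cells of R there.
Only the next one can straddle the change of height, and it is charged `H` in addition. -/
theorem Fits.sum_len_le (hF : L.Fits m n) {K H M₁ M₂ : ℕ} (hK : L.cum n m = K * L.A)
    (hM₁ : ∀ i < L.s₁ * L.a, L.len n i ≤ M₁) (hM₂ : ∀ i < m, L.s₁ * L.a ≤ i → L.len n i ≤ M₂)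
    (hH₁ : M₁ ≤ H) (hH₂ : M₂ ≤ H) (x : ℕ → ℕ)
    (hx : ∀ q, q * L.A ≤ x q ∧ x q < q * L.A + L.A) :
    ∑ q ∈ Finset.range K, L.len n (L.rowAt m n (x q)) ≤
      (L.cum n (L.s₁ * L.a) / L.A) * M₁ + (K - L.cum n (L.s₁ * L.a) / L.A) * M₂ + H := by
  have hA := hF.A_pos
  set C := L.cum n (L.s₁ * L.a) with hC
  set B := C / L.A with hB
  have hBK : B ≤ K := by
    rw [hB]
    refine Nat.div_le_of_le_mul ?_
    rw [mul_comm, ← hK, hC]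
    apply cum_mono
    rw [← hF.rows_eq]
    exact Nat.le_add_right _ _
  have hB1 : B * L.A ≤ C := Nat.div_mul_le_self _ _
  have hB2 : C < B * L.A + L.A := Nat.lt_div_mul_add hA
  have hterm : ∀ q ∈ Finset.range K, L.len n (L.rowAt m n (x q)) ≤
      (if q < B then M₁ else M₂) + if q = B then H else 0 := by
    intro q hq
    rw [Finset.mem_range] at hq
    have hqK : q * L.A + L.A ≤ K * L.A := by nlinarith
    obtain ⟨h1, h2, h3⟩ := rowAt_spec (L := L) (m := m) (n := n) (x := x q)
      (by have := (hx q).2; omega)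
    by_cases hr : L.rowAt m n (x q) < L.s₁ * L.a
    · have h4 := hM₁ _ hr
      rcases lt_trichotomy q B with h | h | h
      · rw [if_pos h]
        omega
      · rw [if_pos h]
        omega
      · exfalso
        have h5 := cum_mono (L := L) (n := n) (show L.rowAt m n (x q) + 1 ≤ L.s₁ * L.a from hr)
        have h6 := (hx q).1
        nlinarith
    · have h4 := hM₂ _ h1 (by omega)
      rcases lt_trichotomy q B with h | h | h
      · exfalso
        have h5 := cum_mono (L := L) (n := n) (show L.s₁ * L.a ≤ L.rowAt m n (x q) by omega)
        have h6 := (hx q).2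
        nlinarith
      · rw [if_pos h]
        omega
      · rw [if_neg (by omega)]
        omega
  refine (Finset.sum_le_sum hterm).trans ?_
  rw [Finset.sum_add_distrib, Finset.sum_ite_eq']
  refine add_le_add ?_ (by split_ifs <;> simp)
  obtain ⟨e, rfl⟩ := Nat.exists_eq_add_of_le hBK
  rw [Finset.sum_range_add, Nat.add_sub_cancel_left]
  refine add_le_add (le_of_eq ?_) (le_of_eq ?_)
  · rw [Finset.sum_congr rfl fun q hq => if_pos (Finset.mem_range.1 hq)]
    simp
  · rw [Finset.sum_congr rfl fun q _ => if_neg (show ¬ B + q < B by omega)]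
    simp

theorem Fits.totalPerimeter_le (hF : L.Fits m n) {d d' : ℕ → Bool} {f : Cell m n → Fin k}
    (hk : k * L.A = m * n) (hf : ∀ v, (f v : ℕ) = L.label m n d d' v) {c H M₁ M₂ : ℕ}
    (hc : ∀ h, h = L.a ∨ h = L.a + 1 → h + ((L.A + h - 2) / h + 1) ≤ c + 1)
    (hM₁ : ∀ i < L.s₁ * L.a, L.len n i ≤ M₁) (hM₂ : ∀ i < m, L.s₁ * L.a ≤ i → L.len n i ≤ M₂)
    (hH₁ : M₁ ≤ H) (hH₂ : M₂ ≤ H) :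
    totalPerimeter f ≤ 2 * L.stripParts * (c + 1) + 2 * (m + (k - L.stripParts)) +
      2 * ((L.cum n (L.s₁ * L.a) / L.A) * M₁ +
        (k - L.stripParts - L.cum n (L.s₁ * L.a) / L.A) * M₂) +
      6 * H + 2 * (L.s₁ + L.s₂) := by
  classical
  have hA := hF.A_pos
  obtain ⟨hKk, hK⟩ := hF.cum_eq_mul hk
  set K := k - L.stripParts with hKdef
  have hH : ∀ i < m, L.len n i ≤ H := fun i hi => by
    by_cases h : i < L.s₁ * L.a
    · exact (hM₁ i h).trans hH₁
    · exact (hM₂ i hi (by omega)).trans hH₂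
  let g : ℕ → ℕ := fun t => if t < L.stripParts then 2 * (c + 1) else
    2 * (L.rowAt m n ((t - L.stripParts) * L.A + L.A - 1) + 1 -
      L.rowAt m n ((t - L.stripParts) * L.A)) +
    L.len n (L.rowAt m n ((t - L.stripParts) * L.A)) +
    L.len n (L.rowAt m n ((t - L.stripParts) * L.A + L.A - 1))
  have hpart : ∀ t : Fin k, perimeter (part f t) ≤ g t +
      (((part f t).filter fun v => v ∈ L.restExposed Above).card +
        ((part f t).filter fun v => v ∈ L.restExposed Below).card) := by
    intro t
    by_cases ht : (t : ℕ) < L.stripParts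
    · refine le_trans ?_ (Nat.le_add_right _ _)
      simp only [g, if_pos ht]
      have hne : (part f t).Nonempty := by
        rw [← Finset.card_pos, hF.card_part hk hf]
        exact hA
      obtain ⟨v, hv⟩ := hne
      obtain rfl : f v = t := by simpa [part] using hv
      rw [hf, hF.label_lt_iff] at ht
      exact (perimeter_le_of_consecutive (height_pos hF.a_pos v.1) hA
        (hF.mem_part_iff hf ht)).trans (Nat.mul_le_mul_left 2 (hc _ (height_eq _)))
    · have hS := hF.mem_rest_part_iff hf (t := t) (q := t - L.stripParts) (by omega)
      have hq : ((t : ℕ) - L.stripParts) * L.A + L.A ≤ L.cum n m := by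
        rw [hK]
        have : (t : ℕ) - L.stripParts + 1 ≤ K := by have := t.2; omega
        nlinarith
      have h1 := hF.exposed_horizontal_le hS
      have h2 := hF.exposed_above_le (by omega) hS
      have h3 := hF.exposed_below_le hq hS
      rw [perimeter_eq]
      simp only [g, if_neg ht]
      omega
  have hfib : ∀ r : Cell m n → Cell m n → Prop,
      ∑ t : Fin k, ((part f t).filter fun v => v ∈ L.restExposed r).card =
        (L.restExposed r).card := by
    intro r
    rw [Finset.card_eq_sum_card_fiberwise (s := L.restExposed r)
      (t := (Finset.univ : Finset (Fin k))) (f := f) (fun v _ => by simp)]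
    refine Finset.sum_congr rfl fun t _ => ?_
    congr 1
    ext v
    simp [part, and_comm]
  have hsum : ∑ t ∈ Finset.range k, g t = L.stripParts * (2 * (c + 1)) +
      ∑ q ∈ Finset.range K, (2 * (L.rowAt m n (q * L.A + L.A - 1) + 1 -
      L.rowAt m n (q * L.A)) + L.len n (L.rowAt m n (q * L.A)) +
    L.len n (L.rowAt m n (q * L.A + L.A - 1))) := by
    rw [show k = L.stripParts + K by omega, Finset.sum_range_add]
    congr 1
    · rw [Finset.sum_congr rfl fun q hq => if_pos (Finset.mem_range.1 hq)]
      simp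
    · refine Finset.sum_congr rfl fun q _ => ?_
      simp [g]
  have htot : totalPerimeter f ≤ ∑ t ∈ Finset.range k, g t +
      ((L.restExposed (Above (m := m) (n := n))).card +
        (L.restExposed (Below (m := m) (n := n))).card) := by
    rw [totalPerimeter, ← Fin.sum_univ_eq_sum_range, ← hfib, ← hfib, ← Finset.sum_add_distrib,
      ← Finset.sum_add_distrib]
    exact Finset.sum_le_sum fun t _ => hpart t
  rw [hsum, Finset.sum_add_distrib, Finset.sum_add_distrib, ← Finset.mul_sum] at htot
  have h1 := sum_rowAt_le (L := L) (m := m) (n := n) hA K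
  have h2 := hF.sum_len_le hK hM₁ hM₂ hH₁ hH₂ (fun q => q * L.A) (fun q => ⟨le_rfl, by omega⟩)
  have h3 := hF.sum_len_le hK hM₁ hM₂ hH₁ hH₂ (fun q => q * L.A + L.A - 1)
    (fun q => ⟨by omega, by omega⟩)
  have h4 := hF.card_restExposed_above_le hH
  have h5 := hF.card_restExposed_below_le hH
  have h6 : L.stripParts * (2 * (c + 1)) = 2 * L.stripParts * (c + 1) := by ring
  omega

end Layout

/-! ### Numerical facts about the golden ratio -/

section GoldenRatio

theorem goldenRatio_bounds : (1.618 : ℝ) < φ ∧ φ < 1.6181 := by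
  have h1 := Real.goldenRatio_sq
  have h2 := Real.goldenRatio_pos
  constructor <;> nlinarith

theorem inv_goldenRatio : (φ : ℝ)⁻¹ = φ - 1 := by
  have h1 := Real.goldenRatio_sq
  exact inv_eq_of_mul_eq_one_right (by linarith)

theorem floor_div_goldenRatio (a : ℕ) :
    (⌊(a : ℝ) / φ⌋₊ : ℝ) ≤ (φ - 1) * a ∧ (φ - 1) * a < ⌊(a : ℝ) / φ⌋₊ + 1 := by
  have h : (a : ℝ) / φ = (φ - 1) * a := by rw [div_eq_mul_inv, inv_goldenRatio, mul_comm]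
  have h2 := goldenRatio_bounds
  constructor
  · rw [← h]
    exact Nat.floor_le (by rw [h]; exact mul_nonneg (by linarith) (by positivity))
  · rw [← h]
    exact Nat.lt_floor_add_one _

/-- From φa = a/φ + a, which is irrational. So the stopping window holds exactly a + 2 integers, and
A ≤ a(a + 2): a part cannot jump over it. -/
theorem ceil_mul_goldenRatio {a : ℕ} (ha : 0 < a) :
    ⌈φ * (a : ℝ)⌉₊ = ⌊(a : ℝ) / φ⌋₊ + a + 1 := by
  obtain ⟨h1, h2⟩ := floor_div_goldenRatio a
  have hne : φ * (a : ℝ) ≠ (⌊(a : ℝ) / φ⌋₊ + a : ℕ) := by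
    have := (Real.goldenRatio_irrational.mul_natCast ha.ne').ne_nat (⌊(a : ℝ) / φ⌋₊ + a)
    exact this
  have h3 : ((⌊(a : ℝ) / φ⌋₊ + a : ℕ) : ℝ) ≤ φ * a := by
    push_cast
    linarith
  rw [Nat.ceil_eq_iff (by omega)]
  constructor
  · rw [Nat.add_sub_cancel]
    exact lt_of_le_of_ne h3 hne.symm
  · push_cast
    linarith

theorem ceil_mul_goldenRatio_lt (a : ℕ) : (⌈φ * (a : ℝ)⌉₊ : ℝ) < φ * a + 1 :=
  Nat.ceil_lt_add_one (mul_nonneg Real.goldenRatio_pos.le (by positivity))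

end GoldenRatio

/-! ### The stopping rule in terms of the number of uncut cells -/

section Stop

theorem sub_ceilDiv {n h x : ℕ} (hh : 0 < h) (hx : x ≤ n * h) :
    n - x ⌈/⌉ h = (n * h - x) / h := by
  have hc : ∀ y, x ⌈/⌉ h ≤ y ↔ x ≤ h * y := fun y => ceilDiv_le_iff_le_mul hh
  have h1 := Nat.div_mul_le_self (n * h - x) h
  have h2 := Nat.lt_div_mul_add (a := n * h - x) hh
  generalize (n * h - x) / h = q at h1 h2
  have hqn : q ≤ n := by
    by_contra hcon
    nlinarith [Nat.sub_le (n * h) x]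
  obtain ⟨e, rfl⟩ := Nat.exists_eq_add_of_le hqn
  rw [add_mul] at h1 h2 hx
  have h3 : x ⌈/⌉ h ≤ e := by
    rw [hc, mul_comm]
    omega
  have h4 : e ≤ x ⌈/⌉ h := by
    by_contra hcon
    have h5 := (hc (e - 1)).1 (by omega)
    have h6 : h * (e - 1) + h = e * h := by
      rw [mul_comm e, Nat.mul_sub, Nat.mul_one, Nat.sub_add_cancel]
      exact Nat.le_mul_of_pos_right h (by omega)
    omega
  omega

theorem IsStop.bounds {n A a h p : ℕ} (hh : 0 < h) (hp : IsStop n A a h p) :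
    p * A ≤ n * h ∧ ⌊(a : ℝ) / φ⌋₊ ≤ (n * h - p * A) / h ∧
      (n * h - p * A) / h ≤ ⌈φ * (a : ℝ)⌉₊ := by
  obtain ⟨h1, h2, h3⟩ := hp.1
  rw [sub_ceilDiv hh h1] at h2 h3
  exact ⟨h1, h2, h3⟩

end Stop

/-! ### Strip parts are optimal up to one row or column -/

section Sqrt

theorem add_div_le_ceil {A h : ℕ} (hA : 0 < A) (hh : h = Nat.sqrt A ∨ h = Nat.sqrt A + 1) :
    h + ((A + h - 2) / h + 1) ≤ ⌈2 * √(A : ℝ)⌉₊ + 1 := by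
  set a := Nat.sqrt A with ha
  have ha1 : a * a ≤ A := Nat.sqrt_le A
  have ha2 : A ≤ a * a + a + a := Nat.sqrt_le_add A
  have ha0 : 0 < a := Nat.sqrt_pos.2 hA
  have hh0 : 0 < h := by omega
  have key : ∀ y : ℕ, y * y < 4 * A → y + 1 ≤ ⌈2 * √(A : ℝ)⌉₊ := by
    intro y hy
    rw [Nat.add_one_le_iff, Nat.lt_ceil]
    have h1 : (y : ℝ) * y < 4 * A := by exact_mod_cast hy
    have h2 : √(A : ℝ) * √(A : ℝ) = A := Real.mul_self_sqrt (by positivity)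
    have h3 := Real.sqrt_nonneg (A : ℝ)
    by_contra hcon
    nlinarith
  rw [← add_assoc, ← Nat.sub_add_cancel (hh0.trans_le (Nat.le_add_right h ((A + h - 2) / h)))]
  -- It remains to show (h + q - 1)² < 4A. With p = q - 1 this square is 4hp + (h - p)², while A ≥
  -- hp + 2; so |h - p| ≤ 2 is enough. The only other case is h = a + 1, p = a - 2, where the square
  -- is (2a - 1)² and A ≥ a².
  refine Nat.add_le_add_right (key _ ?_) 1
  have hq1 := Nat.div_mul_le_self (A + h - 2) h
  have hq2 := Nat.lt_div_mul_add (a := A + h - 2) hh0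
  generalize (A + h - 2) / h = q at hq1 hq2
  rcases Nat.eq_zero_or_pos q with rfl | hq
  · have h2 : h + 0 - 1 ≤ a := by omega
    nlinarith
  obtain ⟨p, rfl⟩ : ∃ p, q = p + 1 := ⟨q - 1, by omega⟩
  have e2 : h + (p + 1) - 1 = h + p := by omega
  rw [e2]
  have hp1 : p * h + 2 ≤ A := by
    rw [add_mul] at hq1
    omega
  have hp2 : A ≤ (p + 1) * h + 1 := by omega
  rcases hh with rfl | rfl
  · have h1 : p ≤ a + 1 := by
      by_contra hcon
      have : (a + 2) * a ≤ p * a := Nat.mul_le_mul_right a (by omega)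
      nlinarith
    have h2 : a ≤ p + 1 := by
      by_contra hcon
      have : (p + 1) * a ≤ (a - 1) * a := Nat.mul_le_mul_right a (by omega)
      rw [Nat.sub_mul] at this
      have := Nat.sub_add_cancel (show 1 * a ≤ a * a from Nat.mul_le_mul_right a ha0)
      nlinarith
    obtain h3 | h3 | h3 : p + 1 = a ∨ p = a ∨ p = a + 1 := by omega
    · rw [← h3] at hp1 ⊢
      nlinarith
    · subst h3
      nlinarith
    · subst h3
      nlinarith
  · have h1 : p ≤ a := by
      by_contra hcon
      have : (a + 1) * (a + 1) ≤ p * (a + 1) := Nat.mul_le_mul_right _ (by omega)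
      nlinarith
    have h2 : a ≤ p + 2 := by
      by_contra hcon
      have h3 : (p + 1) * (a + 1) ≤ (a - 2) * (a + 1) := Nat.mul_le_mul_right _ (by omega)
      have h4 : (a - 2) * (a + 1) + 2 * (a + 1) = a * (a + 1) := by
        rw [← add_mul, Nat.sub_add_cancel (by omega)]
      nlinarith
    obtain h3 | h3 | h3 : p + 2 = a ∨ p + 1 = a ∨ p = a := by omega
    · rw [← h3] at ha1 ⊢
      nlinarith
    · rw [← h3] at hp1 ⊢
      nlinarith
    · subst h3
      nlinarith

end Sqrt

/-! ### The last strip S₂ is always empty -/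

section Layouts

variable {m n k : ℕ} {L : Layout}

/-- The part size `m * n / k`. -/
theorem partSize (hm : 0 < m) (hn : 0 < n) (hnk : n ≤ k) (hk : k ∣ m * n) :
    k * (m * n / k) = m * n ∧ 0 < m * n / k ∧ m * n / k ≤ m := by
  have h1 := Nat.mul_div_cancel' hk
  have h2 : 0 < m * n := Nat.mul_pos hm hn
  refine ⟨h1, Nat.pos_of_ne_zero fun h => by simp [h] at h1; omega, ?_⟩
  by_contra hcon
  nlinarith

/-- From a² ≤ A ≤ m the quotient is at least a, which exceeds the remainder. -/
theorem sqrt_mod_le_div {A : ℕ} (hA : 0 < A) (hAm : A ≤ m) :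
    m % Nat.sqrt A ≤ m / Nat.sqrt A := by
  have h0 : 0 < Nat.sqrt A := Nat.sqrt_pos.2 hA
  have h1 : Nat.sqrt A ≤ m / Nat.sqrt A :=
    (Nat.le_div_iff_mul_le h0).2 ((Nat.sqrt_le A).trans hAm)
  exact (Nat.mod_lt _ h0).le.trans h1

theorem IsLayout.fits (hm : 0 < m) (hn : 0 < n) (hnk : n ≤ k) (hk : k ∣ m * n)
    (h : IsLayout m n k L) : L.Fits m n := by
  obtain ⟨h1, h2, h3⟩ := partSize hm hn hnk hk
  obtain ⟨hA, ha, hrows, hif, hp₁, hp₂⟩ := h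
  have ha0 : 0 < L.a := by
    rw [ha, hA]
    exact Nat.sqrt_pos.2 h2
  rw [if_pos (by rw [ha]; exact sqrt_mod_le_div (by omega) (by omega))] at hif
  exact ⟨by omega, ha0, by rw [Layout.rows]; omega, (hp₁.bounds ha0).1,
    (hp₂.bounds (Nat.succ_pos _)).1⟩

end Layouts

/-! ### Comparison with the lower bound `2 * c * k` -/

section UpperBound

variable {m n k : ℕ}

theorem IsBalanced.le_totalPerimeter {g : Cell m n → Fin k} {A : ℕ} (hk : k * A = m * n)
    (hg : IsBalanced g) : k * (2 * ⌈2 * √(A : ℝ)⌉₊) ≤ totalPerimeter g := by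
  have h : ∀ i : Fin k, (part g i).card = A := fun i =>
    Nat.eq_of_mul_eq_mul_left i.pos ((hg i).trans hk.symm)
  calc k * (2 * ⌈2 * √(A : ℝ)⌉₊) = ∑ _i : Fin k, 2 * ⌈2 * √(A : ℝ)⌉₊ := by simp
    _ ≤ ∑ i : Fin k, perimeter (part g i) := Finset.sum_le_sum fun i _ => by
        rw [← h i]
        exact two_mul_ceil_le_perimeter _

theorem IsContiguous.totalPerimeter_le {f : Cell m n → Fin k} {A : ℕ}
    (hA : ∀ i, (part f i).card = A) (hf : IsContiguous f) :
    totalPerimeter f ≤ k * (2 * A + 2) := by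
  calc totalPerimeter f ≤ ∑ _i : Fin k, (2 * A + 2) := Finset.sum_le_sum fun i _ => by
        rw [← hA i]
        refine perimeter_le_of_connected _ ?_
        have : {v | v ∈ part f i} = {v | f v = i} := by
          ext v
          simp [part]
        rw [this]
        exact hf i
    _ = k * (2 * A + 2) := by simp

/-- The contribution of the unpartitioned cells of a strip of height `h` with `N = u * h + e` such
cells. -/
theorem strip_excess_le {x c E u h N a : ℝ} (hx : 1 ≤ x) (hc : 2 * x ≤ c)
    (ha : a ≤ x) (hxa : x < a + 1) (hu : (φ - 1) * a - 1 ≤ u) (hu' : u ≤ φ * a + 1) (hu0 : 0 ≤ u)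
    (hh : 0 ≤ h) (hN : u * h ≤ N) (hN' : N ≤ u * h + h) (hE : φ * x * (√5 / 2 - 1) ≤ E) :
    N * (u + 1 - c) ≤ h * (2 * x * (E + 8) - x * x) := by
  have hφ := goldenRatio_bounds
  have hsq := Real.goldenRatio_sq
  have h5 : √5 / 2 - 1 = φ - 3 / 2 := by
    rw [Real.goldenRatio]
    ring
  rw [h5] at hE
  have hφu : φ * a ≤ φ * x := mul_le_mul_of_nonneg_left ha (by linarith)
  have hφl : (φ - 1) * x - 1 ≤ (φ - 1) * a := by nlinarith
  -- With N ≈ uh and c ≥ 2x the main term is u² - 2ux = (u - x)² - x². The -x² later cancels against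
  -- the rows of the strip.
  have h1 : N * (u + 1 - c) ≤ h * ((u - x) * (u - x) + 2 * u + 1 - x * x) := by
    have e1 : 0 ≤ N - u * h := by linarith
    have e2 : (N - u * h) * (u + 1 - c) ≤ h * (u + 1) := by
      nlinarith [mul_nonneg e1 (show 0 ≤ c by linarith),
        mul_nonneg (show 0 ≤ u * h + h - N by linarith) (show 0 ≤ u + 1 by linarith)]
    have e3 : u * h * c ≥ u * h * (2 * x) :=
      mul_le_mul_of_nonneg_left hc (mul_nonneg hu0 hh)
    nlinarith
  refine h1.trans (mul_le_mul_of_nonneg_left ?_ hh)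
  have h2 : (u - x) * (u - x) ≤ ((φ - 1) * x + 2) * ((φ - 1) * x + 2) := by
    have e1 : u - x ≤ (φ - 1) * x + 2 := by nlinarith
    have e2 : -((φ - 1) * x + 2) ≤ u - x := by nlinarith
    nlinarith [mul_nonneg (sub_nonneg.2 e1) (show 0 ≤ (u - x) + ((φ - 1) * x + 2) by linarith)]
  -- The constant √5/2 - 1 = φ - 3/2 is made for this: (φ - 1)² = 2 - φ = 2φ(φ - 3/2), so 2xE
  -- dominates the quadratic term. The remaining linear terms are below 16x.
  have h3 : x * (φ * x * (φ - 3 / 2)) ≤ x * E := mul_le_mul_of_nonneg_left hE (by linarith)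
  have h4 : x * (φ * x * (φ - 3 / 2)) = x * x * (1 - φ / 2) := by
    linear_combination x * x * hsq
  have h6 : (φ - 1) * x * ((φ - 1) * x) = x * x * (2 - φ) := by
    linear_combination x * x * hsq
  nlinarith

/-- The computation behind the asymptotic upper bound for the total perimeter. -/
theorem perimeter_bound_of_strips {a x A m n k K B u₁ u₂ N₁ N₂ s₁ s₂ hi c E T : ℝ} (hx : 1 ≤ x)
    (hxx : x * x = A) (ha : 1 ≤ a) (hax : a ≤ x) (hxa : x < a + 1) (hc : 2 * x ≤ c)
    (hE : φ * x * (√5 / 2 - 1) ≤ E) (hhi : hi ≤ φ * a + 1)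
    (hu₁ : (φ - 1) * a - 1 ≤ u₁) (hu₁' : u₁ ≤ hi) (hu₁0 : 0 ≤ u₁)
    (hu₂ : (φ - 1) * a - 1 ≤ u₂) (hu₂' : u₂ ≤ hi) (hu₂0 : 0 ≤ u₂)
    (hN₁ : u₁ * a ≤ N₁) (hN₁' : N₁ ≤ u₁ * a + a)
    (hN₂ : u₂ * (a + 1) ≤ N₂) (hN₂' : N₂ ≤ u₂ * (a + 1) + (a + 1))
    (hs₁ : 0 ≤ s₁) (hs₂ : 0 ≤ s₂) (hK : K * A = s₁ * N₁ + s₂ * N₂)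
    (hB : B * A ≤ s₁ * N₁) (hB' : s₁ * N₁ ≤ B * A + A) (hm : s₁ * a + s₂ * (a + 1) = m)
    (hAm : A ≤ m) (hk : k * A = m * n) (hn : 0 < n)
    (hT : T ≤ 2 * (k - K) * (c + 1) + 2 * (m + K) + 2 * (B * (u₁ + 1) + (K - B) * (u₂ + 1)) +
      6 * (hi + 1) + 2 * (s₁ + s₂)) :
    T ≤ (1 + 1 / c + (E + 17) / n) * (k * (2 * c)) := by
  have hφ := goldenRatio_bounds
  have hA0 : 0 < A := by nlinarith
  have hm0 : 0 < m := by linarith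
  have hc0 : 0 < c := by linarith
  have e₁ := mul_le_mul_of_nonneg_left (strip_excess_le hx hc hax hxa hu₁ (hu₁'.trans hhi) hu₁0
    (by linarith) hN₁ hN₁' hE) hs₁
  have e₂ := mul_le_mul_of_nonneg_left (strip_excess_le hx hc hax hxa hu₂ (hu₂'.trans hhi) hu₂0
    (by linarith) hN₂ hN₂' hE) hs₂
  obtain ⟨Q, hQ⟩ : ∃ Q, Q = 2 * x * (E + 8) - x * x := ⟨_, rfl⟩
  rw [← hQ] at e₁ e₂
  have hE0 : 0 ≤ E := by
    refine le_trans ?_ hE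
    have : (0 : ℝ) ≤ √5 / 2 - 1 := by
      have : (2 : ℝ) ≤ √5 := Real.le_sqrt_of_sq_le (by norm_num)
      linarith
    exact mul_nonneg (mul_nonneg (by linarith) (by linarith)) this
  have hH : hi + 1 ≤ 4 * x := by
    have : φ * a ≤ 1.6181 * x := mul_le_mul hφ.2.le hax (by linarith) (by norm_num)
    linarith
  -- The cells of R in strips of height `a` left over after B whole parts number at most A and are
  -- charged at the rate of the other strips.
  have hdiff : (s₁ * N₁ - B * A) * (u₂ - u₁) ≤ A * (hi + 1) := by
    have h1 : u₂ - u₁ ≤ hi + 1 := by linarith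
    calc (s₁ * N₁ - B * A) * (u₂ - u₁) ≤ (s₁ * N₁ - B * A) * (hi + 1) :=
          mul_le_mul_of_nonneg_left h1 (by linarith)
      _ ≤ A * (hi + 1) := mul_le_mul_of_nonneg_right (by linarith) (by linarith)
  -- In units of 2xm: E + 8 from the strips, 2 from `hdiff`, 6 from 3(hi + 1) and 1 from the number
  -- of strips, in all E + 17.
  have hmain : A * (m - K * c + (B * (u₁ + 1) + (K - B) * (u₂ + 1)) + 3 * (hi + 1) + (s₁ + s₂)) ≤
      c * m * (E + 17) := by
    have h1 : A * (B * (u₁ + 1) + (K - B) * (u₂ + 1) - K * c) =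
        s₁ * (N₁ * (u₁ + 1 - c)) + s₂ * (N₂ * (u₂ + 1 - c)) +
          (s₁ * N₁ - B * A) * (u₂ - u₁) := by
      linear_combination (u₂ + 1 - c) * hK
    have h2 : s₁ * (a * Q) + s₂ * ((a + 1) * Q) = m * Q := by
      rw [← hm]
      ring
    have h3 : A * (hi + 1) ≤ 4 * x * m := by
      calc A * (hi + 1) ≤ A * (4 * x) := mul_le_mul_of_nonneg_left hH hA0.le
        _ ≤ m * (4 * x) := mul_le_mul_of_nonneg_right hAm (by linarith)
        _ = _ := by ring
    have h4 : A * (s₁ + s₂) ≤ 2 * x * m := by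
      have h5 : x * (s₁ + s₂) ≤ 2 * m := by
        have h6 : x * s₁ ≤ 2 * a * s₁ := mul_le_mul_of_nonneg_right (by linarith) hs₁
        have h7 : x * s₂ ≤ 2 * a * s₂ := mul_le_mul_of_nonneg_right (by linarith) hs₂
        linarith
      calc A * (s₁ + s₂) = x * (x * (s₁ + s₂)) := by rw [← hxx]; ring
        _ ≤ x * (2 * m) := mul_le_mul_of_nonneg_left h5 (by linarith)
        _ = _ := by ring
    have h5 : 2 * x * (m * (E + 17)) ≤ c * (m * (E + 17)) :=
      mul_le_mul_of_nonneg_right hc (mul_nonneg hm0.le (by linarith))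
    have h6 : A * m + m * Q = 2 * x * m * (E + 8) := by
      rw [hQ, ← hxx]
      ring
    linarith
  have hgoal : (1 + 1 / c + (E + 17) / n) * (k * (2 * c)) =
      2 * k * (c + 1) + 2 * (c * m * (E + 17)) / A := by
    have hk' : k = m * n / A := by
      rw [eq_div_iff hA0.ne', hk]
    rw [hk']
    field_simp
  rw [hgoal, ← sub_le_iff_le_add', le_div_iff₀ hA0]
  have hT' : T - 2 * k * (c + 1) ≤ 2 * (m - K * c + (B * (u₁ + 1) + (K - B) * (u₂ + 1)) +
      3 * (hi + 1) + (s₁ + s₂)) := by linarith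
  have := mul_le_mul_of_nonneg_right hT' hA0.le
  linarith

variable {L : Layout}

theorem Layout.len_le_of_rest {s : ℕ} {i : ℕ} (ha : 0 < L.a)
    (h : L.rest n i / L.height i ≤ s) : L.len n i ≤ s + 1 := by
  have h1 := Layout.offset_lt ha i
  have hh := Layout.height_pos ha i
  rw [Layout.len]
  calc (L.rest n i + L.offset i) / L.height i ≤ (L.rest n i + L.height i) / L.height i :=
        Nat.div_le_div_right (by omega)
    _ = L.rest n i / L.height i + 1 := Nat.add_div_right _ hh
    _ ≤ s + 1 := by omega

/-- Upper bound for the total perimeter, in terms of the numbers `u₁`, `u₂` of entirely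
unpartitioned columns. -/
theorem Layout.Fits.totalPerimeter_le_of_ceil (hF : L.Fits m n) {d d' : ℕ → Bool}
    {f : Cell m n → Fin k} (hk : k * L.A = m * n) (ha : L.a = Nat.sqrt L.A)
    (hf : ∀ v, (f v : ℕ) = L.label m n d d' v) {M₁ M₂ H : ℕ}
    (h₁ : (n * L.a - L.p₁ * L.A) / L.a + 1 ≤ M₁)
    (h₂ : (n * (L.a + 1) - L.p₂ * L.A) / (L.a + 1) + 1 ≤ M₂) (hH₁ : M₁ ≤ H) (hH₂ : M₂ ≤ H) :
    totalPerimeter f ≤ 2 * L.stripParts * (⌈2 * √(L.A : ℝ)⌉₊ + 1) +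
      2 * (m + (k - L.stripParts)) +
      2 * ((L.cum n (L.s₁ * L.a) / L.A) * M₁ +
        (k - L.stripParts - L.cum n (L.s₁ * L.a) / L.A) * M₂) +
      6 * H + 2 * (L.s₁ + L.s₂) := by
  refine hF.totalPerimeter_le hk hf (fun h hh => ?_) (fun i hi => ?_) (fun i _ hi => ?_) hH₁ hH₂
  · rw [ha] at hh
    exact add_div_le_ceil hF.A_pos hh
  · refine (Layout.len_le_of_rest hF.a_pos (le_of_eq ?_)).trans h₁
    rw [rest, height, parts, if_pos hi, if_pos hi]
  · refine (Layout.len_le_of_rest hF.a_pos (le_of_eq ?_)).trans h₂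
    rw [rest, height, parts, if_neg hi.not_gt, if_neg hi.not_gt]

theorem IsCautiousStriping.isBalanced {f : Cell m n → Fin k} (hm : 0 < m) (hn : 0 < n)
    (hnk : n ≤ k) (hk : k ∣ m * n) (hf : IsCautiousStriping f) :
    (∀ i, (part f i).card = m * n / k) ∧ IsBalanced f := by
  obtain ⟨L, d, d', hL, hf⟩ := hf
  have hF := hL.fits hm hn hnk hk
  have hA := hL.1
  have h1 := (partSize hm hn hnk hk).1
  rw [← hA] at h1 ⊢
  have h2 := hF.card_part h1 hf
  exact ⟨h2, fun i => by rw [h2, h1]⟩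

theorem IsCautiousStriping.totalPerimeter_le {f : Cell m n → Fin k} (hm : 0 < m) (hn : 0 < n)
    (hnk : n ≤ k) (hk : k ∣ m * n) (hf : IsCautiousStriping f) {A : ℕ} (hA : A = m * n / k) :
    (totalPerimeter f : ℝ) ≤ (1 + 1 / (⌈2 * √(A : ℝ)⌉₊ : ℝ) +
      ((⌈φ * √(A : ℝ)⌉₊ : ℝ) * (√5 / 2 - 1) + 17) / n) * (k * (2 * ⌈2 * √(A : ℝ)⌉₊)) := by
  obtain ⟨L, d, d', hL, hf⟩ := hf
  have hF := hL.fits hm hn hnk hk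
  obtain ⟨hLA, hLa, -, -, hp₁, hp₂⟩ := hL
  obtain ⟨hkA, hA0, hAm⟩ := partSize hm hn hnk hk
  rw [← hA] at hLA hkA hA0 hAm
  rw [← hLA] at hkA hA0 hAm ⊢
  clear hA
  have ha0 := hF.a_pos
  obtain ⟨-, hlo₁, hhi₁⟩ := hp₁.bounds ha0
  obtain ⟨-, hlo₂, hhi₂⟩ := hp₂.bounds (show 0 < L.a + 1 by omega)
  obtain ⟨hKk, hK⟩ := hF.cum_eq_mul hkA
  have hT := hF.totalPerimeter_le_of_ceil hkA hLa hf le_rfl le_rfl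
    (Nat.add_le_add_right hhi₁ 1) (Nat.add_le_add_right hhi₂ 1)
  have hC := Layout.cum_mul (n := n) ha0 (le_refl L.s₁)
  have hCm := hF.cum_eq
  have hBA := Nat.div_mul_le_self (L.cum n (L.s₁ * L.a)) L.A
  have hBA' := Nat.lt_div_mul_add (a := L.cum n (L.s₁ * L.a)) hA0
  have hBK : L.cum n (L.s₁ * L.a) / L.A ≤ k - L.stripParts := by
    refine Nat.div_le_of_le_mul ?_
    rw [mul_comm L.A, ← hK, hC, hCm]
    exact Nat.le_add_right _ _
  rw [hCm] at hK
  rw [hC] at hBA hBA' hT hBK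
  have hrows := hF.rows_eq
  rw [Layout.rows] at hrows
  have hsm : (L.s₁ + L.s₂) * L.a ≤ m := by nlinarith
  have ha1 : L.a * L.a ≤ L.A := by rw [hLa]; exact Nat.sqrt_le _
  have ha2 : L.A < (L.a + 1) * (L.a + 1) := by rw [hLa]; exact Nat.lt_succ_sqrt _
  have hl1 := floor_div_goldenRatio L.a
  have hl2 := ceil_mul_goldenRatio_lt L.a
  have hd₁ := Nat.div_mul_le_self (n * L.a - L.p₁ * L.A) L.a
  have hd₁' := Nat.lt_div_mul_add (a := n * L.a - L.p₁ * L.A) ha0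
  have hd₂ := Nat.div_mul_le_self (n * (L.a + 1) - L.p₂ * L.A) (L.a + 1)
  have hd₂' := Nat.lt_div_mul_add (a := n * (L.a + 1) - L.p₂ * L.A) (show 0 < L.a + 1 by omega)
  generalize n * L.a - L.p₁ * L.A = N₁ at *
  generalize n * (L.a + 1) - L.p₂ * L.A = N₂ at *
  generalize N₁ / L.a = u₁ at *
  generalize hu₂ : N₂ / (L.a + 1) = u₂ at *
  generalize (L.s₁ * N₁) / L.A = B at *
  generalize ⌊(L.a : ℝ) / φ⌋₊ = lo at *
  generalize ⌈φ * (L.a : ℝ)⌉₊ = hi at *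
  generalize totalPerimeter f = T at *
  set x := √(L.A : ℝ) with hxdef
  have hxx : x * x = L.A := Real.mul_self_sqrt (by positivity)
  have hx0 : 0 ≤ x := Real.sqrt_nonneg _
  have ha0' : (1 : ℝ) ≤ L.a := by exact_mod_cast ha0
  have ha1' : (L.a : ℝ) * L.a ≤ L.A := by exact_mod_cast ha1
  have ha2' : (L.A : ℝ) < (L.a + 1) * (L.a + 1) := by exact_mod_cast ha2
  have hax : (L.a : ℝ) ≤ x := by nlinarith
  have hE : φ * x * (√5 / 2 - 1) ≤ (⌈φ * x⌉₊ : ℝ) * (√5 / 2 - 1) := by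
    have : (2 : ℝ) ≤ √5 := Real.le_sqrt_of_sq_le (by norm_num)
    exact mul_le_mul_of_nonneg_right (Nat.le_ceil _) (by linarith)
  refine perimeter_bound_of_strips (a := L.a) (x := x) (A := L.A) (m := m) (n := n) (k := k)
    (K := (k - L.stripParts : ℕ)) (B := B) (u₁ := u₁) (u₂ := u₂) (N₁ := N₁) (N₂ := N₂)
    (s₁ := L.s₁) (s₂ := L.s₂) (hi := hi) (by linarith) hxx ha0' hax (by nlinarith) (Nat.le_ceil _)
    hE hl2.le ?_ (by exact_mod_cast hhi₁) (by positivity) ?_ (by exact_mod_cast hhi₂)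
    (by positivity) (by exact_mod_cast (by linarith)) (by exact_mod_cast hd₁'.le)
    (by exact_mod_cast (by linarith)) (by exact_mod_cast hd₂'.le) (by positivity) (by positivity)
    (by exact_mod_cast hK.symm) (by exact_mod_cast hBA) (by exact_mod_cast hBA'.le)
    (by exact_mod_cast hrows) (by exact_mod_cast hAm) (by exact_mod_cast hkA)
    (by exact_mod_cast hn) ?_
  · have : (lo : ℝ) ≤ u₁ := by exact_mod_cast hlo₁
    linarith
  · have : (lo : ℝ) ≤ u₂ := by exact_mod_cast hlo₂
    linarith
  · have e : (2 * (k - (k - L.stripParts : ℕ) : ℝ)) = (2 * L.stripParts : ℕ) := by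
      rw [Nat.cast_sub hKk]
      push_cast
      ring
    rw [e, ← Nat.cast_sub hBK]
    exact_mod_cast hT

theorem le_ceil_two_mul_sqrt {A v : ℕ} (h : v * v < 4 * A) : v + 1 ≤ ⌈2 * √(A : ℝ)⌉₊ := by
  rw [Nat.add_one_le_iff, Nat.lt_ceil]
  have h1 : (v : ℝ) * v < 4 * A := by exact_mod_cast h
  have h2 : √(A : ℝ) * √(A : ℝ) = A := Real.mul_self_sqrt (by positivity)
  have h3 := Real.sqrt_nonneg (A : ℝ)
  by_contra hcon
  nlinarith

/-- For small A the additive terms of the general estimate are too large, but a connected part costs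
at most 2A + 2; up to A = 10 this is at most 5/3 of 2c, with equality at A = 9. -/
theorem IsCautiousStriping.hundred_mul_totalPerimeter_le {f : Cell m n → Fin k} (hm : 0 < m)
    (hmn : m ≤ n) (hnk : n ≤ k) (hk : k ∣ m * n) (hf : IsCautiousStriping f)
    (hcont : IsContiguous f) {A : ℕ} (hA : A = m * n / k) :
    100 * totalPerimeter f ≤ 169 * (k * (2 * ⌈2 * √(A : ℝ)⌉₊)) := by
  have hn : 0 < n := by omega
  rcases le_or_gt A 10 with hA10 | hA10
  · have h1 := hcont.totalPerimeter_le (fun i => (hf.isBalanced hm hn hnk hk).1 i)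
    rw [← hA] at h1
    have hA0 : 0 < A := by
      rw [hA]
      exact (partSize hm hn hnk hk).2.1
    have key : 100 * (2 * A + 2) ≤ 169 * (2 * ⌈2 * √(A : ℝ)⌉₊) := by
      have hv := fun v => le_ceil_two_mul_sqrt (A := A) (v := v)
      generalize ⌈2 * √(A : ℝ)⌉₊ = c at hv ⊢
      interval_cases A
      · linarith [hv 1 (by norm_num)]
      · linarith [hv 2 (by norm_num)]
      · linarith [hv 3 (by norm_num)]
      · linarith [hv 3 (by norm_num)]
      · linarith [hv 4 (by norm_num)]
      · linarith [hv 4 (by norm_num)]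
      · linarith [hv 5 (by norm_num)]
      · linarith [hv 5 (by norm_num)]
      · linarith [hv 5 (by norm_num)]
      · linarith [hv 6 (by norm_num)]
    calc 100 * totalPerimeter f ≤ 100 * (k * (2 * A + 2)) := Nat.mul_le_mul_left _ h1
      _ = k * (100 * (2 * A + 2)) := by ring
      _ ≤ k * (169 * (2 * ⌈2 * √(A : ℝ)⌉₊)) := Nat.mul_le_mul_left _ key
      _ = _ := by ring
  obtain ⟨L, d, d', hL, hf⟩ := hf
  have hF := hL.fits hm hn hnk hk
  obtain ⟨hLA, hLa, -, -, hp₁, hp₂⟩ := hL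
  obtain ⟨hkA, hA0, hAm⟩ := partSize hm hn hnk hk
  rw [← hA] at hLA hkA hA0 hAm
  rw [← hLA] at hkA hA0 hAm hA10 ⊢
  have ha0 := hF.a_pos
  obtain ⟨-, -, hhi₁⟩ := hp₁.bounds ha0
  obtain ⟨-, -, hhi₂⟩ := hp₂.bounds (show 0 < L.a + 1 by omega)
  obtain ⟨hKk, hK⟩ := hF.cum_eq_mul hkA
  have hT := hF.totalPerimeter_le_of_ceil hkA hLa hf
    (Nat.add_le_add_right hhi₁ 1) (Nat.add_le_add_right hhi₂ 1) le_rfl le_rfl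
  have hBK : L.cum n (L.s₁ * L.a) / L.A ≤ k - L.stripParts := by
    refine Nat.div_le_of_le_mul ?_
    rw [mul_comm L.A, ← hK]
    refine Layout.cum_mono ?_
    rw [← hF.rows_eq]
    exact Nat.le_add_right _ _
  rw [← add_mul, Nat.add_sub_cancel' hBK] at hT
  have ha1 : L.a * L.a ≤ L.A := by rw [hLa]; exact Nat.sqrt_le _
  have ha3 : 3 ≤ L.a := by
    rw [hLa, Nat.le_sqrt]
    omega
  have hc7 : 7 ≤ ⌈2 * √(L.A : ℝ)⌉₊ := le_ceil_two_mul_sqrt (v := 6) (by omega)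
  have hca : 2 * L.a ≤ ⌈2 * √(L.A : ℝ)⌉₊ := by
    have := le_ceil_two_mul_sqrt (A := L.A) (v := 2 * L.a - 1) (by
      obtain ⟨b, hb⟩ : ∃ b, L.a = b + 1 := ⟨L.a - 1, by omega⟩
      rw [hb] at ha1 ⊢
      rw [show 2 * (b + 1) - 1 = 2 * b + 1 by omega]
      nlinarith)
    omega
  have hhi : ⌈φ * (L.a : ℝ)⌉₊ + 1 ≤ 2 * L.a := by
    have h1 : ⌈φ * (L.a : ℝ)⌉₊ ≤ 2 * L.a - 1 := by
      rw [Nat.ceil_le, Nat.cast_sub (by omega)]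
      have h2 := goldenRatio_bounds
      have h3 : (3 : ℝ) ≤ L.a := by exact_mod_cast ha3
      push_cast
      nlinarith
    omega
  have hsm : (L.s₁ + L.s₂) * 3 ≤ m := by
    rw [← hF.rows_eq, Layout.rows]
    nlinarith
  generalize ⌈2 * √(L.A : ℝ)⌉₊ = c at *
  generalize ⌈φ * (L.a : ℝ)⌉₊ + 1 = H at *
  generalize hKd : k - L.stripParts = K at *
  have hk' : k = L.stripParts + K := by omega
  have hKH : K * H ≤ K * c := Nat.mul_le_mul_left _ (hhi.trans hca)
  have hck : k * 7 ≤ k * c := Nat.mul_le_mul_left _ hc7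
  have hka : L.a * 3 ≤ k := by nlinarith
  have h1 : 2 * L.stripParts * (c + 1) + 2 * (m + K) + 2 * (K * c) = 2 * (k * c) + 2 * k + 2 * m := by
    rw [hk']
    ring
  have h2 : 169 * (k * (2 * c)) = 338 * (k * c) := by ring
  rw [h2]
  -- The surplus over 2kc is at most 2k + 2m + 6H + 2(s₁ + s₂) with m ≤ k, H ≤ 2a ≤ 2k/3 and 3(s₁ +
  -- s₂) ≤ m, so below 9k; and 0.69 · 2ck > 9k because c ≥ 7.
  omega

end UpperBound

/-! ### Admissible row directions and their finite verification -/

/-- Let a sequence of cells be taken row by row and be cut into parts of `A` cells, let `r` be the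
number of cells modulo `A` up to the end of a row with `ℓ` cells, and let the next row have `ℓ'`
cells, both rows being aligned at their right ends. If `r ≠ 0`, this says that the cells of these rows
that belong to the common part are linked if the rows are taken in the given directions. -/
def Crossing (A r ℓ ℓ' : ℕ) : Bool → Bool → Prop
  | true, false => True
  | false, true => r = 0 ∨ ℓ - r < ℓ' ∧ ℓ' - (A - r) < ℓ
  | true, true => r = 0 ∨ ℓ' - (A - r) < ℓ ∧ ℓ' - (A - r) < r
  | false, false => r = 0 ∨ ℓ - r < ℓ' ∧ ℓ - r < A - r

/-- Directions for rows of given lengths, after a row of length `ℓ` that is taken in direction `b`. -/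
def Route (A : ℕ) : ℕ → ℕ → Bool → List ℕ → Prop
  | _, _, _, [] => True
  | r, ℓ, b, ℓ' :: ls => ∃ b', Crossing A r ℓ ℓ' b b' ∧ Route A ((r + ℓ') % A) ℓ' b' ls

/-- Decision procedure for `Route`: `p` (`q`) says whether the last row may be taken from left to
right (from right to left). -/
def routeCheck (A : ℕ) : List ℕ → ℕ → ℕ → Bool → Bool → Bool
  | [], _, _, _, _ => true
  | ℓ' :: ls, r, ℓ, p, q =>
    bif Nat.beq r 0 then routeCheck A ls (ℓ' % A) ℓ' true true
    else
      bif p && Nat.blt (ℓ' - (A - r)) ℓ && Nat.blt (ℓ' - (A - r)) r ||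
        q && Nat.blt (ℓ - r) ℓ' && Nat.blt (ℓ' - (A - r)) ℓ then
        bif p || q && Nat.blt (ℓ - r) ℓ' && Nat.blt (ℓ - r) (A - r) then
          routeCheck A ls ((r + ℓ') % A) ℓ' true true
        else routeCheck A ls ((r + ℓ') % A) ℓ' true false
      else
        bif p || q && Nat.blt (ℓ - r) ℓ' && Nat.blt (ℓ - r) (A - r) then
          routeCheck A ls ((r + ℓ') % A) ℓ' false true
        else false

/-- Lengths of the unpartitioned parts of the rows of a strip of height `h` that has `N`
unpartitioned cells. -/
def rowLengths (N h : ℕ) : List ℕ := (List.range h).map fun o => (N + o) / h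

/-- The largest number below `(hi + 1) * h` that is congruent to `g * h` modulo `A`. -/
def restOf (A hi g h : ℕ) : ℕ := (hi + 1) * h - 1 - ((hi + 1) * h - 1 + (A - g) * h) % A

/-- `g` stands for n modulo A, which fixes the uncut cells of both kinds of strips. Strips of height
a + 1 are checked A times only, since A of them contain a multiple of A uncut cells. -/
def stripCheck (A a hi g s : ℕ) : Bool :=
  routeCheck A ((List.replicate s (rowLengths (restOf A hi g a) a)).flatten ++
    (List.replicate A (rowLengths (restOf A hi g (a + 1)) (a + 1))).flatten) 0 0 true true

def stripsCheck (A a hi : ℕ) : Bool :=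
  (List.range A).all fun g => (List.range (a + 1)).all fun s => stripCheck A a hi g s

theorem stripsCheck_two : ∀ A ∈ Finset.Icc 4 8, stripsCheck A 2 4 = true := by decide +kernel

theorem stripsCheck_three : ∀ A ∈ Finset.Icc 9 15, stripsCheck A 3 5 = true := by decide +kernel

theorem stripsCheck_four : ∀ A ∈ Finset.Icc 16 24, stripsCheck A 4 7 = true := by decide +kernel

theorem stripsCheck_five : ∀ A ∈ Finset.Icc 25 29, stripsCheck A 5 9 = true := by decide +kernel

section Route

variable {A : ℕ}

theorem crossing_zero (ℓ ℓ' : ℕ) (b b' : Bool) : Crossing A 0 ℓ ℓ' b b' := by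
  cases b <;> cases b' <;> simp [Crossing]

theorem Route.of_zero {ℓ ℓ₀ : ℕ} {b b₀ : Bool} {ls : List ℕ} (h : Route A 0 ℓ b ls) :
    Route A 0 ℓ₀ b₀ ls := by
  cases ls with
  | nil => trivial
  | cons ℓ' ls =>
    obtain ⟨b', -, h⟩ := h
    exact ⟨b', crossing_zero _ _ _ _, h⟩

/-- The check carries the set of directions still possible for the last row; a route is recovered
backwards from any direction that survives. -/
theorem routeCheck_sound (ls : List ℕ) : ∀ (r ℓ : ℕ) (p q : Bool),
    routeCheck A ls r ℓ p q = true → (p || q) = true →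
      ∃ b, (bif b then p else q) = true ∧ Route A r ℓ b ls := by
  induction ls with
  | nil =>
    intro r ℓ p q _ hpq
    rcases Bool.or_eq_true_iff.1 hpq with h | h
    · exact ⟨true, h, trivial⟩
    · exact ⟨false, h, trivial⟩
  | cons ℓ' ls ih =>
    intro r ℓ p q h hpq
    rw [routeCheck] at h
    by_cases hr : r = 0
    · subst hr
      simp only [Nat.beq_refl, cond_true] at h
      obtain ⟨b', -, h'⟩ := ih _ _ _ _ h rfl
      rcases Bool.or_eq_true_iff.1 hpq with hb | hb
      · exact ⟨true, hb, b', crossing_zero _ _ _ _, by rwa [zero_add]⟩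
      · exact ⟨false, hb, b', crossing_zero _ _ _ _, by rwa [zero_add]⟩
    · rw [show Nat.beq r 0 = false by
        cases r with
        | zero => exact absurd rfl hr
        | succ r => rfl, cond_false] at h
      have key : ∀ p' q' : Bool,
          (p' = true → (p && Nat.blt (ℓ' - (A - r)) ℓ && Nat.blt (ℓ' - (A - r)) r ||
            q && Nat.blt (ℓ - r) ℓ' && Nat.blt (ℓ' - (A - r)) ℓ) = true) →
          (q' = true → (p || q && Nat.blt (ℓ - r) ℓ' && Nat.blt (ℓ - r) (A - r)) = true) →
          (p' || q') = true → routeCheck A ls ((r + ℓ') % A) ℓ' p' q' = true →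
          ∃ b, (bif b then p else q) = true ∧ Route A r ℓ b (ℓ' :: ls) := by
        intro p' q' hp' hq' hpq' hc
        obtain ⟨b', hb', hR⟩ := ih _ _ _ _ hc hpq'
        cases b' with
        | true =>
          have h1 := hp' hb'
          simp only [Bool.or_eq_true, Bool.and_eq_true, Nat.blt_eq] at h1
          rcases h1 with ⟨⟨h1, h2⟩, h3⟩ | ⟨⟨h1, h2⟩, h3⟩
          · exact ⟨true, h1, true, Or.inr ⟨h2, h3⟩, hR⟩
          · exact ⟨false, h1, true, Or.inr ⟨h2, h3⟩, hR⟩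
        | false =>
          have h1 := hq' hb'
          simp only [Bool.or_eq_true, Bool.and_eq_true, Nat.blt_eq] at h1
          rcases h1 with h1 | ⟨⟨h1, h2⟩, h3⟩
          · exact ⟨true, h1, false, trivial, hR⟩
          · exact ⟨false, h1, false, Or.inr ⟨h2, h3⟩, hR⟩
      revert h
      generalize hX : (p && Nat.blt (ℓ' - (A - r)) ℓ && Nat.blt (ℓ' - (A - r)) r ||
            q && Nat.blt (ℓ - r) ℓ' && Nat.blt (ℓ' - (A - r)) ℓ) = X at *
      generalize hY : (p || q && Nat.blt (ℓ - r) ℓ' && Nat.blt (ℓ - r) (A - r)) = Y at *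
      intro h
      cases X <;> cases Y <;> simp only [cond_true, cond_false] at h
      · exact absurd h (by simp)
      · exact key _ _ (by simp) (by simp) rfl h
      · exact key _ _ (by simp) (by simp) rfl h
      · exact key _ _ (by simp) (by simp) rfl h

theorem Route.of_append (ls₁ ls₂ : List ℕ) : ∀ {r ℓ : ℕ} {b : Bool},
    Route A r ℓ b (ls₁ ++ ls₂) → Route A r ℓ b ls₁ := by
  induction ls₁ with
  | nil => exact fun _ => trivial
  | cons ℓ' ls ih =>
    rintro r ℓ b ⟨b', h1, h2⟩
    exact ⟨b', h1, ih h2⟩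

/-- If a part ends exactly with the first list, nothing has to be linked there, and the second list
can start afresh. -/
theorem Route.append (hA : 0 < A) {ls₂ : List ℕ} {ℓ₀ : ℕ} {b₀ : Bool} (h₂ : Route A 0 ℓ₀ b₀ ls₂)
    (ls₁ : List ℕ) : ∀ {r ℓ : ℕ} {b : Bool}, r < A → Route A r ℓ b ls₁ →
      A ∣ r + ls₁.sum → Route A r ℓ b (ls₁ ++ ls₂) := by
  induction ls₁ with
  | nil =>
    intro r ℓ b hr _ hd
    obtain rfl : r = 0 := Nat.eq_zero_of_dvd_of_lt (by simpa using hd) hr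
    exact h₂.of_zero
  | cons ℓ' ls ih =>
    rintro r ℓ b hr ⟨b', h1, h2⟩ hd
    refine ⟨b', h1, ih (Nat.mod_lt _ hA) h2 ?_⟩
    rw [List.sum_cons, ← add_assoc] at hd
    exact (Nat.ModEq.add_right ls.sum (Nat.mod_modEq (r + ℓ') A)).dvd_iff dvd_rfl |>.2 hd

theorem Route.exists_directions (len : ℕ → ℕ) (c : ℕ) : ∀ (i₀ r ℓ : ℕ) (b : Bool),
    Route A r ℓ b ((List.range' i₀ c).map len) → ∃ d : ℕ → Bool,
      (0 < c → Crossing A r ℓ (len i₀) b (d i₀)) ∧ ∀ i, i₀ ≤ i → i + 1 < i₀ + c →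
        Crossing A ((r + ∑ x ∈ Finset.Ico i₀ (i + 1), len x) % A) (len i) (len (i + 1))
          (d i) (d (i + 1)) := by
  induction c with
  | zero => exact fun i₀ r ℓ b _ => ⟨fun _ => true, by simp, by omega⟩
  | succ c ih =>
    intro i₀ r ℓ b h
    rw [List.range'_succ, List.map_cons] at h
    obtain ⟨b', h1, h2⟩ := h
    obtain ⟨d, hd1, hd2⟩ := ih _ _ _ _ h2
    refine ⟨fun i => if i = i₀ then b' else d i, fun _ => by simpa using h1, fun i hi hic => ?_⟩
    have e : i + 1 ≠ i₀ := by omega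
    simp only [e, if_false]
    rcases hi.eq_or_lt with rfl | hi
    · simpa using hd1 (by omega)
    · rw [if_neg hi.ne', Finset.sum_eq_sum_Ico_succ_bot (by omega), ← add_assoc]
      have := hd2 i hi (by omega)
      rwa [Nat.mod_add_mod] at this

theorem sum_flatten_replicate (s : ℕ) (l : List ℕ) :
    (List.replicate s l).flatten.sum = s * l.sum := by
  induction s with
  | zero => simp
  | succ s ih => rw [List.replicate_succ, List.flatten_cons, List.sum_append, ih]; ring

theorem flatten_replicate_add (s t : ℕ) (l : List ℕ) : (List.replicate (s + t) l).flatten =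
    (List.replicate s l).flatten ++ (List.replicate t l).flatten := by
  rw [List.replicate_add, List.flatten_append]

/-- Strips of two kinds, first at most `a` strips of the first kind. -/
theorem route_of_strips (hA : 0 < A) {s₁ : ℕ} (l₁ l₂ : List ℕ)
    (h₀ : routeCheck A (List.replicate A l₂).flatten 0 0 true true = true)
    (h₁ : routeCheck A ((List.replicate s₁ l₁).flatten ++ (List.replicate A l₂).flatten)
      0 0 true true = true) {s₂ : ℕ} (hd : A ∣ s₁ * l₁.sum + s₂ * l₂.sum) :
    Route A 0 0 true ((List.replicate s₁ l₁).flatten ++ (List.replicate s₂ l₂).flatten) := by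
  obtain ⟨b₀, -, h₀⟩ := routeCheck_sound _ _ _ _ _ h₀ rfl
  obtain ⟨b₁, -, h₁⟩ := routeCheck_sound _ _ _ _ _ h₁ rfl
  have hq : ∀ q, Route A 0 0 true (List.replicate (A * q) l₂).flatten := by
    intro q
    induction q with
    | zero => trivial
    | succ q ih =>
      rw [mul_add, mul_one, add_comm, flatten_replicate_add]
      refine Route.append hA ih _ hA h₀.of_zero ?_
      rw [sum_flatten_replicate, zero_add]
      exact Nat.dvd_mul_right _ _
  -- First come the s₁ strips and s₂ mod A others, a prefix of the checked list; then blocks of A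
  -- strips, each starting with a new part.
  rw [← Nat.mod_add_div s₂ A, flatten_replicate_add, ← List.append_assoc]
  refine Route.append hA (hq _) _ hA ?_ ?_
  · rw [← Nat.add_sub_cancel' (Nat.mod_lt s₂ hA).le, flatten_replicate_add,
      ← List.append_assoc, Nat.add_sub_cancel' (Nat.mod_lt s₂ hA).le] at h₁
    exact (h₁.of_append).of_zero
  · rw [zero_add, List.sum_append, sum_flatten_replicate, sum_flatten_replicate]
    have h2 : A ∣ A * (s₂ / A) * l₂.sum := Dvd.intro _ (by rw [mul_assoc])
    rw [← Nat.dvd_add_left h2, add_assoc, ← add_mul, Nat.mod_add_div]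
    exact hd

/-- N is congruent to nh modulo A and lies in a window of A consecutive integers, so n mod A
determines it. -/
theorem restOf_eq {A hi n h N p : ℕ} (hA : 0 < A) (hN : N + p * A = n * h)
    (h1 : N < (hi + 1) * h) (h2 : (hi + 1) * h ≤ N + A) : restOf A hi (n % A) h = N := by
  have e : ((hi + 1) * h - 1 + (A - n % A) * h) % A = (hi + 1) * h - 1 - N := by
    obtain ⟨y, hy⟩ := Nat.exists_eq_add_of_le (show N ≤ (hi + 1) * h - 1 by omega)
    rw [hy, Nat.add_sub_cancel_left]
    have h3 : N + y + (A - n % A) * h + (p * A) = y + A * (h * (n / A + 1)) := by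
      have h4 : (A - n % A) * h + n % A * h = A * h := by
        rw [← add_mul, Nat.sub_add_cancel (Nat.mod_lt n hA).le]
      have h5 : n % A * h + A * (h * (n / A)) = n * h := by
        conv_rhs => rw [← Nat.mod_add_div n A]
        ring
      have h6 : A * (h * (n / A + 1)) = A * (h * (n / A)) + A * h := by ring
      omega
    rw [← Nat.add_mul_mod_self_right _ p A, h3, Nat.add_mul_mod_self_left]
    exact Nat.mod_eq_of_lt (by omega)
  rw [restOf, e]
  omega

end Route

/-! ### Choice of the directions of the rows of R -/

section Directions

variable {L : Layout} {m n : ℕ}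

theorem Layout.map_len_eq :
    (List.range (L.s₁ * L.a + L.s₂ * (L.a + 1))).map (L.len n) =
      (List.replicate L.s₁ (rowLengths (n * L.a - L.p₁ * L.A) L.a)).flatten ++
      (List.replicate L.s₂ (rowLengths (n * (L.a + 1) - L.p₂ * L.A) (L.a + 1))).flatten := by
  have h1 : ∀ s ≤ L.s₁, (List.range (s * L.a)).map (L.len n) =
      (List.replicate s (rowLengths (n * L.a - L.p₁ * L.A) L.a)).flatten := by
    intro s
    induction s with
    | zero => simp
    | succ s ih =>
      intro hs
      rw [flatten_replicate_add, ← ih (by omega), add_mul, one_mul, List.range_add,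
        List.map_append, List.map_map]
      congr 1
      simp only [List.replicate_one, List.flatten_singleton, rowLengths]
      refine List.map_congr_left fun o ho => ?_
      rw [List.mem_range] at ho
      rw [Function.comp, Layout.len_of_lt (by nlinarith), add_comm (s * L.a),
        Nat.add_mul_mod_self_right, Nat.mod_eq_of_lt ho]
  have h2 : ∀ s, (List.range (L.s₁ * L.a + s * (L.a + 1))).map (L.len n) =
      (List.replicate L.s₁ (rowLengths (n * L.a - L.p₁ * L.A) L.a)).flatten ++
      (List.replicate s (rowLengths (n * (L.a + 1) - L.p₂ * L.A) (L.a + 1))).flatten := by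
    intro s
    induction s with
    | zero => simpa using h1 _ le_rfl
    | succ s ih =>
      rw [flatten_replicate_add, ← List.append_assoc, ← ih, add_mul, one_mul, ← add_assoc,
        List.range_add, List.map_append, List.map_map]
      congr 1
      simp only [List.replicate_one, List.flatten_singleton, rowLengths]
      refine List.map_congr_left fun o ho => ?_
      rw [List.mem_range] at ho
      rw [Function.comp, Layout.len_of_ge (by omega),
        show L.s₁ * L.a + s * (L.a + 1) + o - L.s₁ * L.a = o + s * (L.a + 1) by omega,
        Nat.add_mul_mod_self_right, Nat.mod_eq_of_lt ho]
  exact h2 _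

theorem sum_rowLengths (N : ℕ) {h : ℕ} (hh : 0 < h) : (rowLengths N h).sum = N :=
  calc (rowLengths N h).sum = ∑ o ∈ Finset.range h, (N + o) / h := rfl
    _ = N := Layout.sum_add_div N hh

/-- The directions of the rows can be chosen so that parts stay linked across `m` rows. -/
def Layout.Directed (L : Layout) (m n : ℕ) (d : ℕ → Bool) : Prop :=
  ∀ i, i + 1 < m →
    Crossing L.A (L.cum n (i + 1) % L.A) (L.len n i) (L.len n (i + 1)) (d i) (d (i + 1))

theorem Layout.Fits.exists_directed_of_check (hF : L.Fits m n) {hi : ℕ} (hs : L.s₁ ≤ L.a)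
    (hd : L.A ∣ m * n)
    (h₁ : n * L.a - L.p₁ * L.A < (hi + 1) * L.a)
    (h₁' : (hi + 1) * L.a ≤ n * L.a - L.p₁ * L.A + L.A)
    (h₂ : n * (L.a + 1) - L.p₂ * L.A < (hi + 1) * (L.a + 1))
    (h₂' : (hi + 1) * (L.a + 1) ≤ n * (L.a + 1) - L.p₂ * L.A + L.A)
    (hcheck : stripsCheck L.A L.a hi = true) : ∃ d, L.Directed m n d := by
  have hA := hF.A_pos
  simp only [stripsCheck, List.all_eq_true, List.mem_range] at hcheck
  have hc := hcheck (n % L.A) (Nat.mod_lt _ hA)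
  have c₀ := hc 0 (by omega)
  have c₁ := hc L.s₁ (by omega)
  rw [stripCheck, restOf_eq hA (Nat.sub_add_cancel hF.le₁) h₁ h₁',
    restOf_eq hA (Nat.sub_add_cancel hF.le₂) h₂ h₂'] at c₀ c₁
  have hR := route_of_strips hA _ _ (by simpa using c₀) c₁ (s₂ := L.s₂) (by
    rw [sum_rowLengths _ hF.a_pos, sum_rowLengths _ (Nat.succ_pos _), ← hF.cum_eq]
    have := hF.cum_add
    rw [← this] at hd
    exact (Nat.dvd_add_left (Nat.dvd_mul_left _ _)).1 hd)
  rw [← Layout.map_len_eq, List.range_eq_range'] at hR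
  obtain ⟨d, -, hd⟩ := Route.exists_directions _ _ _ _ _ _ hR
  refine ⟨d, fun i hi => ?_⟩
  have := hd i (Nat.zero_le _) (by rw [zero_add]; rw [← hF.rows_eq, Layout.rows] at hi; exact hi)
  rwa [zero_add, ← Finset.range_eq_Ico] at this

/-- Rows of equal length can be traversed alternately: each row begins below the end of the previous
one. -/
theorem Layout.exists_directed_of_const {ℓ : ℕ} (hA : 0 < L.A)
    (h : ∀ i < m, L.len n i = ℓ) : ∃ d, L.Directed m n d := by
  refine ⟨fun i => decide (i % 2 = 0), fun i hi => ?_⟩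
  have hc : L.cum n (i + 1) = (i + 1) * ℓ := by
    rw [Layout.cum, Finset.sum_congr rfl fun x hx => h x (by rw [Finset.mem_range] at hx; omega)]
    simp
  rw [h i (by omega), h (i + 1) hi, hc]
  have hr := Nat.mod_lt ((i + 1) * ℓ) hA
  rcases Nat.eq_zero_or_pos ℓ with rfl | hℓ
  · simpa using crossing_zero _ _ _ _
  rcases Nat.mod_two_eq_zero_or_one i with h2 | h2
  · have h3 : (i + 1) % 2 = 1 := by omega
    simp [h2, h3, Crossing]
  · have h3 : (i + 1) % 2 = 0 := by omega
    simp only [h2, h3, Crossing, decide_true, one_ne_zero, decide_false]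
    omega

/-- If every part contains two entire rows, then it suffices to take care of the rows in which a part
ends. -/
theorem Layout.exists_directed_of_le (ha : 2 ≤ L.a) (hA : 0 < L.A)
    (h2 : ∀ i, 2 ≤ L.len n i) (h3 : ∀ i, 3 * L.len n i ≤ L.A) : ∃ d, L.Directed m n d := by
  classical
  set r : ℕ → ℕ := fun i => L.cum n (i + 1) % L.A with hr
  have hstep : ∀ i, r i + L.len n (i + 1) < L.A ∧ r (i + 1) = r i + L.len n (i + 1) ∨
      L.A ≤ r i + L.len n (i + 1) ∧ r (i + 1) + L.A = r i + L.len n (i + 1) := by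
    intro i
    have e : r (i + 1) = (r i + L.len n (i + 1)) % L.A := by
      simp only [hr]
      rw [Layout.cum_succ (i + 1), Nat.mod_add_mod]
    have h4 : r i < L.A := Nat.mod_lt _ hA
    have h5 := h3 (i + 1)
    by_cases h6 : r i + L.len n (i + 1) < L.A
    · exact Or.inl ⟨h6, by rw [e, Nat.mod_eq_of_lt h6]⟩
    · refine Or.inr ⟨by omega, ?_⟩
      rw [e, Nat.mod_eq_sub_mod (by omega), Nat.mod_eq_of_lt (by omega)]
      omega
  have hrA : ∀ i, r i < L.A := fun i => Nat.mod_lt _ hA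
  -- Lengths drop only after the last row of a strip; as a ≥ 2, the row before it is in the same
  -- strip, where lengths grow by at most one per step.
  have hpeak : ∀ i, L.len n (i + 2) < L.len n (i + 1) → L.len n (i + 1) ≤ L.len n i + 1 := by
    intro i hi
    change L.len n (i + 1 + 1) < _ at hi
    have ha0 : 0 < L.a := by omega
    have b1 := Layout.lt_top_add_height ha0 (i + 1)
    rcases (show i + 1 + 1 ≤ L.top (i + 1) + L.height (i + 1) by omega).lt_or_eq with h | h
    · have := (Layout.len_succ_of_lt (n := n) ha0 h).2.2.2.2.1
      omega
    · have b2 : 2 ≤ L.height (i + 1) := by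
        rcases Layout.height_eq (L := L) (i + 1) with h | h <;> omega
      obtain ⟨c1, c2, -⟩ := Layout.strip_congr ha0 (i := i + 1) (i' := i) (by omega) (by omega)
      exact (Layout.len_succ_of_lt (n := n) ha0 (i := i) (by omega)).2.2.2.2.2.1
  -- `bd i`: a cut falls strictly inside row i, leaving `r i` cells after it. Since rows have at
  -- most A/3 cells, such rows are at least three apart. A cut row goes against the direction `up i`
  -- of both its neighbours, so one of its two crossings is automatic. The other is the crossing
  -- below if `r i` is at least the length of the row above (handled by `hpeak`), else the crossing
  -- above, which needs just `r i` below that length.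
  let bd : ℕ → Prop := fun i => 0 < r i ∧ r i < L.len n i
  let up : ℕ → Bool := fun i => decide (1 ≤ i ∧ L.len n (i - 1) ≤ r i)
  refine ⟨fun i => if bd i then !up i else if bd (i + 1) then up (i + 1) else
    if 1 ≤ i ∧ bd (i - 1) then up (i - 1) else true, fun i _ => ?_⟩
  change Crossing L.A (r i) _ _ _ _
  have s0 := hstep i
  have s1 := hstep (i + 1)
  have p0 := h2 i
  have p1 := h2 (i + 1)
  have q0 := h3 i
  have q1 := h3 (i + 1)
  have q2 := h3 (i + 2)
  have hrA0 := hrA i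
  simp only [add_assoc, Nat.reduceAdd] at s1 ⊢
  by_cases hz : r i = 0
  · have key : ∀ b b', Crossing L.A (r i) (L.len n i) (L.len n (i + 1)) b b' := fun b b' => by
      rw [hz]
      exact crossing_zero _ _ _ _
    exact key _ _
  by_cases hb : bd i
  · have hb' := hb
    simp only [bd] at hb'
    have n1 : ¬ bd (i + 1) := by simp only [bd]; omega
    have n2 : ¬ bd (i + 2) := by simp only [bd]; omega
    simp only [hb, n1, n2, if_true, if_false, Nat.add_sub_cancel, and_true,
      show 1 ≤ i + 1 by omega]
    by_cases hu : up i = true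
    · rw [hu]
      simp only [up, decide_eq_true_eq] at hu
      have hp := hpeak (i - 1)
      rw [show i - 1 + 2 = i + 1 by omega, show i - 1 + 1 = i by omega] at hp
      simp only [Bool.not_true, Crossing]
      omega
    · rw [Bool.eq_false_iff.2 hu]
      simp [Crossing]
  · by_cases hb1 : bd (i + 1)
    · simp only [hb, hb1, if_true, if_false]
      simp only [bd] at hb hb1
      by_cases hu : up (i + 1) = true
      · rw [hu]
        simp [Crossing]
      · have hu' := hu
        rw [Bool.eq_false_iff.2 hu]
        simp only [up, decide_eq_true_eq, Nat.add_sub_cancel] at hu'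
        simp only [Bool.not_false, Crossing]
        omega
    -- Neither row is cut inside, so any two directions fit: the common part contains both rows
    -- entirely.
    · simp only [hb, hb1, if_false]
      simp only [bd] at hb hb1
      generalize (if 1 ≤ i ∧ bd (i - 1) then up (i - 1) else true) = b
      generalize (if bd (i + 2) then up (i + 2) else
        if 1 ≤ i + 1 ∧ bd (i + 1 - 1) then up (i + 1 - 1) else true) = b'
      cases b <;> cases b' <;> simp only [Crossing] <;> omega

end Directions

/-! ### Contiguity of the parts -/

section Contiguous

variable {L : Layout} {m n k : ℕ}

/-- A set of consecutive unpartitioned cells is connected if the rows are suitably directed. -/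
theorem Layout.Fits.connected_rest (hF : L.Fits m n) {d : ℕ → Bool} (hd : L.Directed m n d)
    (hpos : ∀ i < m, ∀ i' < m, 0 < L.len n i → 0 < L.len n i') {q : ℕ} {S : Finset (Cell m n)}
    (hne : S.Nonempty) (hS : ∀ w : Cell m n, w ∈ S ↔ ¬ L.InStripParts w.1 w.2 ∧
      q * L.A ≤ L.pos n d w.1 w.2 ∧ L.pos n d w.1 w.2 < q * L.A + L.A) :
    ((gridGraph m n).induce {v | v ∈ S}).Connected := by
  refine connected_of_lines _ _ (fun v => (v.1 : ℕ)) hne ?_ ?_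
  · intro v w hvw
    refine reachable_in_row _ ?_ v w (Fin.ext hvw)
    intro i j j' j'' h1 h2 h3 h4
    simp only [Set.mem_ofPred_eq, hS, Fin.lt_def, hF.inStripParts_iff i.2] at *
    have hj := j''.2
    unfold Layout.pos at *
    split_ifs at * <;> omega
  · intro v hv w hw hlt
    simp only [Set.mem_ofPred_eq] at hv hw hlt ⊢
    have hv' := (hS v).1 hv
    have hw' := (hS w).1 hw
    have hwm := w.1.2
    obtain ⟨i, hi⟩ : ∃ i, i = (v.1 : ℕ) := ⟨_, rfl⟩
    have hi1 : i + 1 < m := by omega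
    have b1 : L.pos n d v.1 v.2 < L.cum n (i + 1) := by
      rw [hi]
      exact (hF.pos_lt_cum hv'.1).2
    have b2 := (hF.pos_lt_cum (d := d) hw'.1).1
    have b3 := Layout.cum_mono (L := L) (n := n) (show i + 1 ≤ w.1 by omega)
    have b4 : 0 < L.len n i := by
      have h1 := hv'.1
      rw [hF.inStripParts_iff v.1.2, ← hi] at h1
      have := v.2.2
      omega
    have b5 := hpos i (by omega) (i + 1) hi1 b4
    have b6 := Layout.len_le (L := L) (n := n) hF.a_pos i
    have b7 := Layout.len_le (L := L) (n := n) hF.a_pos (i + 1)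
    obtain ⟨r, hr⟩ : ∃ r, L.cum n (i + 1) = q * L.A + r := ⟨L.cum n (i + 1) - q * L.A, by omega⟩
    have hr0 : 0 < r := by omega
    have hrA : r < L.A := by omega
    have hrmod : L.cum n (i + 1) % L.A = r := by
      rw [hr, add_comm, Nat.add_mul_mod_self_right, Nat.mod_eq_of_lt hrA]
    have hcr := hd i hi1
    rw [hrmod] at hcr
    have hc := Layout.cum_succ (L := L) (n := n) i
    have mem_upper : ∀ b, ∀ hb : b < L.len n i, (if d i then b < r else L.len n i - r ≤ b) →
        ((⟨i, by omega⟩, ⟨n - 1 - b, by omega⟩) : Cell m n) ∈ S := by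
      intro b hb h
      rw [hS, hF.inStripParts_iff (Fin.isLt _)]
      simp only [Layout.pos]
      split_ifs at h ⊢ <;> omega
    have mem_lower : ∀ b, ∀ hb : b < L.len n (i + 1),
        (if d (i + 1) then L.len n (i + 1) - (L.A - r) ≤ b else b < L.A - r) →
        ((⟨i + 1, hi1⟩, ⟨n - 1 - b, by omega⟩) : Cell m n) ∈ S := by
      intro b hb h
      rw [hS, hF.inStripParts_iff (Fin.isLt _)]
      simp only [Layout.pos]
      split_ifs at h ⊢ <;> omega
    -- `b` is the distance from the right end of a column in which both rows belong to the part. The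
    -- part takes the last r cells of the upper row and the first A - r of the lower one, or the
    -- whole row if it is shorter (truncated subtraction); `Crossing` says that these segments
    -- overlap.
    obtain ⟨b, hb, hb', h1, h2⟩ : ∃ b, b < L.len n i ∧ b < L.len n (i + 1) ∧
        (if d i then b < r else L.len n i - r ≤ b) ∧
        (if d (i + 1) then L.len n (i + 1) - (L.A - r) ≤ b else b < L.A - r) := by
      revert hcr
      cases d i <;> cases d (i + 1) <;> simp only [Crossing, Bool.false_eq_true, if_true, if_false]
      · exact fun h => ⟨L.len n i - r, by omega⟩
      · exact fun h => ⟨max (L.len n i - r) (L.len n (i + 1) - (L.A - r)), by omega⟩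
      · exact fun h => ⟨0, by omega⟩
      · exact fun h => ⟨L.len n (i + 1) - (L.A - r), by omega⟩
    refine ⟨_, mem_upper b hb h1, _, mem_lower b hb' h2, hi, by simp only; omega, ?_⟩
    simp [gridGraph, SimpleGraph.boxProd_adj, SimpleGraph.pathGraph_adj]

theorem Layout.Fits.isContiguous (hF : L.Fits m n) (hk : k * L.A = m * n) {d d' : ℕ → Bool}
    {f : Cell m n → Fin k} (hf : ∀ v, (f v : ℕ) = L.label m n d d' v) (hd : L.Directed m n d)
    (hpos : ∀ i < m, ∀ i' < m, 0 < L.len n i → 0 < L.len n i')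
    (hheight : ∀ i < m, L.height i < L.A ∨ L.height i = 1) : IsContiguous f := by
  intro t
  have e : {v | f v = t} = {v | v ∈ part f t} := by
    ext v
    simp [part]
  rw [e]
  have hne : (part f t).Nonempty := by
    rw [← Finset.card_pos, hF.card_part hk hf]
    exact hF.A_pos
  by_cases ht : (t : ℕ) < L.stripParts
  · obtain ⟨v, hv⟩ := id hne
    obtain rfl : f v = t := by simpa [part] using hv
    rw [hf, hF.label_lt_iff] at ht
    exact Layout.connected_of_consecutive hF.A_pos (hF.top_add_height_le v.1.2) (hheight _ v.1.2) hne
      (hF.mem_part_iff hf ht)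
  · exact hF.connected_rest hd hpos hne 
      (hF.mem_rest_part_iff hf (t := t) (q := t - L.stripParts) (by omega))

end Contiguous

/-! ### Existence of a layout with contiguous parts -/

section Existence

variable {m n k A a h : ℕ}

/-- Cutting stops as soon as at most ⌈φa⌉ free columns remain. The window has a + 2 values and A ≤
(a + 2)h, so its lower end is not passed. The last two bounds place the number of uncut cells in an
interval of length A, as `restOf_eq` requires. -/
theorem exists_isStop (hA : 0 < A) (ha : a = Nat.sqrt A) (hh : h = a ∨ h = a + 1) (hn : A ≤ n)
    (hn4 : 4 ≤ n) : ∃ p, IsStop n A a h p ∧ n * h - p * A < (⌈φ * (a : ℝ)⌉₊ + 1) * h ∧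
      (2 ≤ a → (⌈φ * (a : ℝ)⌉₊ + 1) * h ≤ n * h - p * A + A) := by
  classical
  have ha0 : 0 < a := by rw [ha]; exact Nat.sqrt_pos.2 hA
  have ha1 : a * a ≤ A := by rw [ha]; exact Nat.sqrt_le _
  have ha2 : A ≤ a * a + a + a := by rw [ha]; exact Nat.sqrt_le_add _
  have hh0 : 0 < h := by omega
  have hhi := ceil_mul_goldenRatio ha0
  have hhi' := ceil_mul_goldenRatio_lt a
  have hφ := goldenRatio_bounds
  have hlo := floor_div_goldenRatio a
  have hloa : ⌊(a : ℝ) / φ⌋₊ ≤ a := by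
    have h1 : (a : ℝ) ≥ 0 := by positivity
    have : (⌊(a : ℝ) / φ⌋₊ : ℝ) ≤ a := by nlinarith
    exact_mod_cast this
  generalize hlod : ⌊(a : ℝ) / φ⌋₊ = lo at *
  generalize hhid : ⌈φ * (a : ℝ)⌉₊ = hi at *
  have hnhi : 2 ≤ a → hi ≤ n := by
    intro h2
    rcases h2.eq_or_lt with rfl | h3
    · have : (hi : ℝ) < 5 := by push_cast at hhi'; linarith
      have : hi < 5 := by exact_mod_cast this
      omega
    · nlinarith
  have hex : ∃ q, q * A ≤ n * h ∧ n * h - q * A < (hi + 1) * h := by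
    refine ⟨n * h / A, Nat.div_mul_le_self _ _, ?_⟩
    have h1 := Nat.lt_div_mul_add (a := n * h) hA
    have h2 : A ≤ (hi + 1) * h := by
      have : (a + 2) * a ≤ (hi + 1) * h := Nat.mul_le_mul (by omega) (by omega)
      nlinarith
    omega
  obtain ⟨h1, h2⟩ := Nat.find_spec hex
  have hmin := fun q => Nat.find_min (m := q) hex
  generalize Nat.find hex = p at h1 h2 hmin
  have h3 : p = 0 ∨ (hi + 1) * h ≤ n * h - p * A + A := by
    rcases Nat.eq_zero_or_pos p with h0 | h0
    · exact Or.inl h0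
    · right
      have := hmin (p - 1) (by omega)
      have e : (p - 1) * A + A = p * A := by
        rw [← Nat.succ_mul, Nat.succ_eq_add_one, Nat.sub_add_cancel h0]
      by_contra hcon
      exact this ⟨by omega, by omega⟩
  have hlow : lo ≤ (n * h - p * A) / h := by
    rw [Nat.le_div_iff_mul_le hh0]
    rcases h3 with rfl | h3
    · have : lo * h ≤ n * h := Nat.mul_le_mul_right _ (by nlinarith)
      omega
    · have h4 : A ≤ (a + 2) * h := by
        have : (a + 2) * a ≤ (a + 2) * h := Nat.mul_le_mul_left _ (by omega)
        nlinarith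
      have h5 : (hi + 1) * h = lo * h + (a + 2) * h := by rw [hhi]; ring
      omega
  refine ⟨p, ⟨⟨h1, ?_⟩, ?_⟩, h2, fun ha => ?_⟩
  · rw [sub_ceilDiv hh0 h1, hlod, hhid, Set.mem_Icc]
    exact ⟨hlow, Nat.lt_succ_iff.1 ((Nat.div_lt_iff_lt_mul hh0).2 h2)⟩
  · rintro q ⟨hq1, hq2⟩
    by_contra hcon
    refine hmin q (by omega) ⟨hq1, ?_⟩
    rw [sub_ceilDiv hh0 hq1, hlod, hhid, Set.mem_Icc] at hq2
    exact (Nat.div_lt_iff_lt_mul hh0).1 (Nat.lt_succ_iff.2 hq2.2)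
  -- If nothing is cut, the lower bound comes from n ≥ ⌈φa⌉ and h ≤ A.
  · rcases h3 with rfl | h3
    · have h4 : hi * h ≤ n * h := Nat.mul_le_mul_right _ (hnhi ha)
      have h5 : h ≤ A := by
        have : 2 * a ≤ a * a := Nat.mul_le_mul_right _ ha
        omega
      rw [add_mul]
      omega
    · exact h3

/-- Divide by a + 1: if the remainder r is positive, take one more strip and lower a + 1 - r of the
strips by one row. Since m ≥ a², there are enough strips. The bound s₁ ≤ a makes the verification
finite. -/
theorem exists_strips (ha : 0 < a) (hm : a * a ≤ m) :
    ∃ s₁ ≤ a, ∃ s₂, s₁ * a + s₂ * (a + 1) = m := by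
  have h1 := Nat.div_add_mod' m (a + 1)
  have h2 := Nat.mod_lt m (show 0 < a + 1 by omega)
  generalize m / (a + 1) = q at h1
  generalize m % (a + 1) = r at h1 h2
  rcases Nat.eq_zero_or_pos r with rfl | hr
  · exact ⟨0, by omega, q, by omega⟩
  · have hq : a ≤ q + r := by
      by_contra hcon
      have : q * (a + 1) ≤ (a - r - 1) * (a + 1) := Nat.mul_le_mul_right _ (by omega)
      obtain ⟨b, rfl⟩ : ∃ b, a = r + 1 + b := ⟨a - (r + 1), by omega⟩
      rw [show r + 1 + b - r - 1 = b by omega] at this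
      nlinarith
    obtain ⟨b, hb⟩ := Nat.exists_eq_add_of_le hq
    obtain ⟨c, hc⟩ := Nat.exists_eq_add_of_le (show r ≤ a + 1 by omega)
    refine ⟨c, by omega, b, ?_⟩
    have e2 : q + 1 = c + b := by omega
    have e3 : (q + 1) * (a + 1) = (c + b) * (a + 1) := by rw [e2]
    linarith

theorem stripsCheck_of_lt (ha : 2 ≤ a) (h1 : a * a ≤ A) (h2 : A ≤ a * a + a + a) (hA : A < 30) :
    stripsCheck A a ⌈φ * (a : ℝ)⌉₊ = true := by
  have hφ := goldenRatio_bounds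
  have h6 : a < 6 := by
    by_contra hcon
    nlinarith
  have key : a = 2 ∨ a = 3 ∨ a = 4 ∨ a = 5 := by omega
  rcases key with rfl | rfl | rfl | rfl
  · have e : ⌈φ * ((2 : ℕ) : ℝ)⌉₊ = 4 := by
      rw [Nat.ceil_eq_iff (by norm_num)]
      constructor <;> push_cast <;> linarith
    rw [e]
    exact stripsCheck_two A (Finset.mem_Icc.2 ⟨h1, h2⟩)
  · have e : ⌈φ * ((3 : ℕ) : ℝ)⌉₊ = 5 := by
      rw [Nat.ceil_eq_iff (by norm_num)]
      constructor <;> push_cast <;> linarith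
    rw [e]
    exact stripsCheck_three A (Finset.mem_Icc.2 ⟨h1, h2⟩)
  · have e : ⌈φ * ((4 : ℕ) : ℝ)⌉₊ = 7 := by
      rw [Nat.ceil_eq_iff (by norm_num)]
      constructor <;> push_cast <;> linarith
    rw [e]
    exact stripsCheck_four A (Finset.mem_Icc.2 ⟨h1, h2⟩)
  · have e : ⌈φ * ((5 : ℕ) : ℝ)⌉₊ = 9 := by
      rw [Nat.ceil_eq_iff (by norm_num)]
      constructor <;> push_cast <;> linarith
    rw [e]
    exact stripsCheck_five A (Finset.mem_Icc.2 ⟨h1, by omega⟩)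

theorem three_mul_ceil_le (ha : 5 ≤ a) (h1 : a * a ≤ A) (hA : 30 ≤ A) :
    3 * (⌈φ * (a : ℝ)⌉₊ + 1) ≤ A := by
  have hφ := goldenRatio_bounds
  have hhi := ceil_mul_goldenRatio_lt a
  generalize ⌈φ * (a : ℝ)⌉₊ = hi at *
  rcases ha.eq_or_lt with rfl | h6
  · have : (hi : ℝ) < 10 := by
      push_cast at hhi
      linarith
    have : hi < 10 := by exact_mod_cast this
    omega
  · have h6' : (6 : ℝ) ≤ a := by exact_mod_cast h6
    have h7 : (3 * (hi + 1) : ℝ) ≤ a * a := by nlinarith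
    have h8 : 3 * (hi + 1) ≤ a * a := by exact_mod_cast h7
    omega

theorem two_le_floor (ha : 5 ≤ a) : 2 ≤ ⌊(a : ℝ) / φ⌋₊ := by
  have hφ := goldenRatio_bounds
  rw [Nat.le_floor_iff (by positivity), le_div_iff₀ (by linarith)]
  have : (5 : ℝ) ≤ a := by exact_mod_cast ha
  push_cast
  linarith

theorem floor_pos (ha : 2 ≤ a) : 0 < ⌊(a : ℝ) / φ⌋₊ := by
  have hφ := goldenRatio_bounds
  rw [Nat.floor_pos, le_div_iff₀ (by linarith)]
  have : (2 : ℝ) ≤ a := by exact_mod_cast ha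
  linarith

theorem exists_layout (hm : 0 < m) (hmn : m ≤ n) (hn4 : 4 ≤ n) (hnk : n ≤ k) (hk : k ∣ m * n) :
    ∃ L : Layout, IsLayout m n k L ∧ (∃ d, L.Directed m n d) ∧
      (∀ i < m, ∀ i' < m, 0 < L.len n i → 0 < L.len n i') ∧
      ∀ i < m, L.height i < L.A ∨ L.height i = 1 := by
  obtain ⟨hkA, hA, hAm⟩ := partSize hm (by omega) hnk hk
  obtain ⟨A, hAd⟩ : ∃ A, A = m * n / k := ⟨_, rfl⟩
  rw [← hAd] at hkA hA hAm
  obtain ⟨a, had⟩ : ∃ a, a = Nat.sqrt A := ⟨_, rfl⟩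
  have ha0 : 0 < a := by rw [had]; exact Nat.sqrt_pos.2 hA
  have ha1 : a * a ≤ A := by rw [had]; exact Nat.sqrt_le _
  have ha2 : A ≤ a * a + a + a := by rw [had]; exact Nat.sqrt_le_add _
  obtain ⟨p₁, hp₁, hN₁, hN₁'⟩ := exists_isStop hA had (Or.inl rfl) (hAm.trans hmn) hn4
  obtain ⟨p₂, hp₂, hN₂, hN₂'⟩ := exists_isStop hA had (Or.inr rfl) (hAm.trans hmn) hn4
  have hmod : m % a ≤ m / a := by
    rw [had]
    exact sqrt_mod_le_div hA hAm
  have hlayout : ∀ s₁ s₂, s₁ * a + s₂ * (a + 1) = m →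
      IsLayout m n k ⟨A, a, s₁, s₂, 0, p₁, p₂⟩ := fun s₁ s₂ hs =>
    ⟨hAd, had, by simpa using hs, by simp [hmod], hp₁, hp₂⟩
  rcases (show 1 ≤ a from ha0).eq_or_lt with ha | ha
  · subst ha
    -- For A ≤ 3 single rows serve as strips, so all uncut row lengths agree.
    refine ⟨⟨A, 1, m, 0, 0, p₁, p₂⟩, hlayout _ _ (by simp), ?_⟩
    have hlen : ∀ i < m, (⟨A, 1, m, 0, 0, p₁, p₂⟩ : Layout).len n i = n * 1 - p₁ * A := by
      intro i hi
      rw [Layout.len_of_lt (by simpa using hi)]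
      simp [Nat.mod_one]
    refine ⟨Layout.exists_directed_of_const hA hlen, fun i hi i' hi' h => ?_, fun i hi => ?_⟩
    · rwa [hlen i' hi', ← hlen i hi]
    · right
      simp only [Layout.height, mul_one, if_pos hi]
  obtain ⟨s₁, hs₁, s₂, hs⟩ := exists_strips ha0 (ha1.trans hAm)
  obtain ⟨L, hL⟩ : ∃ L : Layout, L = ⟨A, a, s₁, s₂, 0, p₁, p₂⟩ := ⟨_, rfl⟩
  have hLlay : IsLayout m n k L := hL ▸ hlayout s₁ s₂ hs
  have hF := hLlay.fits hm (by omega) hnk hk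
  have eA : L.A = A := by rw [hL]
  have ea : L.a = a := by rw [hL]
  have e₁ : L.s₁ = s₁ := by rw [hL]
  have ep₁ : L.p₁ = p₁ := by rw [hL]
  have ep₂ : L.p₂ = p₂ := by rw [hL]
  have hN₁' := hN₁' ha
  have hN₂' := hN₂' ha
  have hhi := ceil_mul_goldenRatio ha0
  have hlo0 := floor_pos ha
  have hlo2 : 30 ≤ A → 2 ≤ ⌊(a : ℝ) / φ⌋₊ := fun h => two_le_floor (by rw [had, Nat.le_sqrt]; omega)
  have hhi3 : 30 ≤ A → 3 * (⌈φ * (a : ℝ)⌉₊ + 1) ≤ A := fun h =>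
    three_mul_ceil_le (by rw [had, Nat.le_sqrt]; omega) ha1 h
  have hcheck : A < 30 → stripsCheck A a ⌈φ * (a : ℝ)⌉₊ = true := stripsCheck_of_lt ha ha1 ha2
  generalize ⌈φ * (a : ℝ)⌉₊ = hi at *
  generalize ⌊(a : ℝ) / φ⌋₊ = lo at *
  have hrest : ∀ i, lo * L.height i ≤ L.rest n i ∧ L.rest n i < (hi + 1) * L.height i := by
    intro i
    have hd : ∀ h N, a ≤ h → (hi + 1) * h ≤ N + A → lo * h ≤ N := by
      intro h N h1 h2
      have h3 : A ≤ (a + 2) * h := by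
        have : (a + 2) * a ≤ (a + 2) * h := Nat.mul_le_mul_left _ h1
        nlinarith
      have h4 : (hi + 1) * h = lo * h + (a + 2) * h := by rw [hhi]; ring
      omega
    unfold Layout.rest Layout.height Layout.parts
    rw [eA, ea, ep₁, ep₂]
    split_ifs
    · exact ⟨hd _ _ le_rfl hN₁', hN₁⟩
    · exact ⟨hd _ _ (by omega) hN₂', hN₂⟩
  have hlen : ∀ i, lo ≤ L.len n i ∧ L.len n i ≤ hi + 1 := by
    intro i
    have hh := Layout.height_pos hF.a_pos i
    obtain ⟨h1, h2⟩ := hrest i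
    refine ⟨?_, Layout.len_le_of_rest hF.a_pos ?_⟩
    · rw [Layout.len, Nat.le_div_iff_mul_le hh]
      omega
    · exact Nat.lt_succ_iff.1 ((Nat.div_lt_iff_lt_mul hh).2 h2)
  refine ⟨L, hLlay, ?_, fun i _ i' _ _ => hlo0.trans_le (hlen i').1, fun i _ => Or.inl ?_⟩
  -- From A = 30 on, three rows of the maximal length ⌈φa⌉ + 1 fit into A cells; for a = 5 this
  -- length is 10, which explains the threshold.
  · rcases le_or_gt 30 A with hA30 | hA30
    · have h2 := hlo2 hA30
      have h3 := hhi3 hA30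
      refine Layout.exists_directed_of_le (by omega) (by omega) (fun i => h2.trans (hlen i).1)
        fun i => ?_
      have := (hlen i).2
      omega
    · refine hF.exists_directed_of_check (hi := hi) (by omega) ?_ (by rwa [eA, ea, ep₁])
        (by rwa [eA, ea, ep₁]) (by rwa [eA, ea, ep₂]) (by rwa [eA, ea, ep₂]) ?_
      · rw [eA, ← hkA]
        exact Nat.dvd_mul_left _ _
      · rw [eA, ea]
        exact hcheck hA30
  · have : a + 1 < A := by nlinarith
    rcases Layout.height_eq (L := L) i with h | h <;> omega

theorem exists_isContiguous (hm : 0 < m) (hmn : m ≤ n) (hn4 : 4 ≤ n) (hnk : n ≤ k)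
    (hk : k ∣ m * n) : ∃ f : Cell m n → Fin k, IsCautiousStriping f ∧ IsContiguous f := by
  obtain ⟨L, hL, ⟨d, hd⟩, hpos, hheight⟩ := exists_layout hm hmn hn4 hnk hk
  have hF := hL.fits hm (by omega) hnk hk
  have hkA := (partSize hm (by omega) hnk hk).1
  rw [← hL.1] at hkA
  exact ⟨fun v => ⟨L.label m n d d v, hF.label_lt_card hkA d d v⟩, ⟨L, d, d, hL, fun _ => rfl⟩,
    hF.isContiguous hkA (fun _ => rfl) hd hpos hheight⟩

end Existence

end GridStriping

/-! ### The theorem -/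

open GridStriping in
theorem theorem2 :
    ∃ C : ℝ, ∀ m n k : ℕ, 0 < m → m ≤ n → 4 ≤ n → n ≤ k → k ∣ m * n →
      (∃ f : Cell m n → Fin k, IsCautiousStriping f ∧ IsContiguous f) ∧
      ∀ f : Cell m n → Fin k, IsCautiousStriping f →
        IsBalanced f ∧
        (IsContiguous f → ∀ g : Cell m n → Fin k, IsBalanced g →
          (totalPerimeter f : ℝ) ≤
            (1 + 1 / (⌈2 * √((m * n / k : ℕ) : ℝ)⌉₊ : ℝ) +
              ((⌈φ * √((m * n / k : ℕ) : ℝ)⌉₊ : ℝ) * (√5 / 2 - 1) + C) / n) *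
              totalPerimeter g ∧
          (totalPerimeter f : ℝ) ≤ 1.69 * totalPerimeter g) := by
  refine ⟨17, fun m n k hm hmn hn4 hnk hk => ⟨exists_isContiguous hm hmn hn4 hnk hk,
    fun f hf => ⟨(hf.isBalanced hm (by omega) hnk hk).2, fun hcont g hg => ?_⟩⟩⟩
  have hg' := hg.le_totalPerimeter (partSize hm (by omega) hnk hk).1
  have hgR : (k * (2 * ⌈2 * √((m * n / k : ℕ) : ℝ)⌉₊) : ℝ) ≤ totalPerimeter g := by
    exact_mod_cast hg'
  constructor
  · refine (hf.totalPerimeter_le hm (by omega) hnk hk rfl).trans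
      (mul_le_mul_of_nonneg_left hgR ?_)
    have : (0 : ℝ) ≤ √5 / 2 - 1 := by
      have : (2 : ℝ) ≤ √5 := Real.le_sqrt_of_sq_le (by norm_num)
      linarith
    positivity
  · have h := hf.hundred_mul_totalPerimeter_le hm hmn hnk hk hcont rfl
    have h1 : 100 * totalPerimeter f ≤ 169 * totalPerimeter g := by omega
    have h2 : (100 * totalPerimeter f : ℝ) ≤ 169 * totalPerimeter g := by exact_mod_cast h1
    linarith
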